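/- **Corollary 3.6.** For a discrete set $A\subset\mathbb R^n$ and $s>0$ let $\rho_s(A)=\sum_{x\in A}\exp(-\pi\|x\|^2/s^2)$, and for a lattice $\mathcal L\subset\mathbb R^n$ (of any rank $d\le n$) let $D_{\mathcal L,s}$ be the discrete Gaussian distribution, under which $x\in\mathcal L$ has probability $\rho_s(\{x\})/\rho_s(\mathcal L)$. There are universal constants $C_1,C_2>0$ and a randomized algorithm (a single program for a word RAM that can draw uniform random integers) which takes as input $n$, a step parameter $\ell\in\mathbb N=\{0,1,\dots\}$, a confidence parameter $\kappa\ge 2$ (a real number, of which the algorithm only needs $\lfloor\kappa\rfloor$), and $M=\lceil(32\kappa)^{\ell+1}2^n\rceil$ vectors of a lattice $\mathcal L\subset\mathbb R^n$ of rank $d$, given by their integer coordinates with respect to a basis of $\mathcal L$, and which outputs $\lceil 2^{n/2}\rceil$ vectors of $\mathcal L$, such that the following holds. 1. For every $s>0$, if the input vectors are independent samples from $D_{\mathcal L,s}$, then the joint distribution of the output vectors is within statistical distance $\ell M\exp(C_1n-C_2\kappa)$ of that of $\lceil 2^{n/2}\rceil$ independent samples from $D_{\mathcal L,2^{-\ell/2}s}$.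 2. On every input, and whatever the random choices, the algorithm halts after at most $\max(1,\ell)\cdot M\cdot\mathrm{poly}(n,\log\kappa)$ steps, and it uses words of $O(\log M+B)$ bits only, where $B$ bounds the bit lengths of the input coordinates. Moreover, let $\lambda(r)=\rho_{r/\sqrt2}(\mathcal L)^2/(\rho_r(\mathcal L)\,\rho_r(2\mathcal L))$ be the loss factor of one combining step at parameter $r$. Then for every lattice $\mathcal L\subset\mathbb R^n$, $s>0$ and $\ell\in\mathbb N$ the accumulated loss factor satisfies $\prod_{i=0}^{\ell-1}\lambda(2^{-i/2}s)\ge 2^{-n/2}$. -/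

import Mathlib

/-! ### Lattices and the discrete Gaussian distribution

A lattice of rank `d` in `ℝⁿ` is a discrete `ℤ`-submodule `L` of `EuclideanSpace ℝ (Fin n)` together
with a `ℤ`-basis of it indexed by `Fin d`; any rank `d ≤ n` is allowed. -/

/-- `ρ_s(A) = ∑_{x ∈ A} exp (-π ‖x‖² / s²)`. -/
noncomputable def gaussianMass {n : ℕ} (s : ℝ) (A : Set (EuclideanSpace ℝ (Fin n))) : ℝ :=
  ∑' x : A, Real.exp (-Real.pi * ‖(x : EuclideanSpace ℝ (Fin n))‖ ^ 2 / s ^ 2)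

theorem summable_gaussian {n : ℕ} (L : Submodule ℤ (EuclideanSpace ℝ (Fin n)))
    [DiscreteTopology L] {s : ℝ} (hs : 0 < s) :
    Summable fun x : L =>
      Real.exp (-Real.pi * ‖(x : EuclideanSpace ℝ (Fin n))‖ ^ 2 / s ^ 2) := by
  obtain ⟨k, hk⟩ : ∃ k : ℕ, Module.finrank ℤ L < 2 * k := ⟨Module.finrank ℤ L + 1, by omega⟩
  have ha : 0 < Real.pi / s ^ 2 := by positivity
  have h1 := ZLattice.summable_norm_rpow L (-(2 * k : ℕ) : ℝ)
    (by rw [neg_lt_neg_iff]; exact_mod_cast hk)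
  refine Summable.of_norm_bounded_eventually (h1.mul_left (k.factorial / (Real.pi / s ^ 2) ^ k)) ?_
  refine (Set.finite_singleton (0 : L)).subset fun x hx => ?_
  by_contra hx0
  apply hx
  have hx1 : 0 < ‖(x : EuclideanSpace ℝ (Fin n))‖ :=
    norm_pos_iff.2 fun h => hx0 (Subtype.ext h)
  set t := ‖(x : EuclideanSpace ℝ (Fin n))‖ with ht
  have h2 := Real.pow_div_factorial_le_exp (Real.pi / s ^ 2 * t ^ 2) (by positivity) k
  rw [Set.mem_ofPred_eq, Real.norm_of_nonneg (Real.exp_pos _).le, Submodule.coe_norm, ← ht, Real.rpow_neg hx1.le,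
    Real.rpow_natCast, show -Real.pi * t ^ 2 / s ^ 2 = -(Real.pi / s ^ 2 * t ^ 2) by ring,
    Real.exp_neg]
  have h3 : (k.factorial : ℝ) / (Real.pi / s ^ 2) ^ k * (t ^ (2 * k))⁻¹
      = ((Real.pi / s ^ 2 * t ^ 2) ^ k / k.factorial)⁻¹ := by
    rw [inv_div, mul_pow, ← pow_mul]
    field_simp
  rw [h3]
  exact inv_anti₀ (by positivity) h2

/-- The discrete Gaussian distribution `D_{L,s}`: the probability of `x ∈ L` is proportional to
`ρ_s(x) = exp (-π ‖x‖² / s²)`. -/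
noncomputable def discreteGaussian {n : ℕ} (L : Submodule ℤ (EuclideanSpace ℝ (Fin n)))
    [DiscreteTopology L] (s : ℝ) (hs : 0 < s) : PMF L :=
  PMF.normalize
    (fun x : L =>
      ENNReal.ofReal (Real.exp (-Real.pi * ‖(x : EuclideanSpace ℝ (Fin n))‖ ^ 2 / s ^ 2)))
    (fun h => by
      have := ENNReal.tsum_eq_zero.1 h 0
      simp at this)
    (summable_gaussian L hs).tsum_ofReal_ne_top

/-- The loss factor of one combining step at parameter `s`:
`ρ_{s/√2}(L)² / (ρ_s(L) ρ_s(2L))`. -/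
noncomputable def lossFactor {n : ℕ} (L : Submodule ℤ (EuclideanSpace ℝ (Fin n))) (s : ℝ) : ℝ :=
  gaussianMass (s / Real.sqrt 2) (L : Set (EuclideanSpace ℝ (Fin n))) ^ 2 /
    (gaussianMass s (L : Set (EuclideanSpace ℝ (Fin n))) *
      gaussianMass s ((fun x => (2 : ℝ) • x) '' (L : Set (EuclideanSpace ℝ (Fin n)))))

/-! ### Probability -/

/-- The joint distribution of `m` independent samples from `p`. -/
noncomputable def iidSamples {α : Type} (p : PMF α) : (m : ℕ) → PMF (Fin m → α)
  | 0 => PMF.pure Fin.elim0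
  | m + 1 => p.bind fun x => (iidSamples p m).map fun y => Fin.cons x y

/-- Statistical (total variation) distance. -/
noncomputable def statDist {α : Type} (p q : PMF α) : ℝ :=
  (1 / 2) * ∑' x, |(p x).toReal - (q x).toReal|

/-! ### A randomized random access machine

Memory: integer registers `reg 0, reg 1, …` and integer arrays `arr 0, arr 1, …`, addressed
indirectly through registers. A program is a finite while-program; it is a fixed finite text
and so names only finitely many registers and arrays. Every elementary step costs one unit of
time. -/

/-- Arithmetic operations (`div` is integer division, with `x / 0 = 0`). -/
inductive ArithOp
  | add | sub | mul | div

def ArithOp.eval : ArithOp → ℤ → ℤ → ℤ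
  | .add, x, y => x + y
  | .sub, x, y => x - y
  | .mul, x, y => x * y
  | .div, x, y => x / y

inductive Prog
  | skip
  /-- `reg x := v` -/
  | const (x : ℕ) (v : ℤ)
  /-- `reg x := reg y ∘ reg z` -/
  | arith (op : ArithOp) (x y z : ℕ)
  /-- `reg x := arr a [reg y]` -/
  | load (x a y : ℕ)
  /-- `arr a [reg y] := reg x` -/
  | store (a y x : ℕ)
  /-- `reg x :=` a fresh uniform element of `{0, …, reg y - 1}` (`0` if `reg y ≤ 0`) -/
  | rand (x y : ℕ)
  | seq (p q : Prog)
  /-- if `0 < reg x` then `p` else `q` -/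
  | ite (x : ℕ) (p q : Prog)
  /-- while `0 < reg x` do `p` -/
  | loop (x : ℕ) (p : Prog)

structure Memory where
  reg : ℕ → ℤ
  arr : ℕ → ℤ → ℤ

def Memory.setReg (σ : Memory) (x : ℕ) (v : ℤ) : Memory :=
  { σ with reg := Function.update σ.reg x v }

def Memory.setArr (σ : Memory) (a : ℕ) (i v : ℤ) : Memory :=
  { σ with arr := Function.update σ.arr a (Function.update (σ.arr a) i v) }

noncomputable def uniformBelow (k : ℤ) : PMF ℤ :=
  if h : 0 < k then PMF.uniformOfFinset (Finset.Ico 0 k) ⟨0, Finset.mem_Ico.2 ⟨le_rfl, h⟩⟩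
  else PMF.pure 0

/-- A configuration: the stack of programs still to be run, and the memory. The machine has halted
when the stack is empty. -/
abbrev Config := List Prog × Memory

/-- One step of the machine. -/
noncomputable def step : Config → PMF Config
  | ([], σ) => PMF.pure ([], σ)
  | (.skip :: K, σ) => PMF.pure (K, σ)
  | (.const x v :: K, σ) => PMF.pure (K, σ.setReg x v)
  | (.arith op x y z :: K, σ) => PMF.pure (K, σ.setReg x (op.eval (σ.reg y) (σ.reg z)))
  | (.load x a y :: K, σ) => PMF.pure (K, σ.setReg x (σ.arr a (σ.reg y)))
  | (.store a y x :: K, σ) => PMF.pure (K, σ.setArr a (σ.reg y) (σ.reg x))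
  | (.rand x y :: K, σ) => (uniformBelow (σ.reg y)).map fun v => (K, σ.setReg x v)
  | (.seq p q :: K, σ) => PMF.pure (p :: q :: K, σ)
  | (.ite x p q :: K, σ) => PMF.pure (if 0 < σ.reg x then p :: K else q :: K, σ)
  | (.loop x p :: K, σ) => PMF.pure (if 0 < σ.reg x then p :: .loop x p :: K else K, σ)

/-- The distribution of the configuration after `t` steps. -/
noncomputable def run : ℕ → Config → PMF Config
  | 0, c => PMF.pure c
  | t + 1, c => (step c).bind (run t)

/-- Worst-case running time: whatever the random choices, the machine has halted after `T` steps. -/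
def HaltsWithin (p : Prog) (σ : Memory) (T : ℕ) : Prop :=
  ∀ c ∈ (run T ([p], σ)).support, c.1 = []

/-- Whatever the random choices, all integers that are in memory at any time of the computation
have at most `w` bits. -/
def UsesWordLength (p : Prog) (σ : Memory) (w : ℕ) : Prop :=
  ∀ t, ∀ c ∈ (run t ([p], σ)).support,
    (∀ x, |c.2.reg x| < 2 ^ w) ∧ ∀ a i, |c.2.arr a i| < 2 ^ w

/-! ### Input and output conventions

A lattice vector is stored as its integer coordinate vector with respect to the given basis `b`. -/

/-- The initial memory: registers `0, …, 4` hold `n`, `d`, `ℓ`, `k` and the number `M` of input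
vectors, and entry `j * d + i` of array `0` holds the `i`-th coordinate of the `j`-th input vector.
Everything else is zero. -/
noncomputable def inputMemory {n d M : ℕ} {L : Submodule ℤ (EuclideanSpace ℝ (Fin n))}
    (b : Module.Basis (Fin d) ℤ L) (ℓ k : ℕ) (x : Fin M → L) : Memory where
  reg r := match r with
    | 0 => n
    | 1 => d
    | 2 => ℓ
    | 3 => k
    | 4 => M
    | _ => 0
  arr a i :=
    if h : a = 0 ∧ 0 ≤ i ∧ i.toNat < M * d then
      b.repr (x (finProdFinEquiv.symm ⟨i.toNat, h.2.2⟩).1)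
        (finProdFinEquiv.symm ⟨i.toNat, h.2.2⟩).2
    else 0

/-- The `m` output vectors: entry `j * d + i` of array `1` holds the `i`-th coordinate of the `j`-th
output vector. -/
noncomputable def outputVectors {n d : ℕ} {L : Submodule ℤ (EuclideanSpace ℝ (Fin n))}
    (b : Module.Basis (Fin d) ℤ L) (m : ℕ) (σ : Memory) : Fin m → L :=
  fun j => ∑ i : Fin d, σ.arr 1 ((j : ℤ) * d + i) • b i

set_option linter.unusedSimpArgs false

/-! ### A relational program logic for the machine -/

/-! One stage turns samples of parameter `s` into fewer samples of parameter `s/√2` by averaging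
pairs `x, y` that agree modulo `2L`. The map `(z, v) ↦ (z + v, z - v)` is a bijection onto such
pairs, and by the parallelogram law it carries the product Gaussian weight of parameter `s/√2` to
that of parameter `s`. So `(x + y)/2` has exactly the right law as soon as the pair has density
proportional to `D(x) D(y)` on same-class pairs (`wsum_same_parity`, `wsum_gaussCoord_same_class`).
Pairing up all vectors inside each class would weight a class of probability `p_c` by `p_c` instead
of `p_c²`, so the pairing has to be thinned.

The thinning is done by Poissonization. Let `K = ⌊κ⌋ / 512`, rounded down, and let a stage receive
`m` vectors; put `A = m / (32 K)`. A Poisson number of vectors, of mean `K A`, goes into a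
dictionary whose cells are indexed by the class and a random label below `J`. Disjoint parts of a
Poisson process are independent (`poissonMean_split`). Hence each of the `A` vectors of the main
segment, which looks into a cell of its class that nobody has opened before, meets a fresh Poisson
process (`poissonMean_mainLoop`). Probing one of `K` slots uniformly finds a given `y` with
probability `θ D(y)`, where `θ = A / J`, up to overflow of the cell (`poissonMean_pick_le`). In the
idealized loop the number of outputs is binomial, and given that number the outputs are independent
samples of the target law (`idealMean_eq`). `freshMean_le` bounds the price of the idealization.

All errors are exponentially small in `K` if `J` lies within constant factors of `A p`, where `p` is
the probability of the most likely class. Since `p` is unknown, `J` is taken to be the largest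
multiplicity of a class among `16 A` separate samples (`psum_le_maxMult`, `psum_maxMult_lt`). The
most likely class is `2L` itself (`parityWeight_le_zero`), so `p = ρ_{s/2}(L) / ρ_s(L)`. With `c =
ρ_{s/√2}(L)² / ρ_s(L)²` the probability that two samples collide, the expected number of outputs is
`A² c / J`, which is of order `(m/K)(c/p)`, and `c/p` is the loss factor. These loss factors
telescope (`prod_lossFactor`): a first ratio of masses is at least `2^{-d/2}` by Cauchy–Schwarz over
the `2^d` classes (`gaussianMass_sq_le`), and the other is at least `1` by monotonicity. This is why
`(32κ)^{ℓ+1} 2^n` vectors last for `ℓ` stages (`stage_gauss_close`, `stages_gauss_close`).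

The Poisson number is a sum of Poisson variables of mean `1/2`, each generated by a rejection walk
that only needs uniform integers; a fixed number of rounds suffices except with tiny probability
(`wsum_iter_poissonStep_le`).

The machine side is a refinement proof: `Sim` says that a program simulates an abstract random
experiment within given time and word bounds, and `stageProg_sim` and `samplerProg_sim` connect the
code with the experiment `stage`. Statistical distance is handled through the one-sided relation
`Close` on test functions with values in `[0, 1]`; working in `ℝ≥0∞` removes all summability
questions. For small `κ` and `ℓ > 0` the claimed distance exceeds `1`, and nothing has to be proved
about the distribution. -/

theorem PMF.bind_congr_support {α β : Type} (p : PMF α) (f g : α → PMF β)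
    (h : ∀ a ∈ p.support, f a = g a) : p.bind f = p.bind g := by
  ext b
  simp only [PMF.bind_apply]
  refine tsum_congr fun a => ?_
  by_cases ha : p a = 0
  · simp [ha]
  · rw [h a ((PMF.mem_support_iff _ _).2 ha)]

/-- From configuration `c` the machine halts within `T` steps, the distribution of the observation
`out` of its final memory is `ν`, and all memories along the way satisfy `W`. -/
def Ev {Out : Type} (W : Memory → Prop) (out : Memory → Out) (c : Config) (T : ℕ) (ν : PMF Out) :
    Prop :=
  (∀ t, T ≤ t → (run t c).map (fun c' => out c'.2) = ν ∧ ∀ c' ∈ (run t c).support, c'.1 = []) ∧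
    ∀ t, ∀ c' ∈ (run t c).support, W c'.2

theorem Ev.mono {Out : Type} {W : Memory → Prop} {out : Memory → Out} {c : Config} {T T' : ℕ}
    {ν : PMF Out} (h : Ev W out c T ν) (hT : T ≤ T') : Ev W out c T' ν :=
  ⟨fun t ht => h.1 t (hT.trans ht), h.2⟩

theorem run_halted (t : ℕ) (σ : Memory) : run t ([], σ) = PMF.pure ([], σ) := by
  induction t with
  | zero => rfl
  | succ t ih => rw [run, step, PMF.pure_bind, ih]

theorem Ev.halted {Out : Type} {W : Memory → Prop} (out : Memory → Out) {σ : Memory} (h : W σ) :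
    Ev W out ([], σ) 0 (PMF.pure (out σ)) := by
  refine ⟨fun t _ => ?_, fun t c' hc => ?_⟩
  · rw [run_halted, PMF.pure_map]
    exact ⟨rfl, fun c' hc => by rw [PMF.mem_support_pure_iff] at hc; rw [hc]⟩
  · rw [run_halted, PMF.mem_support_pure_iff] at hc
    rw [hc]; exact h

theorem Ev.of_step {Out β : Type} {W : Memory → Prop} {out : Memory → Out} {c : Config} {T : ℕ}
    (μ : PMF β) (g : β → Config) (ν : β → PMF Out) (hW : W c.2) (hs : step c = μ.map g)
    (h : ∀ v ∈ μ.support, Ev W out (g v) T (ν v)) : Ev W out c (T + 1) (μ.bind ν) := by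
  have hr : ∀ t, run (t + 1) c = μ.bind fun v => run t (g v) := fun t => by
    rw [run, hs, PMF.bind_map]; rfl
  refine ⟨fun t ht => ?_, fun t c' hc => ?_⟩
  · obtain ⟨t, rfl⟩ : ∃ u, t = u + 1 := ⟨t - 1, by omega⟩
    rw [hr, PMF.map_bind]
    refine ⟨PMF.bind_congr_support _ _ _ fun v hv => ((h v hv).1 t (by omega)).1, fun c' hc => ?_⟩
    obtain ⟨v, hv, hc⟩ := (PMF.mem_support_bind_iff _ _ _).1 hc
    exact ((h v hv).1 t (by omega)).2 c' hc
  · cases t with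
    | zero =>
      rw [run, PMF.mem_support_pure_iff] at hc
      rw [hc]; exact hW
    | succ t =>
      rw [hr] at hc
      obtain ⟨v, hv, hc⟩ := (PMF.mem_support_bind_iff _ _ _).1 hc
      exact (h v hv).2 t c' hc

theorem Ev.of_step_pure {Out : Type} {W : Memory → Prop} {out : Memory → Out} {c c' : Config}
    {T : ℕ} {ν : PMF Out} (hW : W c.2) (hs : step c = PMF.pure c') (h : Ev W out c' T ν) :
    Ev W out c (T + 1) ν := by
  have := Ev.of_step (out := out) (T := T) (PMF.pure c') id (fun _ => ν) hW
    (by rw [hs, PMF.pure_map]; rfl)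
    (fun v hv => by rw [PMF.mem_support_pure_iff] at hv; rw [hv]; exact h)
  rwa [PMF.pure_bind] at this

/-- Program `p`, started in memory `σ`, runs for at most `T` steps, keeps the memory in `W`, and
simulates the abstract random experiment `ν`: its final memory is related by `R` to the outcome of
the experiment. -/
def Sim {β : Type} (W : Memory → Prop) (p : Prog) (σ : Memory) (T : ℕ) (ν : PMF β)
    (R : β → Memory → Prop) : Prop :=
  W σ → ∀ (Out : Type) (out : Memory → Out) (K : List Prog) (T' : ℕ) (ν' : β → PMF Out),
    (∀ b ∈ ν.support, ∀ σ', R b σ' → W σ' → Ev W out (K, σ') T' (ν' b)) →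
      Ev W out (p :: K, σ) (T + T') (ν.bind ν')

theorem Sim.conseq {β γ : Type} {W : Memory → Prop} {p : Prog} {σ : Memory} {T T₂ : ℕ} {ν : PMF β}
    {R : β → Memory → Prop} (h : Sim W p σ T ν R) (g : β → γ) (R' : γ → Memory → Prop)
    (hT : T ≤ T₂) (hR : ∀ b ∈ ν.support, ∀ σ', W σ' → R b σ' → R' (g b) σ') :
    Sim W p σ T₂ (ν.map g) R' := by
  intro hW Out out K T' ν' h'
  rw [PMF.bind_map]
  exact (h hW Out out K T' _ fun b hb σ' hr hw =>
    h' _ ((PMF.mem_support_map_iff _ _ _).2 ⟨b, hb, rfl⟩) σ' (hR b hb σ' hw hr) hw).mono (by omega)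

theorem Sim.post {β : Type} {W : Memory → Prop} {p : Prog} {σ : Memory} {T T₂ : ℕ} {ν : PMF β}
    {R : β → Memory → Prop} (h : Sim W p σ T ν R) (R' : β → Memory → Prop)
    (hT : T ≤ T₂) (hR : ∀ b ∈ ν.support, ∀ σ', W σ' → R b σ' → R' b σ') : Sim W p σ T₂ ν R' := by
  have := h.conseq id R' hT hR
  rwa [PMF.map_id] at this

theorem Sim.mono {β : Type} {W : Memory → Prop} {p : Prog} {σ : Memory} {T T₂ : ℕ} {ν : PMF β}
    {R : β → Memory → Prop} (h : Sim W p σ T ν R) (hT : T ≤ T₂) : Sim W p σ T₂ ν R :=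
  h.post R hT fun _ _ _ _ h => h

/-- Because `Sim` quantifies over the remaining stack and over the law produced by it, the first
program can be run with the second one pushed onto the stack; associativity of `bind` does the rest.
-/
theorem Sim.seq {β γ : Type} {W : Memory → Prop} {p q : Prog} {σ : Memory} {T₁ T₂ : ℕ} {ν : PMF β}
    {R : β → Memory → Prop} {ν' : β → PMF γ} {R' : γ → Memory → Prop} (h : Sim W p σ T₁ ν R)
    (h' : ∀ b ∈ ν.support, ∀ σ', W σ' → R b σ' → Sim W q σ' T₂ (ν' b) R') :
    Sim W (.seq p q) σ (T₁ + T₂ + 1) (ν.bind ν') R' := by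
  intro hW Out out K T' ν'' h''
  rw [PMF.bind_bind]
  have := Ev.of_step_pure (c := (.seq p q :: K, σ)) hW rfl
    (h hW Out out (q :: K) (T₂ + T') (fun b => (ν' b).bind ν'') fun b hb σ' hr hw =>
      h' b hb σ' hw hr hw Out out K T' ν'' fun c hc =>
        h'' c ((PMF.mem_support_bind_iff _ _ _).2 ⟨b, hb, hc⟩))
  exact this.mono (by omega)

theorem Sim.seq_pure {γ : Type} {W : Memory → Prop} {p q : Prog} {σ : Memory} {T₁ T₂ : ℕ}
    {R : Memory → Prop} {ν : PMF γ} {R' : γ → Memory → Prop}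
    (h : Sim W p σ T₁ (PMF.pure ()) fun _ => R)
    (h' : ∀ σ', W σ' → R σ' → Sim W q σ' T₂ ν R') :
    Sim W (.seq p q) σ (T₁ + T₂ + 1) ν R' := by
  have := Sim.seq (ν' := fun _ => ν) (R' := R') h fun _ _ σ' hw hr => h' σ' hw hr
  rwa [PMF.pure_bind] at this

theorem Sim.ite {β : Type} {W : Memory → Prop} {x : ℕ} {p q : Prog} {σ : Memory} {T : ℕ}
    {ν : PMF β} {R : β → Memory → Prop} (h₁ : 0 < σ.reg x → Sim W p σ T ν R)
    (h₂ : ¬ 0 < σ.reg x → Sim W q σ T ν R) : Sim W (.ite x p q) σ (T + 1) ν R := by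
  intro hW Out out K T' ν' h'
  refine Ev.mono (T := T + T' + 1) ?_ (by omega)
  refine Ev.of_step_pure (c := (.ite x p q :: K, σ)) hW rfl ?_
  split_ifs with h
  · exact h₁ h hW Out out K T' ν' h'
  · exact h₂ h hW Out out K T' ν' h'

/-- Iterate a random transition; the index counts the remaining rounds. -/
noncomputable def iter {S : Type} (f : ℕ → S → PMF S) : ℕ → S → PMF S
  | 0, s => PMF.pure s
  | j + 1, s => (f j s).bind (iter f j)

/-- The loop register is required to equal the number of remaining rounds, so the loop ends after a
number of rounds that does not depend on the random choices. This is the source of all worst-case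
time bounds. -/
theorem Sim.loop {S : Type} {W : Memory → Prop} {x : ℕ} {p : Prog} {T : ℕ} (f : ℕ → S → PMF S)
    (R : ℕ → S → Memory → Prop) (hx : ∀ j s σ, R j s σ → σ.reg x = j) (N : ℕ)
    (hp : ∀ j s σ, j < N → W σ → R (j + 1) s σ → Sim W p σ T (f j s) (R j)) :
    ∀ j s σ, j ≤ N → R j s σ → Sim W (.loop x p) σ (j * (T + 1) + 1) (iter f j s) (R 0) := by
  intro j
  induction j with
  | zero =>
    intro s σ _ hr hW Out out K T' ν' h'
    rw [iter, PMF.pure_bind]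
    refine Ev.mono (T := T' + 1) ?_ (by omega)
    refine Ev.of_step_pure (c := (.loop x p :: K, σ)) hW rfl ?_
    rw [if_neg (by rw [hx _ _ _ hr]; simp)]
    exact h' s ((PMF.mem_support_pure_iff _ _).2 rfl) σ hr hW
  | succ j ih =>
    intro s σ hj hr hW Out out K T' ν' h'
    rw [iter, PMF.bind_bind]
    refine Ev.mono (T := T + ((j * (T + 1) + 1) + T') + 1) ?_ (by rw [Nat.succ_mul]; omega)
    refine Ev.of_step_pure (c := (.loop x p :: K, σ)) hW rfl ?_
    rw [if_pos (by rw [hx _ _ _ hr]; positivity)]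
    refine hp j s σ (by omega) hW hr hW Out out _ _ _ fun b hb σ' hr' hw' => ?_
    exact ih b σ' (by omega) hr' hw' Out out K T' ν' fun c hc =>
      h' c ((PMF.mem_support_bind_iff _ _ _).2 ⟨b, hb, hc⟩)

/-! ### Word bounds and symbolic execution of straight-line code. -/

/-- All integers in memory have at most `w` bits. -/
def Memory.Bdd (w : ℕ) (σ : Memory) : Prop :=
  (∀ x, |σ.reg x| < 2 ^ w) ∧ ∀ a i, |σ.arr a i| < 2 ^ w

theorem Memory.Bdd.setReg {w : ℕ} {σ : Memory} (h : σ.Bdd w) (x : ℕ) {v : ℤ} (hv : |v| < 2 ^ w) :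
    (σ.setReg x v).Bdd w := by
  refine ⟨fun y => ?_, h.2⟩
  unfold Memory.setReg
  by_cases hy : y = x
  · subst hy; simpa using hv
  · simpa [Function.update_of_ne hy] using h.1 y

theorem Memory.Bdd.setArr {w : ℕ} {σ : Memory} (h : σ.Bdd w) (a : ℕ) (i : ℤ) {v : ℤ}
    (hv : |v| < 2 ^ w) : (σ.setArr a i v).Bdd w := by
  refine ⟨h.1, fun b j => ?_⟩
  unfold Memory.setArr
  by_cases hb : b = a
  · subst hb
    by_cases hj : j = i
    · subst hj; simpa using hv
    · simpa [Function.update_of_ne hj] using h.2 b j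
  · simpa [Function.update_of_ne hb] using h.2 b j

/-- The effect of a loop-free deterministic program. -/
def Prog.exec : Prog → Memory → Memory
  | .skip, σ => σ
  | .const x v, σ => σ.setReg x v
  | .arith op x y z, σ => σ.setReg x (op.eval (σ.reg y) (σ.reg z))
  | .load x a y, σ => σ.setReg x (σ.arr a (σ.reg y))
  | .store a y x, σ => σ.setArr a (σ.reg y) (σ.reg x)
  | .rand _ _, σ => σ
  | .seq p q, σ => q.exec (p.exec σ)
  | .ite x p q, σ => if 0 < σ.reg x then p.exec σ else q.exec σ
  | .loop _ _, σ => σ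

/-- A loop-free deterministic program whose intermediate results have at most `w` bits. -/
def Prog.Ok (w : ℕ) : Prog → Memory → Prop
  | .skip, _ => True
  | .const _ v, _ => |v| < 2 ^ w
  | .arith op _ y z, σ => |op.eval (σ.reg y) (σ.reg z)| < 2 ^ w
  | .load _ _ _, _ => True
  | .store _ _ _, _ => True
  | .rand _ _, _ => False
  | .seq p q, σ => p.Ok w σ ∧ q.Ok w (p.exec σ)
  | .ite x p q, σ => (0 < σ.reg x → p.Ok w σ) ∧ (¬ 0 < σ.reg x → q.Ok w σ)
  | .loop _ _, _ => False

/-- Running time of a loop-free program. -/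
def Prog.cost : Prog → ℕ
  | .seq p q => p.cost + q.cost + 1
  | .ite _ p q => p.cost + q.cost + 1
  | _ => 1

theorem Sim.of_pure_step {W : Memory → Prop} {p : Prog} {σ σ' : Memory} (hW : W σ')
    (h : ∀ K, step (p :: K, σ) = PMF.pure (K, σ')) :
    Sim W p σ 1 (PMF.pure ()) fun _ τ => τ = σ' := by
  intro hw Out out K T' ν' h'
  rw [PMF.pure_bind, add_comm]
  exact Ev.of_step_pure hw (h K) (h' () ((PMF.mem_support_pure_iff _ _).2 rfl) _ rfl hW)

theorem Sim.exec {w : ℕ} (p : Prog) : ∀ σ : Memory, σ.Bdd w → p.Ok w σ →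
    Sim (Memory.Bdd w) p σ p.cost (PMF.pure ()) fun _ σ' => σ' = p.exec σ := by
  induction p with
  | skip => exact fun σ h _ => Sim.of_pure_step h fun K => rfl
  | const x v => exact fun σ h hv => Sim.of_pure_step (h.setReg x hv) fun K => rfl
  | arith op x y z => exact fun σ h hv => Sim.of_pure_step (h.setReg x hv) fun K => rfl
  | load x a y => exact fun σ h hv => Sim.of_pure_step (h.setReg x (h.2 _ _)) fun K => rfl
  | store a y x => exact fun σ h hv => Sim.of_pure_step (h.setArr a _ (h.1 _)) fun K => rfl
  | rand x y => exact fun σ h hv => hv.elim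
  | seq p q hp hq =>
    intro σ h hv
    refine Sim.seq_pure (hp σ h hv.1) fun σ' h' e => ?_
    subst e
    exact hq _ h' hv.2
  | ite x p q hp hq =>
    intro σ h hv
    refine Sim.mono (T := max p.cost q.cost + 1) (Sim.ite (fun h0 => ?_) fun h0 => ?_)
      (by simp only [Prog.cost]; omega)
    · simp only [Prog.exec, if_pos h0]
      exact (hp σ h (hv.1 h0)).mono (le_max_left _ _)
    · simp only [Prog.exec, if_neg h0]
      exact (hq σ h (hv.2 h0)).mono (le_max_right _ _)
  | loop x p => exact fun σ h hv => hv.elim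

theorem mem_support_uniformBelow {k v : ℤ} (h : v ∈ (uniformBelow k).support) :
    (0 < k → 0 ≤ v ∧ v < k) ∧ (k ≤ 0 → v = 0) := by
  unfold uniformBelow at h
  split_ifs at h with hk
  · have := Finset.mem_Ico.1 ((PMF.mem_support_uniformOfFinset_iff _ _).1 h)
    exact ⟨fun _ => this, fun h' => by omega⟩
  · rw [PMF.mem_support_pure_iff] at h
    exact ⟨fun h' => absurd h' hk, fun _ => h⟩

theorem Sim.rand {w : ℕ} (x y : ℕ) (σ : Memory) (h : σ.Bdd w) :
    Sim (Memory.Bdd w) (.rand x y) σ 1 (uniformBelow (σ.reg y))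
      fun v σ' => σ' = σ.setReg x v := by
  intro hw Out out K T' ν' h'
  rw [add_comm]
  refine Ev.of_step (c := (.rand x y :: K, σ)) (uniformBelow (σ.reg y))
    (fun v => (K, σ.setReg x v)) ν' hw rfl fun v hv => h' v hv _ rfl ?_
  refine h.setReg x ?_
  have := mem_support_uniformBelow hv
  have h0 := h.1 y
  have h1 := neg_abs_le (σ.reg y)
  have h2 := le_abs_self (σ.reg y)
  rcases lt_or_ge 0 (σ.reg y) with h3 | h3
  · have := this.1 h3
    rw [abs_of_nonneg this.1]; omega
  · rw [this.2 h3]; simp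

theorem Sim.pure_map {β : Type} {W : Memory → Prop} {p : Prog} {σ : Memory} {T : ℕ}
    {R : Memory → Prop} (h : Sim W p σ T (PMF.pure ()) fun _ => R) (b : β) (T₂ : ℕ)
    (R' : β → Memory → Prop) (hT : T ≤ T₂) (hR : ∀ σ', W σ' → R σ' → R' b σ') :
    Sim W p σ T₂ (PMF.pure b) R' := by
  have := h.conseq (fun _ => b) R' hT fun _ _ σ' hw hr => hR σ' hw hr
  rwa [PMF.pure_map] at this

/-- The working form of symbolic execution: a straight-line block leaves one arithmetic side
condition for the word length and one equation about the final memory, both within reach of `simp`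
and `omega`. -/
theorem Sim.det {β : Type} {w : ℕ} {p : Prog} {σ : Memory} {T : ℕ} {b : β}
    {R : β → Memory → Prop} (hT : p.cost ≤ T) (hok : σ.Bdd w → p.Ok w σ)
    (h : R b (p.exec σ)) : Sim (Memory.Bdd w) p σ T (PMF.pure b) R := by
  intro hW
  exact (Sim.exec p σ hW (hok hW)).pure_map b T R hT (fun σ' _ e => e ▸ h) hW

theorem Sim.loop_pure {W : Memory → Prop} {x : ℕ} {p : Prog} {T : ℕ} {N : ℕ} {σ : Memory}
    (R : ℕ → Memory → Prop) (hx : ∀ j σ, R j σ → σ.reg x = j)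
    (hp : ∀ j σ, j < N → W σ → R (j + 1) σ → Sim W p σ T (PMF.pure ()) fun _ => R j)
    (h : R N σ) : Sim W (.loop x p) σ (N * (T + 1) + 1) (PMF.pure ()) fun _ => R 0 := by
  have hi : ∀ j s, iter (fun _ (_ : Unit) => PMF.pure ()) j s = PMF.pure () := by
    intro j
    induction j with
    | zero => intro s; rfl
    | succ j ih => intro s; rw [iter, PMF.pure_bind, ih]
  have := Sim.loop (fun _ (_ : Unit) => PMF.pure ()) (fun j _ => R j) (fun j _ => hx j) N
    (fun j _ => hp j) N () σ le_rfl h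
  rwa [hi] at this

/-! ### Machine subroutines -/

/-- Sequential composition of a list of programs. -/
def Prog.block : List Prog → Prog
  | [] => .skip
  | p :: ps => .seq p (Prog.block ps)

/-- The code `∑ i, (x i mod 2) 2 ^ i` of the class of `x` modulo `2`. -/
def cosetCode {d : ℕ} (x : Fin d → ℤ) : ℤ := ∑ i : Fin d, x i % 2 * 2 ^ (i : ℕ)

/-- The part of the code contributed by the coordinates with index at least `j`. -/
def cosetCodeFrom {d : ℕ} (x : Fin d → ℤ) (j : ℕ) : ℤ :=
  ∑ i : Fin d, if j ≤ i then x i % 2 * 2 ^ ((i : ℕ) - j) else 0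

theorem cosetCodeFrom_zero {d : ℕ} (x : Fin d → ℤ) : cosetCodeFrom x 0 = cosetCode x := by
  simp [cosetCodeFrom, cosetCode]

theorem cosetCodeFrom_self {d : ℕ} (x : Fin d → ℤ) : cosetCodeFrom x d = 0 := by
  refine Finset.sum_eq_zero fun i _ => if_neg ?_
  have := i.2
  omega

theorem cosetCodeFrom_succ {d : ℕ} (x : Fin d → ℤ) (j : Fin d) :
    cosetCodeFrom x j = 2 * cosetCodeFrom x (j + 1) + x j % 2 := by
  have h : x j % 2 = ∑ i : Fin d, if i = j then x j % 2 else 0 := by simp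
  rw [h, cosetCodeFrom, cosetCodeFrom, Finset.mul_sum, ← Finset.sum_add_distrib]
  refine Finset.sum_congr rfl fun i _ => ?_
  rcases lt_trichotomy i j with hij | hij | hij
  · have h1 : (i : ℕ) < j := hij
    rw [if_neg (by omega), if_neg (by omega), if_neg hij.ne]; simp
  · subst hij; simp
  · have h1 : (j : ℕ) < i := hij
    rw [if_pos (by omega), if_pos (by omega), if_neg hij.ne']
    obtain ⟨k, hk⟩ : ∃ k, (i : ℕ) = j + 1 + k := ⟨i - (j + 1), by omega⟩
    rw [hk, show (j : ℕ) + 1 + k - j = k + 1 by omega, show (j : ℕ) + 1 + k - (j + 1) = k by omega]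
    ring

theorem cosetCodeFrom_bounds {d : ℕ} (x : Fin d → ℤ) (j : ℕ) (hj : j ≤ d) :
    0 ≤ cosetCodeFrom x j ∧ cosetCodeFrom x j < 2 ^ (d - j) := by
  induction hj using Nat.decreasingInduction with
  | self => simp [cosetCodeFrom_self]
  | of_succ k hk ih =>
    have h := cosetCodeFrom_succ x ⟨k, hk⟩
    simp only at h
    have h2 : (2 : ℤ) ^ (d - k) = 2 * 2 ^ (d - (k + 1)) := by
      rw [show d - k = d - (k + 1) + 1 by omega]; ring
    have h3 := Int.emod_two_eq_zero_or_one (x ⟨k, hk⟩)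
    rw [h, h2]
    omega

theorem cosetCode_bounds {d : ℕ} (x : Fin d → ℤ) : 0 ≤ cosetCode x ∧ cosetCode x < 2 ^ d := by
  simpa [cosetCodeFrom_zero] using cosetCodeFrom_bounds x 0 (Nat.zero_le d)

/-- Equality of the codes is pushed up through the Horner recursion: the last binary digit of each
partial code is a coordinate modulo `2`, and the remaining digits form the next partial code. -/
theorem cosetCode_eq_iff {d : ℕ} (x y : Fin d → ℤ) :
    cosetCode x = cosetCode y ↔ ∀ i, x i % 2 = y i % 2 := by
  refine ⟨fun h => ?_, fun h => Finset.sum_congr rfl fun i _ => by rw [h i]⟩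
  have key : ∀ j, j ≤ d → cosetCodeFrom x j = cosetCodeFrom y j := by
    intro j
    induction j with
    | zero => intro _; rwa [cosetCodeFrom_zero, cosetCodeFrom_zero]
    | succ j ih =>
      intro hj
      have h1 := cosetCodeFrom_succ x ⟨j, hj⟩
      have h2 := cosetCodeFrom_succ y ⟨j, hj⟩
      simp only at h1 h2
      have := ih (by omega)
      have h3 := Int.emod_two_eq_zero_or_one (x ⟨j, hj⟩)
      have h4 := Int.emod_two_eq_zero_or_one (y ⟨j, hj⟩)
      omega
  intro i
  have h1 := cosetCodeFrom_succ x i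
  have h2 := cosetCodeFrom_succ y i
  have := key i i.2.le
  have := key (i + 1) i.2
  omega

/-- The `j`-th vector stored in array `1` is `x`. -/
def VecAt {d : ℕ} (σ : Memory) (j : ℤ) (x : Fin d → ℤ) : Prop :=
  ∀ i : Fin d, σ.arr 1 (j * d + (i : ℕ)) = x i

open Prog in
/-- Horner step of `cosetProg`. -/
def cosetBody : Prog := block
  [arith .sub 32 32 20, arith .add 34 33 32, load 35 1 34, arith .div 36 35 21,
    arith .add 36 36 36, arith .sub 35 35 36, arith .add 31 31 31, arith .add 31 31 35]

open Prog in
/-- Compute in register `31` the code of the class of the vector with index `reg 30`. -/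
def cosetProg : Prog := .seq
  (block [const 31 0, arith .add 32 1 31, arith .mul 33 30 1]) (.loop 32 cosetBody)

/-- The machine has no remainder operation, so `x mod 2` is computed as `x - 2 (x / 2)`. Division
rounds down, so `2 (x / 2)` can exceed `x` by one in absolute value; this is why the coordinates
must stay two below the word bound. -/
theorem cosetProg_sim {d w : ℕ} (σ : Memory) (x : Fin d → ℤ) (v : ℕ)
    (h1 : σ.reg 1 = d) (h20 : σ.reg 20 = 1) (h21 : σ.reg 21 = 2) (h30 : σ.reg 30 = v)
    (hx : VecAt σ v x) (hb : ((v : ℤ) + 1) * d < 2 ^ w) (hN : (2 : ℤ) ^ d ≤ 2 ^ w) (hw : 1 < w)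
    (hxb : ∀ i, |x i| + 2 ≤ 2 ^ w) :
    Sim (Memory.Bdd w) cosetProg σ (20 * (d + 1)) (PMF.pure ()) fun _ σ' =>
      (∀ r, r < 31 ∨ 40 ≤ r → σ'.reg r = σ.reg r) ∧ σ'.arr = σ.arr ∧ σ'.reg 31 = cosetCode x := by
  have h2w : (4 : ℤ) ≤ 2 ^ w := by
    calc (4 : ℤ) = 2 ^ 2 := by norm_num
      _ ≤ 2 ^ w := pow_le_pow_right₀ (by norm_num) hw
  have hvd : (v : ℤ) * d + d < 2 ^ w := by linarith
  have hvd0 : (0 : ℤ) ≤ (v : ℤ) * d := by positivity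
  refine Sim.mono (T := 7 + (d * (17 + 1) + 1) + 1) ?_ (by omega)
  refine Sim.seq_pure (R := fun σ' => (∀ r, r < 31 ∨ 40 ≤ r → σ'.reg r = σ.reg r) ∧
    σ'.arr = σ.arr ∧ σ'.reg 31 = 0 ∧ σ'.reg 32 = d ∧ σ'.reg 33 = v * d) ?_ ?_
  · refine Sim.det (by decide) (fun _ => ?_) ?_
    · simp [Prog.block, Prog.exec, Prog.Ok, Memory.setReg, ArithOp.eval, h1, h30]
      omega
    · simp [Prog.block, Prog.exec, Memory.setReg, ArithOp.eval, Function.update_apply, h1, h30]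
      intro r hr
      simp [show r ≠ 31 by omega, show r ≠ 32 by omega, show r ≠ 33 by omega]
  · intro σ₁ _ ⟨hf, ha, h31, h32, h33⟩
    have := Sim.loop_pure (W := Memory.Bdd w) (x := 32) (T := 17) (p := cosetBody) (N := d)
      (fun j σ' => (∀ r, r < 31 ∨ 40 ≤ r → σ'.reg r = σ.reg r) ∧
        σ'.arr = σ.arr ∧ σ'.reg 31 = cosetCodeFrom x j ∧ σ'.reg 32 = j ∧ σ'.reg 33 = v * d)
      (fun j _ h => h.2.2.2.1) ?_
      (σ := σ₁) ⟨hf, ha, by rw [cosetCodeFrom_self, h31], h32, h33⟩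
    · refine this.post _ le_rfl fun _ _ τ _ h => ⟨h.1, h.2.1, ?_⟩
      rw [h.2.2.1, cosetCodeFrom_zero]
    · rintro j τ hj _ ⟨hf, ha, h31, h32, h33⟩
      have e20 := hf 20 (by omega)
      have e21 := hf 21 (by omega)
      rw [h20] at e20
      rw [h21] at e21
      have ex := hx ⟨j, hj⟩
      have hs := cosetCodeFrom_succ x ⟨j, hj⟩
      have hb1 := cosetCodeFrom_bounds x (j + 1) hj
      have hb0 := cosetCodeFrom_bounds x j hj.le
      have hp : (2 : ℤ) ^ (d - j) ≤ 2 ^ d := pow_le_pow_right₀ (by norm_num) (by omega)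
      obtain ⟨hxj, hxj'⟩ := abs_le.1 (show |x ⟨j, hj⟩| ≤ 2 ^ w - 2 by linarith [hxb ⟨j, hj⟩])
      simp only at hs ex
      refine Sim.det (by decide) (fun _ => ?_) ?_
      · simp [cosetBody, Prog.block, Prog.exec, Prog.Ok, Memory.setReg, ArithOp.eval, h31, h32,
          h33, e20, e21, ex, ha]
        simp only [abs_lt]
        omega
      · simp [cosetBody, Prog.block, Prog.exec, Memory.setReg, ArithOp.eval, Function.update_apply,
          h31, h32, h33, e20, e21, ex, ha]
        refine ⟨?_, ?_⟩
        · intro r hr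
          rw [← hf r hr]
          simp [show r ≠ 31 by omega, show r ≠ 32 by omega, show r ≠ 34 by omega,
            show r ≠ 35 by omega, show r ≠ 36 by omega]
        · omega

/-- Coordinatewise average, rounded down. -/
def vecAvg {d : ℕ} (x y : Fin d → ℤ) : Fin d → ℤ := fun i => (x i + y i) / 2

open Prog in
/-- One coordinate of `avgProg`. -/
def avgBody : Prog := block
  [arith .sub 32 32 20, arith .add 36 34 32, load 37 1 36, arith .add 36 35 32, load 38 1 36,
    arith .add 37 37 38, arith .div 37 37 21, arith .add 36 33 32, store 1 36 37]

open Prog in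
/-- Replace the vector with index `reg 16` by the average of those with indices `reg 30` and
`reg 17`. -/
def avgProg : Prog := .seq
  (block [const 31 0, arith .add 32 1 31, arith .mul 33 16 1, arith .mul 34 30 1,
    arith .mul 35 17 1]) (.loop 32 avgBody)

theorem block_disjoint {u v d i : ℤ} (h : u ≠ v) (h0 : 0 ≤ i) (hi : i < d) :
    u * d + i < v * d ∨ v * d + d ≤ u * d + i := by
  rcases lt_or_gt_of_ne h with h | h
  · left; nlinarith
  · right; nlinarith

/-- Averaging two `B`-bit integers gives a `B`-bit integer, and only the intermediate sum needs the
extra bit in `hBw`; coordinates therefore do not grow from stage to stage. The target differs from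
both sources, so they are intact when they are read. -/
theorem avgProg_sim {d w B : ℕ} (σ : Memory) (x y : Fin d → ℤ) (o v u m : ℕ)
    (h1 : σ.reg 1 = d) (h20 : σ.reg 20 = 1) (h21 : σ.reg 21 = 2) (h30 : σ.reg 30 = v)
    (h16 : σ.reg 16 = o) (h17 : σ.reg 17 = u) (hx : VecAt σ v x) (hy : VecAt σ u y)
    (hov : (v : ℤ) ≠ o) (hou : (u : ℤ) ≠ o) (ho : o < m) (hv : v < m) (hu : u < m)
    (hb : (m : ℤ) * d < 2 ^ w) (hB : ∀ i, |σ.arr 1 i| < 2 ^ B) (hBw : (2 : ℤ) * 2 ^ B ≤ 2 ^ w) :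
    Sim (Memory.Bdd w) avgProg σ (25 * (d + 1)) (PMF.pure ()) fun _ σ' =>
      (∀ r, r < 31 ∨ 40 ≤ r → σ'.reg r = σ.reg r) ∧ (∀ a, a ≠ 1 → σ'.arr a = σ.arr a) ∧
      VecAt σ' o (vecAvg x y) ∧ (∀ j : ℤ, j ≠ o → ∀ z : Fin d → ℤ, VecAt σ j z → VecAt σ' j z) ∧
      ∀ i, |σ'.arr 1 i| < 2 ^ B := by
  have hm : ∀ t : ℕ, t < m → (t : ℤ) * d + d ≤ m * d ∧ (0 : ℤ) ≤ t * d := fun t ht => by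
    have : (t : ℤ) + 1 ≤ m := by exact_mod_cast ht
    exact ⟨by nlinarith, by positivity⟩
  have hmo := hm o ho
  have hmv := hm v hv
  have hmu := hm u hu
  refine Sim.mono (T := 11 + (d * (19 + 1) + 1) + 1) ?_ (by omega)
  refine Sim.seq_pure (R := fun σ' => (∀ r, r < 31 ∨ 40 ≤ r → σ'.reg r = σ.reg r) ∧
    σ'.arr = σ.arr ∧ σ'.reg 32 = d ∧ σ'.reg 33 = o * d ∧ σ'.reg 34 = v * d ∧ σ'.reg 35 = u * d)
    ?_ ?_
  · refine Sim.det (by decide) (fun _ => ?_) ?_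
    · simp [Prog.block, Prog.exec, Prog.Ok, Memory.setReg, ArithOp.eval, h1, h30, h16, h17]
      omega
    · simp [Prog.block, Prog.exec, Memory.setReg, ArithOp.eval, Function.update_apply, h1, h30,
        h16, h17]
      intro r hr
      simp [show r ≠ 31 by omega, show r ≠ 32 by omega, show r ≠ 33 by omega,
        show r ≠ 34 by omega, show r ≠ 35 by omega]
  · intro σ₁ _ ⟨hf, ha, h32, h33, h34, h35⟩
    have := Sim.loop_pure (W := Memory.Bdd w) (x := 32) (T := 19) (p := avgBody) (N := d)
      (fun j σ' => (∀ r, r < 31 ∨ 40 ≤ r → σ'.reg r = σ.reg r) ∧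
        (∀ a, a ≠ 1 → σ'.arr a = σ.arr a) ∧ σ'.reg 32 = j ∧ σ'.reg 33 = o * d ∧
        σ'.reg 34 = v * d ∧ σ'.reg 35 = u * d ∧
        (∀ i : Fin d, j ≤ (i : ℕ) → σ'.arr 1 (o * d + (i : ℕ)) = vecAvg x y i) ∧
        (∀ k : ℤ, k < o * d ∨ o * d + d ≤ k → σ'.arr 1 k = σ.arr 1 k) ∧
        ∀ i, |σ'.arr 1 i| < 2 ^ B)
      (fun j _ h => h.2.2.1) ?_
      (σ := σ₁) ⟨hf, fun a _ => by rw [ha], h32, h33, h34, h35,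
        fun i hi => absurd i.2 (by omega), fun k _ => by rw [ha], fun i => by rw [ha]; exact hB i⟩
    · refine this.post _ le_rfl fun _ _ τ _ h => ⟨h.1, h.2.1, fun i => h.2.2.2.2.2.2.1 i (by omega),
        fun j hj z hz i => ?_, h.2.2.2.2.2.2.2.2⟩
      rw [← hz i]
      exact h.2.2.2.2.2.2.2.1 _ (block_disjoint hj (by positivity) (by exact_mod_cast i.2))
    · rintro j τ hj _ ⟨hf, ha, h32, h33, h34, h35, hd, hs, hB'⟩
      have e20 := hf 20 (by omega)
      have e21 := hf 21 (by omega)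
      rw [h20] at e20
      rw [h21] at e21
      have ex := hx ⟨j, hj⟩
      have ey := hy ⟨j, hj⟩
      simp only at ex ey
      rw [← hs _ (block_disjoint hov (by positivity) (by exact_mod_cast hj))] at ex
      rw [← hs _ (block_disjoint hou (by positivity) (by exact_mod_cast hj))] at ey
      have bx := hB' (v * d + j)
      have bY := hB' (u * d + j)
      rw [ex] at bx
      rw [ey] at bY
      rw [abs_lt] at bx bY
      refine Sim.det (by decide) (fun _ => ?_) ?_
      · simp [avgBody, Prog.block, Prog.exec, Prog.Ok, Memory.setReg, ArithOp.eval, h32,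
          h33, h34, h35, e20, e21, ex, ey]
        simp only [abs_lt]
        omega
      · simp [avgBody, Prog.block, Prog.exec, Memory.setReg, Memory.setArr, ArithOp.eval,
          Function.update_apply, h32, h33, h34, h35, e20, e21, ex, ey]
        refine ⟨?_, ?_, ?_, ?_, ?_⟩
        · intro r hr
          rw [← hf r hr]
          simp [show r ≠ 32 by omega, show r ≠ 36 by omega,
            show r ≠ 37 by omega, show r ≠ 38 by omega]
        · intro a h
          rw [if_neg h, ha a h]
        · intro i hi
          split_ifs with h
          · have : i = ⟨j, hj⟩ := Fin.ext h
            rw [this]; rfl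
          · exact hd i (by omega)
        · intro k hk
          rw [if_neg (by omega), hs k hk]
        · intro i
          split_ifs with h
          · rw [abs_lt]; omega
          · exact hB' i

/-! ### The sampling algorithm as a random experiment -/

/-- The largest multiplicity of an entry of a list. -/
def maxMult : List ℤ → ℕ
  | [] => 0
  | c :: l => max (maxMult l) (l.count c + 1)

/-- One round of the Poisson generator. In state `(k, W, u)` there are `u` summands, each of them
`Poisson (1/2)`, still to be generated, `W` is the sum of the finished ones, and `k` is the proposal
for the current one. -/
noncomputable def poissonStep (s : ℕ × ℕ × ℕ) : PMF (ℕ × ℕ × ℕ) :=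
  if 0 < s.2.2 then
    (uniformBelow (2 * (s.1 : ℤ) + 2)).map fun r : ℤ =>
      if r < (s.1 : ℤ) + 1 then (0, s.2.1 + s.1, s.2.2 - 1)
      else if (s.1 : ℤ) + 1 < r then (0, s.2.1, s.2.2) else (s.1 + 1, s.2.1, s.2.2)
  else PMF.pure s

/-- The elements of a dictionary that are stored in cell `z`. -/
def lookup {α : Type} (dict : List ((ℤ × ℤ) × α)) (z : ℤ × ℤ) : List α :=
  (dict.filter fun e => e.1 = z).map Prod.snd

/-- Insert `y` into a cell of its class with a random label. -/
noncomputable def dictStep {α : Type} (cs : α → ℤ) (J : ℕ) (y : α) (l : List ((ℤ × ℤ) × α)) :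
    PMF (List ((ℤ × ℤ) × α)) :=
  (uniformBelow J).map fun r => l ++ [((cs y, r), y)]

/-- Try to combine `x` with a random element of the next unused cell of its class. -/
noncomputable def mainStep {α : Type} (cs : α → ℤ) (av : α → α → α) (K : ℕ)
    (dict : List ((ℤ × ℤ) × α)) (x : α) (s : List ℤ × List α) : PMF (List ℤ × List α) :=
  (uniformBelow K).map fun u =>
    (cs x :: s.1, s.2 ++ ((lookup dict (cs x, s.1.count (cs x)))[u.toNat]?.map (av x)).toList)

/-- One combining stage. -/
noncomputable def stage {α : Type} [Inhabited α] (cs : α → ℤ) (av : α → α → α) (K : ℕ)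
    (xs : List α) : PMF (List α) :=
  let A := xs.length / (32 * K)
  let J := maxMult ((xs.take (16 * A)).map cs)
  (iter (fun _ => poissonStep) (16 * K * A) (0, 0, 2 * K * A)).bind fun p =>
  (iter (fun j l => dictStep cs J (xs.getD (16 * A + j) default) l)
      (min p.2.1 (4 * K * A)) []).bind fun dict =>
  (iter (fun j s => mainStep cs av K dict (xs.getD (16 * A + 4 * K * A + j) default) s) A
      ([], [])).map Prod.snd

theorem maxMult_le_length (l : List ℤ) : maxMult l ≤ l.length := by
  induction l with
  | nil => simp [maxMult]
  | cons c l ih =>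
    have := List.count_le_length (a := c) (l := l)
    simp [maxMult]; omega

/-! ### Correctness of the machine program -/

/-- The registers that are constant during a stage. -/
structure Ctx (d K N base : ℕ) (σ : Memory) : Prop where
  h1 : σ.reg 1 = d
  h3 : σ.reg 3 = K
  h5 : σ.reg 5 = N
  h6 : σ.reg 6 = base
  h20 : σ.reg 20 = 1
  h21 : σ.reg 21 = 2

theorem Ctx.frame {d K N base : ℕ} {σ σ' : Memory} (h : Ctx d K N base σ)
    (hf : ∀ r, r = 1 ∨ r = 3 ∨ r = 5 ∨ r = 6 ∨ r = 20 ∨ r = 21 → σ'.reg r = σ.reg r) :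
    Ctx d K N base σ' :=
  ⟨by rw [hf 1 (by omega), h.h1], by rw [hf 3 (by omega), h.h3], by rw [hf 5 (by omega), h.h5],
    by rw [hf 6 (by omega), h.h6], by rw [hf 20 (by omega), h.h20],
    by rw [hf 21 (by omega), h.h21]⟩

/-- Words of `w` bits suffice for lattice vectors with coordinates of `B` bits, for lists of at most
`M` vectors, and for tables of size `Z * K`. -/
structure Bounds (d w B M N K Z : ℕ) : Prop where
  hN : N = 2 ^ d
  hB : 2 * 2 ^ B ≤ 2 ^ w
  hM : (M + 2) * (d + 4) ≤ 2 ^ w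
  hZ : (Z + 2) * (K + 2) ≤ 2 ^ w
  hMZ : M ≤ Z
  h32 : 32 ≤ M
  hNZ : N ≤ Z

/-- The list `xs` is stored in array `1`, with coordinates of at most `B` bits. -/
structure Stored {d : ℕ} (B : ℕ) (xs : List (Fin d → ℤ)) (σ : Memory) : Prop where
  vec : ∀ j (h : j < xs.length), VecAt σ j xs[j]
  bd : ∀ i, |σ.arr 1 i| < 2 ^ B

theorem Stored.frame {d B : ℕ} {xs : List (Fin d → ℤ)} {σ σ' : Memory} (h : Stored B xs σ)
    (ha : σ'.arr 1 = σ.arr 1) : Stored B xs σ' :=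
  ⟨fun j hj i => by rw [ha]; exact h.vec j hj i, fun i => by rw [ha]; exact h.bd i⟩

theorem cosetProg_sim' {d w B M N K Z base : ℕ} (hB : Bounds d w B M N K Z) {σ : Memory}
    (hc : Ctx d K N base σ) (x : Fin d → ℤ) (v : ℕ) (hx : VecAt σ v x)
    (hb : ∀ i, |σ.arr 1 i| < 2 ^ B) (hv : v < M) (h30 : σ.reg 30 = v) :
    Sim (Memory.Bdd w) cosetProg σ (20 * (d + 1)) (PMF.pure ()) fun _ σ' =>
      (∀ r, r < 31 ∨ 40 ≤ r → σ'.reg r = σ.reg r) ∧ σ'.arr = σ.arr ∧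
        σ'.reg 31 = cosetCode x := by
  have h8 : 2 ^ 3 ≤ 2 ^ w := by nlinarith [hB.hM]
  have hw : 3 ≤ w := (Nat.pow_le_pow_iff_right (by norm_num)).1 h8
  refine cosetProg_sim σ x v hc.h1 hc.h20 hc.h21 h30 hx ?_ ?_ (by omega) ?_
  · have h1 := hB.hM
    have h2 : (v + 1) * d < 2 ^ w := by nlinarith
    exact_mod_cast h2
  · have h2 : 2 ^ d ≤ 2 ^ w := by rw [← hB.hN]; nlinarith [hB.hNZ, hB.hZ]
    exact_mod_cast h2
  · intro i
    have h1 : |x i| < 2 ^ B := by rw [← hx i]; exact hb _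
    have h2 : (2 : ℤ) * 2 ^ B ≤ 2 ^ w := by exact_mod_cast hB.hB
    have h3 : (2 : ℤ) ^ 3 ≤ 2 ^ w := by exact_mod_cast h8
    have : (0 : ℤ) ≤ |x i| := abs_nonneg _
    omega

open Prog in
/-- Body of the loop that counts classes in the test segment. -/
def testBody : Prog := .seq (block [arith .sub 10 10 20, const 30 0, arith .add 30 30 10])
  (.seq cosetProg (block [arith .add 18 6 31, load 19 2 18, arith .add 19 19 20, store 2 18 19,
    arith .sub 22 19 9, ite 22 (block [const 9 0, arith .add 9 9 19]) skip]))

/-- The loop counts down, so the vectors already treated form a suffix of the segment. This matches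
the recursion of `maxMult`, which compares the count of the head in the tail with the maximum of the
tail. -/
theorem testBody_sim {d w B M N K Z base : ℕ} (hB : Bounds d w B M N K Z) {σ : Memory}
    (hc : Ctx d K N base σ) (xs : List (Fin d → ℤ)) (hs : Stored B xs σ) (hM : xs.length ≤ M)
    (hbase : base + N * (M + 1) ≤ Z) (n : ℕ) (hn : n ≤ xs.length) (h10 : σ.reg 10 = n)
    (h9 : σ.reg 9 = 0) (hfresh : ∀ i : ℤ, base ≤ i → σ.arr 2 i = 0) :
    Sim (Memory.Bdd w) (.loop 10 testBody) σ (n * (20 * (d + 1) + 60) + 1) (PMF.pure ())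
      fun _ σ' =>
      (∀ r, r < 9 ∨ (10 < r ∧ r < 18) ∨ r = 20 ∨ r = 21 ∨ (22 < r ∧ r < 30) ∨
        40 ≤ r → σ'.reg r = σ.reg r) ∧
        (∀ a, a ≠ 2 → σ'.arr a = σ.arr a) ∧
        (∀ i : ℤ, base + N ≤ i → σ'.arr 2 i = 0) ∧
        σ'.reg 9 = maxMult ((xs.take n).map cosetCode) := by
  have hZ1 : ((Z : ℤ) + 2) * (K + 2) ≤ 2 ^ w := by exact_mod_cast hB.hZ
  have hZ2 : (Z : ℤ) + 2 ≤ 2 ^ w := by nlinarith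
  have hN1 : (N : ℤ) = 2 ^ d := by rw [hB.hN]; push_cast; rfl
  have hbN : (base : ℤ) + N ≤ Z := by
    have : base + N ≤ Z := by nlinarith
    exact_mod_cast this
  have hnZ : (n : ℤ) ≤ Z := by have := hB.hMZ; omega
  refine Sim.mono (T := n * (7 + (20 * (d + 1) + 30 + 1) + 1 + 1) + 1) ?_ 
    (Nat.add_le_add_right (Nat.mul_le_mul_left n (by omega)) 1)
  refine (Sim.loop_pure (W := Memory.Bdd w) (x := 10)
    (T := 7 + (20 * (d + 1) + 30 + 1) + 1) (p := testBody) (N := n)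
      (fun j σ' =>
        (∀ r, r < 9 ∨ (10 < r ∧ r < 18) ∨ r = 20 ∨ r = 21 ∨ (22 < r ∧ r < 30) ∨
        40 ≤ r → σ'.reg r = σ.reg r) ∧
        (∀ a, a ≠ 2 → σ'.arr a = σ.arr a) ∧
        (∀ c : ℤ, 0 ≤ c → σ'.arr 2 (base + c) = (((xs.take n).drop j).map cosetCode).count c) ∧
        σ'.reg 9 = maxMult (((xs.take n).drop j).map cosetCode) ∧ σ'.reg 10 = j)
      (fun j _ h => h.2.2.2.2) ?_
      (σ := σ) ⟨fun _ _ => rfl, fun _ _ => rfl, fun c hc0 => ?_, ?_, h10⟩).post _ le_rfl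
      fun _ _ τ _ h => ⟨h.1, h.2.1, fun i hi => ?_, ?_⟩
  · rintro j τ hj _ ⟨hf, ha, ht, h9, h10⟩
    have hjx : j < xs.length := by omega
    have hcτ : Ctx d K N base τ := hc.frame fun r hr => hf r (by omega)
    have e20 := hcτ.h20
    refine Sim.seq_pure (R := fun σ' => (∀ r, r ≠ 10 ∧ r ≠ 30 → σ'.reg r = τ.reg r) ∧
      σ'.arr = τ.arr ∧ σ'.reg 10 = j ∧ σ'.reg 30 = j) ?_ ?_
    · refine Sim.det (by decide) (fun _ => ?_) ?_
      · simp [Prog.block, Prog.exec, Prog.Ok, Memory.setReg, ArithOp.eval, h10, e20]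
        omega
      · simp [Prog.block, Prog.exec, Memory.setReg, ArithOp.eval, Function.update_apply, h10, e20]
        intro r hr hr'
        simp [hr, hr']
    · intro τ₁ _ ⟨hf1, ha1, h10', h30⟩
      have hcτ1 : Ctx d K N base τ₁ := hcτ.frame fun r hr => hf1 r (by omega)
      have hs1 : Stored B xs τ₁ := hs.frame (by rw [ha1, ha 1 (by omega)])
      refine Sim.seq_pure (cosetProg_sim' hB hcτ1 xs[j] j (hs1.vec j hjx) hs1.bd (by omega) h30) ?_
      intro τ₂ _ ⟨hf2, ha2, h31⟩
      have hcτ2 : Ctx d K N base τ₂ := hcτ1.frame fun r hr => hf2 r (by omega)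
      have hcb := cosetCode_bounds xs[j]
      have hd : (xs.take n).drop j = xs[j] :: (xs.take n).drop (j + 1) := by
        rw [List.drop_eq_getElem_cons (by simp; omega)]; simp
      have e6 := hcτ2.h6
      have e20 := hcτ2.h20
      have e9 : τ₂.reg 9 = maxMult (((xs.take n).drop (j + 1)).map cosetCode) := by
        rw [hf2 9 (by omega), hf1 9 (by omega), h9]
      have e10 : τ₂.reg 10 = j := by rw [hf2 10 (by omega), h10']
      have et : τ₂.arr 2 (base + cosetCode xs[j]) =
          (((xs.take n).drop (j + 1)).map cosetCode).count (cosetCode xs[j]) := by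
        rw [ha2, ha1]; exact ht _ hcb.1
      have hl : (((xs.take n).drop (j + 1)).map cosetCode).count (cosetCode xs[j]) + 1 ≤ M + 1 := by
        refine Nat.add_le_add_right (List.count_le_length.trans ?_) 1
        simp; omega
      have hm := maxMult_le_length (((xs.take n).drop (j + 1)).map cosetCode)
      have hlen : (((xs.take n).drop (j + 1)).map cosetCode).length ≤ M := by simp; omega
      have hMZ := hB.hMZ
      have hK0 : (0 : ℤ) ≤ K := by positivity
      have hMw : (M : ℤ) + 2 < 2 ^ w := by nlinarith
      rw [hd, List.map_cons]
      simp only [maxMult]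
      generalize ((xs.take n).drop (j + 1)).map cosetCode = l at *
      generalize cosetCode xs[j] = c at *
      refine Sim.det (by decide) (fun _ => ?_) ?_
      · simp [Prog.block, Prog.exec, Prog.Ok, Memory.setReg, Memory.setArr, ArithOp.eval,
          Function.update_apply, h31, e6, e20, e9, et]
        simp only [abs_lt]
        omega
      · simp only [Prog.block, Prog.exec, Memory.setReg, Memory.setArr, ArithOp.eval]
        simp [Function.update_apply, h31, e6, e20, e9, et]
        refine ⟨?_, ?_, ?_, ?_, ?_⟩
        · intro r hr
          have e : τ₂.reg r = σ.reg r := by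
            rw [hf2 r (by omega), hf1 r (by omega), hf r hr]
          split_ifs <;>
            simp [show r ≠ 9 by omega, show r ≠ 18 by omega, show r ≠ 19 by omega,
              show r ≠ 22 by omega, e]
        · intro a h
          have e : τ₂.arr a = σ.arr a := by
            rw [ha2, ha1, ha a h]
          split_ifs <;> simp [h, e]
        · intro c' hc'
          have e := ht c' hc'
          rw [← ha1, ← ha2] at e
          rw [List.count_cons]
          have h4 : base + c' = base + c ↔ c = c' := by constructor <;> intro h <;> omega
          split_ifs with h1 h2 h2 <;> simp_all [Function.update_apply]
        · split_ifs <;> simp <;> omega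
        · split_ifs <;> simp [e10]
  · rw [hfresh _ (by omega)]
    simp
  · simp [h9, maxMult]
  · obtain ⟨c, rfl⟩ : ∃ c, i = base + c := ⟨i - base, by ring⟩
    rw [h.2.2.1 c (by omega)]
    norm_cast
    rw [List.count_eq_zero]
    simp only [List.mem_map, not_exists, not_and]
    intro x _ hx
    have := cosetCode_bounds x
    omega
  · have := h.2.2.2.1
    rwa [List.drop_zero] at this

/-! ### Frame rules: what a block leaves unchanged. -/

/-- The registers that a program may modify. -/
def Prog.regs : Prog → List ℕ
  | .const x _ => [x]
  | .arith _ x _ _ => [x]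
  | .load x _ _ => [x]
  | .rand x _ => [x]
  | .seq p q => p.regs ++ q.regs
  | .ite _ p q => p.regs ++ q.regs
  | .loop _ p => p.regs
  | _ => []

/-- The arrays that a program may modify. -/
def Prog.arrs : Prog → List ℕ
  | .store a _ _ => [a]
  | .seq p q => p.arrs ++ q.arrs
  | .ite _ p q => p.arrs ++ q.arrs
  | .loop _ p => p.arrs
  | _ => []

theorem Memory.setReg_reg_of_ne (σ : Memory) {x r : ℕ} (v : ℤ) (h : r ≠ x) :
    (σ.setReg x v).reg r = σ.reg r :=
  Function.update_of_ne h _ _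

theorem Prog.exec_reg (p : Prog) : ∀ (σ : Memory) (r : ℕ), r ∉ p.regs →
    (p.exec σ).reg r = σ.reg r := by
  induction p with
  | seq p q hp hq =>
    intro σ r hr
    simp only [Prog.regs, List.mem_append, not_or] at hr
    rw [Prog.exec, hq _ _ hr.2, hp _ _ hr.1]
  | ite x p q hp hq =>
    intro σ r hr
    simp only [Prog.regs, List.mem_append, not_or] at hr
    rw [Prog.exec]
    split_ifs
    exacts [hp _ _ hr.1, hq _ _ hr.2]
  | _ =>
    intro σ r hr
    simp_all [Prog.regs, Prog.exec, Memory.setReg, Memory.setArr]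

theorem Prog.exec_arr (p : Prog) : ∀ (σ : Memory) (a : ℕ), a ∉ p.arrs →
    (p.exec σ).arr a = σ.arr a := by
  induction p with
  | seq p q hp hq =>
    intro σ r hr
    simp only [Prog.arrs, List.mem_append, not_or] at hr
    rw [Prog.exec, hq _ _ hr.2, hp _ _ hr.1]
  | ite x p q hp hq =>
    intro σ r hr
    simp only [Prog.arrs, List.mem_append, not_or] at hr
    rw [Prog.exec]
    split_ifs
    exacts [hp _ _ hr.1, hq _ _ hr.2]
  | _ =>
    intro σ r hr
    simp_all [Prog.arrs, Prog.exec, Memory.setReg, Memory.setArr]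

open Prog in
/-- Body of the loop of the Poisson generator. -/
def poissonBody : Prog := .seq (arith .sub 10 10 20)
  (.ite 11 (.seq (block [arith .add 18 13 13, arith .add 18 18 21])
    (.seq (rand 18 18) (block [arith .add 19 13 20, arith .sub 22 19 18,
      ite 22 (block [arith .add 12 12 13, const 13 0, arith .sub 11 11 20])
        (block [arith .sub 22 18 19, ite 22 (const 13 0) (arith .add 13 13 20)])]))) skip)

/-- A round raises `W + k` by at most one: acceptance moves `k` into `W`, a restart discards `k`,
and only a climb adds one. So `W + k` plus the number of remaining rounds stays below `n`, which
bounds every register independently of the random choices. -/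
theorem poissonBody_sim {d w B M N K Z base : ℕ} (hB : Bounds d w B M N K Z) {σ : Memory}
    (hc : Ctx d K N base σ) (n U : ℕ) (hn : n ≤ M) (hU : U ≤ M)
    (h10 : σ.reg 10 = n) (h11 : σ.reg 11 = U) (h12 : σ.reg 12 = 0) (h13 : σ.reg 13 = 0) :
    Sim (Memory.Bdd w) (.loop 10 poissonBody) σ (n * 60 + 1)
      (iter (fun _ => poissonStep) n (0, 0, U)) fun p σ' =>
      (∀ r, r < 10 ∨ (13 < r ∧ r < 18) ∨ r = 20 ∨ r = 21 ∨ 23 ≤ r → σ'.reg r = σ.reg r) ∧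
        σ'.arr = σ.arr ∧ σ'.reg 12 = (p.2.1 : ℕ) ∧ p.2.1 ≤ n := by
  have hMw : 4 * ((M : ℤ) + 2) ≤ 2 ^ w := by
    have := hB.hM
    have : 4 * (M + 2) ≤ 2 ^ w := by nlinarith
    exact_mod_cast this
  refine (Sim.loop (W := Memory.Bdd w) (x := 10) (T := 59) (p := poissonBody)
    (fun _ => poissonStep)
    (fun j p σ' =>
        (∀ r, r < 10 ∨ (13 < r ∧ r < 18) ∨ r = 20 ∨ r = 21 ∨ 23 ≤ r → σ'.reg r = σ.reg r) ∧
        σ'.arr = σ.arr ∧ σ'.reg 13 = (p.1 : ℕ) ∧ σ'.reg 12 = (p.2.1 : ℕ) ∧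
        σ'.reg 11 = (p.2.2 : ℕ) ∧ p.2.1 + p.1 + j ≤ n ∧ p.2.2 ≤ U ∧ σ'.reg 10 = j)
      (fun j _ _ h => h.2.2.2.2.2.2.2) n ?_
      n (0, 0, U) σ le_rfl ⟨fun _ _ => rfl, rfl, by simp [h13], by simp [h12], by simp [h11],
        by simp, le_rfl, h10⟩).post _ (by omega)
      fun _ _ τ _ h => ⟨h.1, h.2.1, h.2.2.2.1, by have := h.2.2.2.2.2.1; omega⟩
  rintro j ⟨k, W, u⟩ τ hj _ ⟨hf, ha, h13, h12, h11, hle, hu, h10⟩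
  simp only at h13 h12 h11 hle hu
  have e20 : τ.reg 20 = 1 := by rw [hf 20 (by omega), hc.h20]
  have e21 : τ.reg 21 = 2 := by rw [hf 21 (by omega), hc.h21]
  refine Sim.mono (T := 1 + 57 + 1) ?_ (by omega)
  refine Sim.seq_pure (R := fun σ' => (∀ r, r ≠ 10 → σ'.reg r = τ.reg r) ∧
      σ'.arr = τ.arr ∧ σ'.reg 10 = j) ?_ ?_
  · refine Sim.det (by decide) (fun _ => ?_) ?_
    · simp [Prog.exec, Prog.Ok, Memory.setReg, ArithOp.eval, h10, e20]
      omega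
    · simp [Prog.exec, Memory.setReg, ArithOp.eval, Function.update_apply, h10, e20]
      intro r hr
      simp [hr]
  · intro τ₁ _ ⟨hf1, ha1, h10'⟩
    have e11 : τ₁.reg 11 = u := by rw [hf1 11 (by omega), h11]
    refine Sim.mono (T := 56 + 1) (Sim.ite (fun hu0 => ?_) fun hu0 => ?_) (by omega)
    · rw [e11] at hu0
      have hu1 : 0 < u := by exact_mod_cast hu0
      unfold poissonStep
      rw [if_pos hu1]
      simp only
      refine Sim.mono (T := 5 + (1 + 40 + 1) + 1) ?_ (by omega)
      refine Sim.seq_pure (R := fun σ' => (∀ r, r ≠ 18 → σ'.reg r = τ₁.reg r) ∧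
        σ'.arr = τ.arr ∧ σ'.reg 18 = 2 * k + 2) ?_ ?_
      · have e13 : τ₁.reg 13 = k := by rw [hf1 13 (by omega), h13]
        have e21' : τ₁.reg 21 = 2 := by rw [hf1 21 (by omega), e21]
        refine Sim.det (by decide) (fun _ => ?_) ?_
        · simp [Prog.block, Prog.exec, Prog.Ok, Memory.setReg, ArithOp.eval, e13, e21']
          simp only [abs_lt]
          omega
        · simp [Prog.block, Prog.exec, Memory.setReg, ArithOp.eval, Function.update_apply, e13,
            e21', ha1]
          refine ⟨fun r hr => ?_, by ring⟩
          simp [hr]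
      · intro τ₂ hb2 ⟨hf2, ha2, h18⟩
        rw [← PMF.bind_pure_comp]
        have hr := Sim.rand 18 18 τ₂ hb2
        rw [h18] at hr
        refine Sim.seq (T₁ := 1) (T₂ := 40) hr ?_
        rintro r hrs τ₃ _ rfl
        have hr2 := (mem_support_uniformBelow hrs).1 (by positivity)
        have e10 : τ₂.reg 10 = j := by rw [hf2 10 (by omega), h10']
        have e11 : τ₂.reg 11 = u := by rw [hf2 11 (by omega), e11]
        have e12 : τ₂.reg 12 = W := by rw [hf2 12 (by omega), hf1 12 (by omega), h12]
        have e13 : τ₂.reg 13 = k := by rw [hf2 13 (by omega), hf1 13 (by omega), h13]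
        have e20 : τ₂.reg 20 = 1 := by rw [hf2 20 (by omega), hf1 20 (by omega), e20]
        refine Sim.det (by decide) (fun _ => ?_) ?_
        · simp [Prog.block, Prog.exec, Prog.Ok, Memory.setReg, ArithOp.eval,
            Function.update_apply, e11, e12, e13, e20]
          simp only [abs_lt]
          omega
        · refine ⟨fun q hq => ?_, ?_, ?_⟩
          · rw [Prog.exec_reg _ _ _ (by simp [Prog.block, Prog.regs]; omega), 
              Memory.setReg_reg_of_ne _ _ (by omega), hf2 q (by omega), hf1 q (by omega), hf q hq]
          · ext a
            rw [Prog.exec_arr _ _ _ (by simp [Prog.block, Prog.arrs]), Memory.setReg, ha2, ha]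
          · simp [Prog.block, Prog.exec, Memory.setReg, ArithOp.eval, Function.update_apply,
              e11, e12, e13, e20]
            split_ifs with h1 h2 <;>
              (try simp [e10, e11, e12, e13, Function.update_apply]) <;> omega
    · rw [e11] at hu0
      have hu1 : ¬ 0 < u := by exact_mod_cast hu0
      unfold poissonStep
      rw [if_neg hu1]
      refine Sim.det (by decide) (fun _ => trivial) ?_
      simp only [Prog.exec]
      refine ⟨fun r hr => by rw [hf1 r (by omega), hf r hr], by rw [ha1, ha],
        by rw [hf1 13 (by omega), h13], by rw [hf1 12 (by omega), h12],
        by rw [hf1 11 (by omega), h11], by omega, hu, h10'⟩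

/-! ### The dictionary as a list and as a table in memory. -/

theorem lookup_append {α : Type} (l l' : List ((ℤ × ℤ) × α)) (z : ℤ × ℤ) :
    lookup (l ++ l') z = lookup l z ++ lookup l' z := by
  simp [lookup]

theorem lookup_length_le {α : Type} (l : List ((ℤ × ℤ) × α)) (z : ℤ × ℤ) :
    (lookup l z).length ≤ l.length := by
  simpa [lookup] using List.length_filter_le _ _

theorem lookup_singleton {α : Type} (z z' : ℤ × ℤ) (y : α) :
    lookup [(z, y)] z' = if z = z' then [y] else [] := by
  by_cases h : z = z' <;> simp [lookup, h]

/-- The dictionary `l` is stored in the cells of array `3` (sizes) and array `4` (indices of the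
vectors in the list `xs`). -/
structure Table {d : ℕ} (base N K M lo hi : ℕ) (xs : List (Fin d → ℤ))
    (l : List ((ℤ × ℤ) × (Fin d → ℤ))) (σ : Memory) : Prop where
  size : ∀ i k : ℤ, 0 ≤ i → i < N → 0 ≤ k → σ.arr 3 (base + (k * N + i)) = (lookup l (i, k)).length
  slot : ∀ i k : ℤ, 0 ≤ i → i < N → 0 ≤ k → ∀ u : ℕ, u < K → ∀ y, (lookup l (i, k))[u]? = some y →
    ∃ v : ℕ, lo ≤ v ∧ v < hi ∧ σ.arr 4 ((base + (k * N + i)) * K + u) = v ∧ xs.getD v default = y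
  label : ∀ e ∈ l, e.1.2 ≤ M

theorem mul_add_inj {N : ℕ} {i i' k k' : ℤ} (h0 : 0 ≤ i) (h1 : i < N) (h0' : 0 ≤ i') (h1' : i' < N)
    (h : k * N + i = k' * N + i') : k = k' ∧ i = i' := by
  by_cases hk : k = k'
  · subst hk
    exact ⟨rfl, by omega⟩
  · have := block_disjoint hk h0 h1
    omega

/-- Cell `(c, r)` lives at offset `r * N + c` with `0 ≤ c < N`, and slot `u` of a cell at `cell * K
+ u` with `u < K`; both encodings are injective, so an insertion disturbs no other entry. Elements
beyond the first `K` of a cell are counted but not stored, since the main loop never probes them. -/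
theorem Table.insert {d base N K M lo hi : ℕ} {xs : List (Fin d → ℤ)}
    {l : List ((ℤ × ℤ) × (Fin d → ℤ))} {σ σ' : Memory} (ht : Table base N K M lo hi xs l σ)
    {c r : ℤ} {y : Fin d → ℤ} {v : ℕ} (hc0 : 0 ≤ c) (hc1 : c < N) (hr0 : r ≤ M)
    (hv0 : lo ≤ v) (hv1 : v < hi) (hv2 : xs.getD v default = y)
    (h3 : σ'.arr 3 = Function.update (σ.arr 3) (base + (r * N + c))
      ((lookup l (c, r)).length + 1))
    (h4 : σ'.arr 4 = if (lookup l (c, r)).length < K then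
      Function.update (σ.arr 4) ((base + (r * N + c)) * K + (lookup l (c, r)).length) v
      else σ.arr 4) : Table base N K M lo hi xs (l ++ [((c, r), y)]) σ' := by
  refine ⟨?_, ?_, ?_⟩
  · intro i k hi0 hi1 hk0
    rw [lookup_append, lookup_singleton, h3]
    by_cases h : (c, r) = (i, k)
    · obtain ⟨rfl, rfl⟩ := Prod.mk.inj h
      simp
    · rw [if_neg h, Function.update_of_ne, ht.size i k hi0 hi1 hk0, List.append_nil]
      intro h'
      obtain ⟨h1, h2⟩ := mul_add_inj hi0 hi1 hc0 hc1 (add_left_cancel h')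
      exact h (by rw [h1, h2])
  · intro i k hi0 hi1 hk0 u hu z hz
    rw [lookup_append, lookup_singleton] at hz
    by_cases hnew : (c, r) = (i, k) ∧ u = (lookup l (c, r)).length
    · obtain ⟨h1, h2⟩ := hnew
      obtain ⟨rfl, rfl⟩ := Prod.mk.inj h1
      rw [if_pos rfl, h2] at hz
      simp at hz
      refine ⟨v, hv0, hv1, ?_, by rw [hv2, hz]⟩
      rw [h4, if_pos (by omega), h2, Function.update_self]
    · have hz' : (lookup l (i, k))[u]? = some z := by
        by_cases h : (c, r) = (i, k)
        · rw [if_pos h] at hz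
          rw [← h] at hz ⊢
          have hu' : u ≠ (lookup l (c, r)).length := fun h' => hnew ⟨h, h'⟩
          rcases lt_or_gt_of_ne hu' with h1 | h1
          · rwa [List.getElem?_append_left h1] at hz
          · rw [List.getElem?_eq_none (by simp; omega)] at hz
            simp at hz
        · simpa [h] using hz
      obtain ⟨v', hw0, hw1, hw2, hw3⟩ := ht.slot i k hi0 hi1 hk0 u hu z hz'
      refine ⟨v', hw0, hw1, ?_, hw3⟩
      rw [← hw2, h4]
      split_ifs with hLK
      · refine Function.update_of_ne (fun h => ?_) _ _
        obtain ⟨h1, h2⟩ := mul_add_inj (by omega) (by omega) (by omega) (by omega) h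
        obtain ⟨h3, h4⟩ := mul_add_inj hi0 hi1 hc0 hc1 (add_left_cancel h1)
        exact hnew ⟨by rw [h3, h4], by omega⟩
      · rfl
  · intro e he
    rcases List.mem_append.1 he with he | he
    · exact ht.label e he
    · rw [List.mem_singleton] at he
      rw [he]; exact hr0

open Prog in
/-- Insert the vector with index `reg 30` and class `reg 31` into the cell with label `reg 14`. -/
def dictStore : Prog :=
  block [arith .mul 18 14 5, arith .add 18 18 31, arith .add 18 6 18, load 19 3 18,
      arith .add 22 19 20, store 3 18 22, arith .sub 22 3 19,
      ite 22 (block [arith .mul 18 18 3, arith .add 18 18 19, store 4 18 30]) skip]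

theorem dictStore_exec {σ : Memory} {c r : ℤ} {N K base L v : ℕ} (h3 : σ.reg 3 = K)
    (h5 : σ.reg 5 = N) (h6 : σ.reg 6 = base) (h14 : σ.reg 14 = r) (h20 : σ.reg 20 = 1)
    (h30 : σ.reg 30 = v) (h31 : σ.reg 31 = c) (hL : σ.arr 3 (base + (r * N + c)) = L) :
    (dictStore.exec σ).arr 3 = Function.update (σ.arr 3) (base + (r * N + c)) (L + 1) ∧
    (dictStore.exec σ).arr 4 = if L < K then
      Function.update (σ.arr 4) ((base + (r * N + c)) * K + L) v else σ.arr 4 := by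
  by_cases hLK : L < K <;>
  simp [dictStore, Prog.block, Prog.exec, Memory.setReg, Memory.setArr, ArithOp.eval,
    h3, h5, h6, h14, h20, h30, h31, hL, hLK]

theorem dictStore_ok {σ : Memory} {c r : ℤ} {N K base L w : ℕ} (h3 : σ.reg 3 = K)
    (h5 : σ.reg 5 = N) (h6 : σ.reg 6 = base) (h14 : σ.reg 14 = r) (h20 : σ.reg 20 = 1)
    (h31 : σ.reg 31 = c) (hL : σ.arr 3 (base + (r * N + c)) = L)
    (hc0 : 0 ≤ c) (hrN : 0 ≤ r * N) (h1 : (base : ℤ) + (r * N + c) < 2 ^ w)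
    (h2 : ((base : ℤ) + (r * N + c)) * K + K < 2 ^ w) (hLw : (L : ℤ) + 1 < 2 ^ w) :
    dictStore.Ok w σ := by
  have hcK0 : 0 ≤ ((base : ℤ) + (r * N + c)) * K := mul_nonneg (by omega) (by positivity)
  simp [-abs_mul, dictStore, Prog.block, Prog.exec, Prog.Ok, Memory.setReg, Memory.setArr, ArithOp.eval,
    h3, h5, h6, h14, h20, h31, hL]
  simp only [abs_lt]
  omega

open Prog in
/-- Body of the loop that fills the dictionary. -/
def dictBody : Prog :=
  .seq (block [arith .sub 10 10 20, const 30 0, arith .add 30 30 10, arith .add 30 30 23])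
  (.seq cosetProg (.seq (rand 14 9) dictStore))

theorem dictBody_sim {d w B M N K Z base : ℕ} (hB : Bounds d w B M N K Z) {σ : Memory}
    (hc : Ctx d K N base σ) (xs : List (Fin d → ℤ)) (hs : Stored B xs σ) (hM : xs.length ≤ M)
    (hbase : base + N * (M + 1) ≤ Z) (n lo J : ℕ) (hn : lo + n ≤ xs.length) (hJ : J ≤ M)
    (h10 : σ.reg 10 = n)
    (h9 : σ.reg 9 = J) (h23 : σ.reg 23 = lo) (hfresh : ∀ i : ℤ, base ≤ i → σ.arr 3 i = 0) :
    Sim (Memory.Bdd w) (.loop 10 dictBody) σ (n * (20 * (d + 1) + 60) + 1)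
      (iter (fun j l => dictStep cosetCode J (xs.getD (lo + j) default) l) n []) fun l σ' =>
      (∀ r, r < 10 ∨ (10 < r ∧ r < 14) ∨ (14 < r ∧ r < 18) ∨ r = 20 ∨ r = 21 ∨ (22 < r ∧ r < 30) ∨
        40 ≤ r → σ'.reg r = σ.reg r) ∧
        (∀ a, a ≠ 3 → a ≠ 4 → σ'.arr a = σ.arr a) ∧ l.length ≤ M ∧
        Table base N K M lo (lo + n) xs l σ' := by
  have hZ1 : ((Z : ℤ) + 2) * (K + 2) ≤ 2 ^ w := by exact_mod_cast hB.hZ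
  have hZ2 : (Z : ℤ) + 2 ≤ 2 ^ w := by nlinarith
  have hN1 : (N : ℤ) = 2 ^ d := by rw [hB.hN]; push_cast; rfl
  have hbN : (base : ℤ) + N * (M + 1) ≤ Z := by exact_mod_cast hbase
  have hMZ : (M : ℤ) ≤ Z := by exact_mod_cast hB.hMZ
  have hN0 : (0 : ℤ) < N := by rw [hN1]; positivity
  refine Sim.mono (T := n * (9 + (20 * (d + 1) + (1 + 35 + 1) + 1) + 1 + 1) + 1) ?_
    (Nat.add_le_add_right (Nat.mul_le_mul_left n (by omega)) 1)
  refine (Sim.loop (W := Memory.Bdd w) (x := 10)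
    (T := 9 + (20 * (d + 1) + (1 + 35 + 1) + 1) + 1) (p := dictBody)
      (fun j l => dictStep cosetCode J (xs.getD (lo + j) default) l)
      (fun j l σ' =>
        (∀ r, r < 10 ∨ (10 < r ∧ r < 14) ∨ (14 < r ∧ r < 18) ∨ r = 20 ∨ r = 21 ∨
          (22 < r ∧ r < 30) ∨ 40 ≤ r → σ'.reg r = σ.reg r) ∧
        (∀ a, a ≠ 3 → a ≠ 4 → σ'.arr a = σ.arr a) ∧ l.length + j ≤ n ∧
        Table base N K M lo (lo + n) xs l σ' ∧ σ'.reg 10 = j)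
      (fun j _ _ h => h.2.2.2.2) n ?_
      n [] σ le_rfl ⟨fun _ _ => rfl, fun _ _ _ => rfl, by simp, ?_, h10⟩).post _ le_rfl
      fun _ _ τ _ h => ⟨h.1, h.2.1, by have := h.2.2.1; omega, h.2.2.2.1⟩
  swap
  · refine ⟨fun i k h0 h1 h2 => ?_, fun i k h0 h1 h2 u hu y hy => ?_, by simp⟩
    · rw [hfresh _ (by nlinarith)]; simp [lookup]
    · simp [lookup] at hy
  rintro j l τ hj _ ⟨hf, ha, hl, ht, h10⟩
  have hjx : lo + j < xs.length := by omega
  have hcτ : Ctx d K N base τ := hc.frame fun r hr => hf r (by omega)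
  have e20 := hcτ.h20
  have e23 : τ.reg 23 = lo := by rw [hf 23 (by omega), h23]
  refine Sim.seq_pure (R := fun σ' => (∀ r, r ≠ 10 ∧ r ≠ 30 → σ'.reg r = τ.reg r) ∧
    σ'.arr = τ.arr ∧ σ'.reg 10 = j ∧ σ'.reg 30 = ((lo + j : ℕ) : ℤ)) ?_ ?_
  · refine Sim.det (by decide) (fun _ => ?_) ⟨fun r hr => ?_, ?_⟩
    · simp [Prog.block, Prog.exec, Prog.Ok, Memory.setReg, ArithOp.eval, h10, e20, e23]
      simp only [abs_lt]
      omega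
    · rw [Prog.exec_reg _ _ _ (by simp [Prog.block, Prog.regs]; omega)]
    · simp [Prog.block, Prog.exec, Memory.setReg, ArithOp.eval, Function.update_apply, h10, e20,
        e23]
      ring
  intro τ₁ _ ⟨hf1, ha1, h10', h30⟩
  have hcτ1 : Ctx d K N base τ₁ := hcτ.frame fun r hr => hf1 r (by omega)
  have hs1 : Stored B xs τ₁ := hs.frame (by rw [ha1, ha 1 (by omega) (by omega)])
  refine Sim.seq_pure (cosetProg_sim' hB hcτ1 xs[lo + j] (lo + j) (hs1.vec _ hjx) hs1.bd (by omega) h30) ?_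
  intro τ₂ hb2 ⟨hf2, ha2, h31⟩
  have hcτ2 : Ctx d K N base τ₂ := hcτ1.frame fun r hr => hf2 r (by omega)
  have hcb := cosetCode_bounds xs[lo + j]
  rw [← hN1] at hcb
  have e9 : τ₂.reg 9 = J := by rw [hf2 9 (by omega), hf1 9 (by omega), hf 9 (by omega), h9]
  have hxj : xs.getD (lo + j) default = xs[lo + j] := by simp [hjx]
  rw [dictStep, ← PMF.bind_pure_comp, hxj]
  have hr := Sim.rand 14 9 τ₂ hb2
  rw [e9] at hr
  refine Sim.seq (T₁ := 1) (T₂ := 35) hr ?_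
  rintro r hrs τ₃ _ rfl
  -- If `J = 0`, the random instruction returns the label `0`, so the bound holds in every case.
  have hr0 : 0 ≤ r ∧ r ≤ M := by
    have := mem_support_uniformBelow hrs
    rcases Nat.eq_zero_or_pos J with h0 | h0
    · have := this.2 (by omega); omega
    · have := this.1 (by exact_mod_cast h0); omega
  have e3 := hcτ2.h3
  have e5 := hcτ2.h5
  have e6 := hcτ2.h6
  have e20 := hcτ2.h20
  have e10 : τ₂.reg 10 = j := by rw [hf2 10 (by omega), h10']
  have e30 : τ₂.reg 30 = ((lo + j : ℕ) : ℤ) := by rw [hf2 30 (by omega), h30]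
  have ha2' : τ₂.arr = τ.arr := by rw [ha2, ha1]
  have hxv : xs.getD (lo + j) default = xs[lo + j] := hxj
  have hsz := ht.size _ r hcb.1 hcb.2 hr0.1
  have hll := lookup_length_le l (cosetCode xs[lo + j], r)
  generalize hcg : cosetCode xs[lo + j] = c at *
  generalize hL : lookup l (c, r) = L at *
  rw [← ha2'] at hsz
  have hrN : r * N ≤ M * N := mul_le_mul_of_nonneg_right hr0.2 hN0.le
  have hrN0 : 0 ≤ r * N := mul_nonneg hr0.1 hN0.le
  have hcell : (base : ℤ) + (r * N + c) < Z := by linarith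
  have hK0 : (0 : ℤ) ≤ K := by positivity
  have hcK : ((base : ℤ) + (r * N + c)) * K + K ≤ Z * K := by
    have := mul_le_mul_of_nonneg_right (Int.add_one_le_of_lt hcell) hK0
    linarith
  have hcK0 : 0 ≤ ((base : ℤ) + (r * N + c)) * K := mul_nonneg (by omega) hK0
  have hcK2 : (Z : ℤ) * K < 2 ^ w := by linarith
  have e14 : (τ₂.setReg 14 r).reg 14 = r := by simp [Memory.setReg]
  have en : ∀ q, q ≠ 14 → (τ₂.setReg 14 r).reg q = τ₂.reg q :=
    fun q hq => Memory.setReg_reg_of_ne _ _ hq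
  rw [← en 3 (by omega)] at e3
  rw [← en 5 (by omega)] at e5
  rw [← en 6 (by omega)] at e6
  rw [← en 20 (by omega)] at e20
  rw [← en 30 (by omega)] at e30
  rw [← en 31 (by omega)] at h31
  refine Sim.det (by decide) (fun _ => ?_) ⟨?_, ?_, ?_, ?_, ?_⟩
  · exact dictStore_ok e3 e5 e6 e14 e20 h31 hsz hcb.1 hrN0 (by omega) (by omega) (by omega)
  · intro q hq
    rw [Prog.exec_reg _ _ _ (by simp [dictStore, Prog.block, Prog.regs]; omega),
      en _ (by omega), hf2 q (by omega), hf1 q (by omega), hf q hq]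
  · intro a h3 h4
    rw [Prog.exec_arr _ _ _ (by simp [dictStore, Prog.block, Prog.arrs]; omega), Memory.setReg,
      ha2', ha a h3 h4]
  · simp; omega
  · have := dictStore_exec e3 e5 e6 e14 e20 e30 h31 hsz
    refine ht.insert hcb.1 hcb.2 hr0.2 (v := lo + j) (by omega) (by omega) hxv ?_ ?_
    · rw [this.1, hL, ← ha2']; rfl
    · rw [this.2, hL, ← ha2']; rfl
  · rw [Prog.exec_reg _ _ _ (by simp [dictStore, Prog.block, Prog.regs]),
      en _ (by omega), e10]

/-! ### The loop over the main segment. -/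

open Prog in
/-- Determine the next cell of the class `reg 31` and its size. -/
def mainFetch : Prog := block [arith .add 18 6 31, load 19 5 18, arith .add 22 19 20, store 5 18 22,
  arith .mul 18 19 5, arith .add 18 18 31, arith .add 18 6 18, load 19 3 18]

theorem mainFetch_exec {σ : Memory} {c : ℤ} {N base q L : ℕ}
    (h5 : σ.reg 5 = N) (h6 : σ.reg 6 = base) (h20 : σ.reg 20 = 1) (h31 : σ.reg 31 = c)
    (hq : σ.arr 5 (base + c) = q) (hL : σ.arr 3 (base + ((q : ℤ) * N + c)) = L) :
    (mainFetch.exec σ).arr 5 = Function.update (σ.arr 5) (base + c) (q + 1) ∧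
    (mainFetch.exec σ).reg 18 = base + ((q : ℤ) * N + c) ∧ (mainFetch.exec σ).reg 19 = L := by
  simp [mainFetch, Prog.block, Prog.exec, Memory.setReg, Memory.setArr, ArithOp.eval,
    h5, h6, h20, h31, hq, hL]

theorem mainFetch_ok {σ : Memory} {c : ℤ} {N base q w : ℕ}
    (h5 : σ.reg 5 = N) (h6 : σ.reg 6 = base) (h20 : σ.reg 20 = 1) (h31 : σ.reg 31 = c)
    (hq : σ.arr 5 (base + c) = q) (hc0 : 0 ≤ c) (hqw : (q : ℤ) + 1 < 2 ^ w)
    (h1 : (base : ℤ) + ((q : ℤ) * N + c) < 2 ^ w) : mainFetch.Ok w σ := by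
  have hqN : 0 ≤ (q : ℤ) * N := by positivity
  simp [-abs_mul, mainFetch, Prog.block, Prog.exec, Prog.Ok, Memory.setReg, Memory.setArr,
    ArithOp.eval, h5, h6, h20, h31, hq]
  simp only [abs_lt]
  omega

open Prog in
/-- Body of the loop over the main segment. -/
def mainBody : Prog :=
  .seq (block [arith .sub 10 10 20, const 30 0, arith .add 30 30 10, arith .add 30 30 24])
  (.seq cosetProg (.seq mainFetch (.seq (rand 14 3) (.seq (arith .sub 22 19 14)
    (.ite 22 (.seq (block [arith .mul 18 18 3, arith .add 18 18 14, load 17 4 18])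
      (.seq avgProg (arith .add 16 16 20))) skip)))))

/-- Invariant of the loop over the main segment. -/
structure MainInv {d : ℕ} (B base N A lo : ℕ) (xs : List (Fin d → ℤ)) (σ₀ : Memory) (j : ℕ)
    (s : List ℤ × List (Fin d → ℤ)) (σ : Memory) : Prop where
  frame : ∀ r, r < 10 ∨ (10 < r ∧ r < 14) ∨ r = 15 ∨ r = 20 ∨ r = 21 ∨ (22 < r ∧ r < 30) ∨
    40 ≤ r → σ.reg r = σ₀.reg r
  arr : ∀ a, a ≠ 1 → a ≠ 5 → σ.arr a = σ₀.arr a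
  occ : ∀ c : ℤ, 0 ≤ c → σ.arr 5 (base + c) = s.1.count c
  seen : ∀ c ∈ s.1, c < N
  len₁ : s.1.length + j = A
  len₂ : s.2.length + j ≤ A
  out : σ.reg 16 = s.2.length
  vout : ∀ o (h : o < s.2.length), VecAt σ o s.2[o]
  vin : ∀ v (h : v < xs.length), lo ≤ v → VecAt σ v xs[v]
  bd : ∀ i, |σ.arr 1 i| < 2 ^ B
  ctr : σ.reg 10 = j

set_option maxHeartbeats 1000000 in
-- Outputs overwrite array `1` from position `0`. They stay below `A ≤ lo`, inside the test segment
-- that is no longer needed, while the dictionary points to positions in `[lo, hi)` and the main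
-- segment starts at `hi`. Hence every vector still to be read is intact. Array `5` records how
-- often each class has occurred, which is the label of the next unopened cell.
theorem mainBody_sim {d w B M N K Z base : ℕ} (hB : Bounds d w B M N K Z) {σ : Memory}
    (hc : Ctx d K N base σ) (xs : List (Fin d → ℤ)) (hM : xs.length ≤ M)
    (hbase : base + N * (M + 1) ≤ Z) (A lo hi : ℕ) (hn : hi + A ≤ xs.length) (hlohi : lo ≤ hi)
    (hAlo : A ≤ lo) (hKA : 0 < A → 0 < K) (h24 : σ.reg 24 = hi)
    (dict : List ((ℤ × ℤ) × (Fin d → ℤ))) (hdl : dict.length ≤ M)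
    (hd : Table base N K M lo hi xs dict σ) (hinv : MainInv B base N A lo xs σ A ([], []) σ) :
    Sim (Memory.Bdd w) (.loop 10 mainBody) σ (A * (50 * (d + 1) + 100) + 1)
      (iter (fun j s => mainStep cosetCode vecAvg K dict (xs.getD (hi + j) default) s) A ([], []))
      fun s σ' => MainInv B base N A lo xs σ 0 s σ' := by
  have hZ1 : ((Z : ℤ) + 2) * (K + 2) ≤ 2 ^ w := by exact_mod_cast hB.hZ
  have hZ2 : (Z : ℤ) + 2 ≤ 2 ^ w := by nlinarith
  have hN1 : (N : ℤ) = 2 ^ d := by rw [hB.hN]; push_cast; rfl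
  have hbN : (base : ℤ) + N * (M + 1) ≤ Z := by exact_mod_cast hbase
  have hMZ : (M : ℤ) ≤ Z := by exact_mod_cast hB.hMZ
  have hN0 : (0 : ℤ) < N := by rw [hN1]; positivity
  have hMd : (M : ℤ) * d < 2 ^ w := by
    have : M * d < 2 ^ w := by nlinarith [hB.hM]
    exact_mod_cast this
  have hBw : (2 : ℤ) * 2 ^ B ≤ 2 ^ w := by exact_mod_cast hB.hB
  refine Sim.mono (T := A * (9 + (20 * (d + 1) + (17 + (1 + (1 + (7 + (25 * (d + 1) + 1 + 1) + 1
    + 1) + 1) + 1) + 1) + 1) + 1 + 1) + 1) ?_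
    (Nat.add_le_add_right (Nat.mul_le_mul_left A (by omega)) 1)
  refine Sim.loop (W := Memory.Bdd w) (x := 10) (p := mainBody)
      (fun j s => mainStep cosetCode vecAvg K dict (xs.getD (hi + j) default) s)
      (MainInv B base N A lo xs σ) (fun j _ _ h => h.ctr) A ?_ A ([], []) σ le_rfl hinv
  rintro j ⟨seen, out⟩ τ hj _ hI
  have hjx : hi + j < xs.length := by omega
  have hcτ : Ctx d K N base τ := hc.frame fun r hr => hI.frame r (by omega)
  have e20 := hcτ.h20
  have e24 : τ.reg 24 = hi := by rw [hI.frame 24 (by omega), h24]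
  have h10 := hI.ctr
  refine Sim.seq_pure (R := fun σ' => (∀ r, r ≠ 10 ∧ r ≠ 30 → σ'.reg r = τ.reg r) ∧
    σ'.arr = τ.arr ∧ σ'.reg 10 = j ∧ σ'.reg 30 = ((hi + j : ℕ) : ℤ)) ?_ ?_
  · refine Sim.det (by decide) (fun _ => ?_) ⟨fun r hr => ?_, ?_⟩
    · simp [Prog.block, Prog.exec, Prog.Ok, Memory.setReg, ArithOp.eval, h10, e20, e24]
      simp only [abs_lt]
      omega
    · rw [Prog.exec_reg _ _ _ (by simp [Prog.block, Prog.regs]; omega)]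
    · simp [Prog.block, Prog.exec, Memory.setReg, ArithOp.eval, Function.update_apply, h10, e20,
        e24]
      ring
  intro τ₁ _ ⟨hf1, ha1, h10', h30⟩
  have hcτ1 : Ctx d K N base τ₁ := hcτ.frame fun r hr => hf1 r (by omega)
  refine Sim.seq_pure (cosetProg_sim' hB hcτ1 xs[hi + j] (hi + j) (fun i => ?_)
    (fun i => ?_) (by omega) h30) ?_
  · rw [ha1]; exact hI.vin _ hjx (by omega) i
  · rw [ha1]; exact hI.bd i
  intro τ₂ _ ⟨hf2, ha2, h31⟩
  have hcτ2 : Ctx d K N base τ₂ := hcτ1.frame fun r hr => hf2 r (by omega)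
  have hcb := cosetCode_bounds xs[hi + j]
  rw [← hN1] at hcb
  have hxj : xs.getD (hi + j) default = xs[hi + j] := by simp [hjx]
  rw [mainStep, ← PMF.bind_pure_comp, hxj]
  have ha2' : τ₂.arr = τ.arr := by rw [ha2, ha1]
  have hq : τ₂.arr 5 (base + cosetCode xs[hi + j]) = seen.count (cosetCode xs[hi + j]) := by
    rw [ha2']; exact hI.occ _ hcb.1
  have hqM : seen.count (cosetCode xs[hi + j]) < M :=
    lt_of_le_of_lt List.count_le_length (by have := hI.len₁; simp only at this; omega)
  have hsz := hd.size _ (seen.count (cosetCode xs[hi + j]) : ℤ) hcb.1 hcb.2 (by positivity)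
  rw [← hI.arr 3 (by omega) (by omega), ← ha2'] at hsz
  have hslot := hd.slot _ (seen.count (cosetCode xs[hi + j]) : ℤ) hcb.1 hcb.2 (by positivity)
  have hLl := (lookup_length_le dict
    (cosetCode xs[hi + j], (seen.count (cosetCode xs[hi + j]) : ℤ))).trans hdl
  simp only
  generalize hcg : cosetCode xs[hi + j] = c at *
  generalize hqg : seen.count c = q at *
  generalize lookup dict (c, (q : ℤ)) = L at *
  have hqM' : (q : ℤ) + 1 ≤ M := by exact_mod_cast hqM
  have hqN : (q : ℤ) * N ≤ M * N := mul_le_mul_of_nonneg_right (by omega) hN0.le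
  have hqN0 : 0 ≤ (q : ℤ) * N := by positivity
  have hcell : (base : ℤ) + (q * N + c) < Z := by linarith
  have hK0 : (0 : ℤ) ≤ K := by positivity
  have hcK : ((base : ℤ) + (q * N + c)) * K + K ≤ Z * K := by
    have := mul_le_mul_of_nonneg_right (Int.add_one_le_of_lt hcell) hK0
    linarith
  have hcK0 : 0 ≤ ((base : ℤ) + (q * N + c)) * K := mul_nonneg (by omega) hK0
  have hcK2 : (Z : ℤ) * K + K < 2 ^ w := by linarith
  have e2 := hcτ2.h3
  have e5 := hcτ2.h5
  have e6 := hcτ2.h6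
  have e20 := hcτ2.h20
  refine Sim.seq_pure (T₁ := 17) (R := fun σ' => σ' = mainFetch.exec τ₂) (Sim.det (by decide)
    (fun _ => mainFetch_ok e5 e6 e20 h31 hq hcb.1 (by omega) (by omega)) rfl) ?_
  intro τ₃ hb3 e3
  obtain ⟨k5, k18, k19⟩ := mainFetch_exec e5 e6 e20 h31 hq hsz
  rw [← e3] at k5 k18 k19
  have hf3 : ∀ r, r ≠ 18 → r ≠ 19 → r ≠ 22 → τ₃.reg r = τ₂.reg r := fun r h1 h2 h3 => by
    rw [e3, Prog.exec_reg _ _ _ (by simp [mainFetch, Prog.block, Prog.regs]; omega)]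
  have ha3 : ∀ a, a ≠ 5 → τ₃.arr a = τ.arr a := fun a h => by
    rw [e3, Prog.exec_arr _ _ _ (by simp [mainFetch, Prog.block, Prog.arrs]; omega), ha2']
  clear e3
  have hr := Sim.rand 14 3 τ₃ hb3
  rw [hf3 3 (by omega) (by omega) (by omega), e2] at hr
  refine Sim.seq (T₁ := 1) hr ?_
  rintro u hus τ₄ _ rfl
  have hu := (mem_support_uniformBelow hus).1 (by have := hKA (by omega); exact_mod_cast this)
  obtain ⟨n, rfl⟩ := Int.eq_ofNat_of_zero_le hu.1
  have hnK : n < K := by exact_mod_cast hu.2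
  have hregs : ∀ r, r ≠ 10 → r ≠ 30 → (r < 31 ∨ 40 ≤ r) → r ≠ 18 → r ≠ 19 → r ≠ 22 → r ≠ 14 →
      ((τ₃.setReg 14 (n : ℤ)).reg r) = τ.reg r := fun r h1 h2 h3 h4 h5 h6 h7 => by
    rw [Memory.setReg_reg_of_ne _ _ h7, hf3 r h4 h5 h6, hf2 r h3, hf1 r ⟨h1, h2⟩]
  have m18 : (τ₃.setReg 14 (n : ℤ)).reg 18 = base + (q * N + c) := by
    rw [Memory.setReg_reg_of_ne _ _ (by omega), k18]
  have m19 : (τ₃.setReg 14 (n : ℤ)).reg 19 = L.length := by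
    rw [Memory.setReg_reg_of_ne _ _ (by omega), k19]
  have m14 : (τ₃.setReg 14 (n : ℤ)).reg 14 = n := by simp [Memory.setReg]
  have m10 : (τ₃.setReg 14 (n : ℤ)).reg 10 = j := by
    rw [Memory.setReg_reg_of_ne _ _ (by omega), hf3 10 (by omega) (by omega) (by omega),
      hf2 10 (by omega), h10']
  have m30 : (τ₃.setReg 14 (n : ℤ)).reg 30 = ((hi + j : ℕ) : ℤ) := by
    rw [Memory.setReg_reg_of_ne _ _ (by omega), hf3 30 (by omega) (by omega) (by omega),
      hf2 30 (by omega), h30]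
  have mctx : Ctx d K N base (τ₃.setReg 14 (n : ℤ)) := hcτ.frame fun r hr =>
    hregs r (by omega) (by omega) (by omega) (by omega) (by omega) (by omega) (by omega)
  have marr : (τ₃.setReg 14 (n : ℤ)).arr = τ₃.arr := rfl
  rw [← marr] at k5 ha3
  generalize τ₃.setReg 14 (n : ℤ) = τ₄ at *
  have hslot4 : ∀ y, L[n]? = some y → ∃ v : ℕ, lo ≤ v ∧ v < hi ∧
      τ₄.arr 4 ((base + (q * N + c)) * K + n) = v ∧ xs.getD v default = y := by
    intro y hy
    obtain ⟨v, h1, h2, h3, h4⟩ := hslot n hnK y hy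
    refine ⟨v, h1, h2, ?_, h4⟩
    rw [ha3 4 (by omega), hI.arr 4 (by omega) (by omega), h3]
  have hocc : ∀ c' : ℤ, 0 ≤ c' → τ₄.arr 5 (base + c') = (c :: seen).count c' := by
    intro c' hc'
    rw [k5, List.count_cons]
    by_cases h : c = c'
    · subst h
      simp [hqg]
    · rw [Function.update_of_ne (by omega), ha2', hI.occ c' hc']
      simp [h]
  have hI' : ∀ σ' : Memory, σ'.arr 5 = τ₄.arr 5 → (∀ a, a ≠ 1 → a ≠ 5 → σ'.arr a = τ₄.arr a) →
      (∀ r, r < 10 ∨ (10 < r ∧ r < 14) ∨ r = 15 ∨ r = 20 ∨ r = 21 ∨ (22 < r ∧ r < 30) ∨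
      40 ≤ r → σ'.reg r = τ₄.reg r) → ∀ out' : List (Fin d → ℤ), out'.length ≤ out.length + 1 →
      σ'.reg 16 = out'.length → (∀ o (h : o < out'.length), VecAt σ' o out'[o]) →
      (∀ v (h : v < xs.length), lo ≤ v → VecAt σ' v xs[v]) → (∀ i, |σ'.arr 1 i| < 2 ^ B) →
      σ'.reg 10 = j → MainInv B base N A lo xs σ j (c :: seen, out') σ' := by
    intro σ' a5 a1 fr out' hl h16 hvo hvi hbd h10
    have hl1 := hI.len₁
    have hl2 := hI.len₂
    simp only at hl1 hl2
    refine ⟨fun r hr => ?_, fun a h1 h5 => ?_, fun c' hc' => ?_, fun c' hc' => ?_, ?_, ?_, h16, hvo,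
      hvi, hbd, h10⟩
    · rw [fr r hr, hregs r (by omega) (by omega) (by omega) (by omega) (by omega) (by omega)
        (by omega), hI.frame r hr]
    · rw [a1 a h1 h5, ha3 a h5, hI.arr a h1 h5]
    · rw [a5, hocc c' hc']
    · rcases List.mem_cons.1 hc' with rfl | hc'
      · exact hcb.2
      · exact hI.seen c' hc'
    · simp only [List.length_cons]; omega
    · simp only; omega
  have hvin4 : ∀ v (h : v < xs.length), lo ≤ v → VecAt τ₄ v xs[v] := fun v h hl i => by
    rw [ha3 1 (by omega)]; exact hI.vin v h hl i
  have hbd4 : ∀ i, |τ₄.arr 1 i| < 2 ^ B := fun i => by rw [ha3 1 (by omega)]; exact hI.bd i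
  have hvout4 : ∀ o (h : o < out.length), VecAt τ₄ o out[o] := fun o h i => by
    rw [ha3 1 (by omega)]; exact hI.vout o h i
  have m16 : τ₄.reg 16 = out.length := by
    rw [hregs 16 (by omega) (by omega) (by omega) (by omega) (by omega) (by omega) (by omega)]
    exact hI.out
  have hlen2 := hI.len₂
  simp only at hlen2
  clear hregs hI hslot hsz hq k18 k19 k5 hocc ha3 hf3 hb3 hr hus hinv
  simp only [Function.comp, Int.toNat_natCast]
  refine Sim.seq_pure (T₁ := 1) (R := fun σ' => σ' = τ₄.setReg 22 (L.length - n))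
    (Sim.det (by decide) (fun _ => ?_) ?_) ?_
  · simp only [Prog.Ok, ArithOp.eval, m19, m14, abs_lt]
    omega
  · simp [Prog.exec, ArithOp.eval, m19, m14]
  rintro τ₅ _ rfl
  have hf5 : ∀ r, r ≠ 22 → (τ₄.setReg 22 ((L.length : ℤ) - n)).reg r = τ₄.reg r :=
    fun r h => Memory.setReg_reg_of_ne _ _ h
  have m22 : (τ₄.setReg 22 ((L.length : ℤ) - n)).reg 22 = L.length - n := by simp [Memory.setReg]
  have ha5 : (τ₄.setReg 22 ((L.length : ℤ) - n)).arr = τ₄.arr := rfl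
  generalize τ₄.setReg 22 ((L.length : ℤ) - n) = τ₅ at *
  refine Sim.ite (fun h => ?_) fun h => ?_
  · rw [m22] at h
    have hnL : n < L.length := by omega
    obtain ⟨v, hv1, hv2, hv3, hv4⟩ := hslot4 L[n] (by simp [hnL])
    have hvx : v < xs.length := by omega
    have hv4' : xs[v] = L[n] := by rw [← hv4]; simp [hvx]
    rw [List.getElem?_eq_getElem hnL]
    refine Sim.seq_pure (T₁ := 7) (R := fun σ' => (∀ r, r ≠ 18 → r ≠ 17 → σ'.reg r = τ₅.reg r) ∧
      σ'.arr = τ₄.arr ∧ σ'.reg 17 = v) (Sim.det (by decide) (fun _ => ?_) ⟨?_, ?_, ?_⟩) ?_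
    · have k3 : τ₅.reg 3 = K := by rw [hf5 3 (by omega), mctx.h3]
      have k14 : τ₅.reg 14 = n := by rw [hf5 14 (by omega), m14]
      have k18 : τ₅.reg 18 = base + (q * N + c) := by rw [hf5 18 (by omega), m18]
      simp [-abs_mul, Prog.block, Prog.exec, Prog.Ok, Memory.setReg, ArithOp.eval, k3, k14, k18]
      simp only [abs_lt]
      omega
    · intro r h1 h2
      rw [Prog.exec_reg _ _ _ (by simp [Prog.block, Prog.regs]; omega)]
    · ext a
      rw [Prog.exec_arr _ _ _ (by simp [Prog.block, Prog.arrs]), ha5]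
    · have k3 : τ₅.reg 3 = K := by rw [hf5 3 (by omega), mctx.h3]
      have k14 : τ₅.reg 14 = n := by rw [hf5 14 (by omega), m14]
      have k18 : τ₅.reg 18 = base + (q * N + c) := by rw [hf5 18 (by omega), m18]
      simp [Prog.block, Prog.exec, Memory.setReg, ArithOp.eval, k3, k14, k18, ha5, hv3]
    intro τ₆ _ ⟨hf6, ha6, r17⟩
    have hf6' : ∀ r, r ≠ 18 → r ≠ 17 → r ≠ 22 → τ₆.reg r = τ₄.reg r := fun r h1 h2 h3 => by
      rw [hf6 r h1 h2, hf5 r h3]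
    have hl2 : out.length + 1 ≤ A := by omega
    refine Sim.seq_pure (T₂ := 1) (avgProg_sim τ₆ xs[hi + j] L[n] out.length (hi + j) v M
      (by rw [hf6' 1 (by omega) (by omega) (by omega), mctx.h1])
      (by rw [hf6' 20 (by omega) (by omega) (by omega), mctx.h20])
      (by rw [hf6' 21 (by omega) (by omega) (by omega), mctx.h21])
      (by rw [hf6' 30 (by omega) (by omega) (by omega), m30])
      (by rw [hf6' 16 (by omega) (by omega) (by omega), m16]) r17
      (fun i => by rw [ha6]; exact hvin4 _ hjx (by omega) i)
      (fun i => by rw [ha6, ← hv4']; exact hvin4 v hvx hv1 i)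
      (by omega) (by omega) (by omega) (by omega) (by omega) hMd
      (fun i => by rw [ha6]; exact hbd4 i) hBw) ?_
    intro τ₇ _ ⟨hf7, ha7, hvo, hvn, hbd7⟩
    have k16 : τ₇.reg 16 = out.length := by
      rw [hf7 16 (by omega), hf6' 16 (by omega) (by omega) (by omega), m16]
    have k20 : τ₇.reg 20 = 1 := by
      rw [hf7 20 (by omega), hf6' 20 (by omega) (by omega) (by omega), mctx.h20]
    refine Sim.det (by decide) (fun _ => ?_) ?_
    · simp only [Prog.Ok, ArithOp.eval, k16, k20, abs_lt]
      omega
    · simp only [Prog.exec, ArithOp.eval, k16, k20]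
      have hf8 : ∀ r, r ≠ 16 → (τ₇.setReg 16 ((out.length : ℤ) + 1)).reg r = τ₇.reg r :=
        fun r h => Memory.setReg_reg_of_ne _ _ h
      refine hI' _ ?_ ?_ ?_ _ (by simp) ?_ ?_ ?_ hbd7 ?_
      · show τ₇.arr 5 = _
        rw [ha7 5 (by omega), ha6]
      · intro a h1 h5
        show τ₇.arr a = _
        rw [ha7 a h1, ha6]
      · intro r hr
        rw [hf8 r (by omega), hf7 r (by omega), hf6' r (by omega) (by omega) (by omega)]
      · simp [Memory.setReg]
      · intro o ho
        simp only [Option.map_some, Option.toList_some, List.length_append,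
          List.length_singleton] at ho
        rcases Nat.lt_succ_iff_lt_or_eq.1 ho with ho | rfl
        · rw [List.getElem_append_left ho]
          exact hvn o (by omega) _ fun i => by rw [ha6]; exact hvout4 o ho i
        · simp only [Option.map_some, Option.toList_some, List.getElem_concat_length]
          exact hvo
      · intro v' h hl
        exact hvn v' (by omega) _ fun i => by rw [ha6]; exact hvin4 v' h hl i
      · rw [hf8 10 (by omega), hf7 10 (by omega), hf6' 10 (by omega) (by omega) (by omega), m10]
  · rw [m22] at h
    rw [List.getElem?_eq_none (by omega)]
    refine Sim.det (by simp [Prog.cost]) (fun _ => trivial) ?_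
    simp only [Prog.exec, Option.map_none, Option.toList_none, List.append_nil]
    exact hI' _ (by rw [ha5]) (fun a _ _ => by rw [ha5]) (fun r hr => hf5 r (by omega)) _ (by omega)
      (by rw [hf5 16 (by omega), m16]) (fun o h i => by rw [ha5]; exact hvout4 o h i)
      (fun o h hl i => by rw [ha5]; exact hvin4 o h hl i) (fun i => by rw [ha5]; exact hbd4 i)
      (by rw [hf5 10 (by omega), m10])

/-! ### A whole stage and the whole program. -/

open Prog in
/-- One combining stage. -/
def stageProg : Prog :=
  .seq (block [arith .sub 2 2 20, const 31 32, arith .mul 31 31 3, arith .div 8 4 31, const 9 0,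
    const 31 16, arith .mul 10 31 8, const 30 0, arith .add 23 30 10])
  (.seq (.loop 10 testBody) (.seq (block [arith .mul 10 23 3, arith .add 11 8 8, arith .mul 11 11 3,
    const 12 0, const 13 0])
  (.seq (.loop 10 poissonBody) (.seq (block [arith .add 31 8 8, arith .add 31 31 31,
    arith .mul 31 31 3, arith .add 24 23 31, arith .sub 32 12 31,
    ite 32 (block [const 12 0, arith .add 12 12 31]) skip, const 30 0, arith .add 10 30 12])
  (.seq (.loop 10 dictBody) (.seq (block [const 16 0, const 30 0, arith .add 10 30 8])
  (.seq (.loop 10 mainBody) (block [const 30 0, arith .add 4 30 16, arith .add 6 6 7]))))))))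

/-- Invariant of the loop over the stages; `r` is the number of remaining stages. -/
structure StageInv {d : ℕ} (B M N K Z r : ℕ) (xs : List (Fin d → ℤ)) (base : ℕ) (σ : Memory) :
    Prop where
  ctx : Ctx d K N base σ
  room : base + r * (N * (M + 1)) ≤ Z
  h2 : σ.reg 2 = r
  h4 : σ.reg 4 = xs.length
  h7 : σ.reg 7 = N * (M + 1)
  len : xs.length ≤ M
  stored : Stored B xs σ
  fresh : ∀ i : ℤ, base ≤ i → σ.arr 2 i = 0 ∧ σ.arr 3 i = 0 ∧ σ.arr 5 i = 0

theorem Table.mono {d base N K M lo hi hi' : ℕ} {xs : List (Fin d → ℤ)}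
    {l : List ((ℤ × ℤ) × (Fin d → ℤ))} {σ : Memory} (ht : Table base N K M lo hi xs l σ)
    (h : hi ≤ hi') : Table base N K M lo hi' xs l σ := by
  refine ⟨ht.size, fun i k h0 h1 h2 u hu y hy => ?_, ht.label⟩
  obtain ⟨v, h3, h4, h5⟩ := ht.slot i k h0 h1 h2 u hu y hy
  exact ⟨v, h3, by omega, h5⟩

theorem Table.congr {d base N K M lo hi : ℕ} {xs : List (Fin d → ℤ)}
    {l : List ((ℤ × ℤ) × (Fin d → ℤ))} {σ σ' : Memory} (ht : Table base N K M lo hi xs l σ)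
    (h3 : σ'.arr 3 = σ.arr 3) (h4 : σ'.arr 4 = σ.arr 4) : Table base N K M lo hi xs l σ' := by
  refine ⟨?_, ?_, ht.label⟩
  · rw [h3]; exact ht.size
  · rw [h4]; exact ht.slot

set_option maxHeartbeats 1000000 in
-- Tables are never cleared. Each stage works in a block of `N * (M + 1)` cells starting at `base`,
-- and the next stage moves `base` past it; what has to be shown is that counters and cell sizes
-- beyond the block are still zero. Array `4` may contain garbage, since it is only read below a
-- recorded cell size.
theorem stageProg_sim {d w B M N K Z base r : ℕ} (hB : Bounds d w B M N K Z) {σ : Memory}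
    (xs : List (Fin d → ℤ)) (hI : StageInv B M N K Z (r + 1) xs base σ) :
    Sim (Memory.Bdd w) stageProg σ (M * (200 * (d + 1) + 1000))
      (stage cosetCode vecAvg K xs)
      fun ys σ' => StageInv B M N K Z r ys (base + N * (M + 1)) σ' := by
  obtain ⟨hc, hroom, h2, h4, h7, hlen, hst, hfr⟩ := hI
  have hbase : base + N * (M + 1) ≤ Z := by rw [Nat.succ_mul] at hroom; omega
  have h32 := hB.h32
  have hMZ := hB.hMZ
  have hZ0 : (Z + 2) * (K + 2) ≤ 2 ^ w := hB.hZ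
  have hZ1 : 34 * (K + 2) ≤ 2 ^ w := by nlinarith
  have hZ2 : Z + 2 ≤ 2 ^ w := by nlinarith
  have hZ1' : 34 * ((K : ℤ) + 2) ≤ 2 ^ w := by exact_mod_cast hZ1
  have hZ2' : (Z : ℤ) + 2 ≤ 2 ^ w := by exact_mod_cast hZ2
  unfold stage
  simp only
  obtain ⟨A, hAdef⟩ : ∃ A, A = xs.length / (32 * K) := ⟨_, rfl⟩
  rw [← hAdef]
  have hA1 : A * (32 * K) ≤ xs.length := by rw [hAdef]; exact Nat.div_mul_le_self _ _
  -- For `K = 0` the division by zero yields `A = 0`, so all loops of the stage are empty.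
  have hKA : 0 < A → 0 < K := fun h => by
    rcases Nat.eq_zero_or_pos K with h0 | h0
    · subst h0; simp at hAdef; omega
    · exact h0
  obtain ⟨P, hP⟩ : ∃ P, P = K * A := ⟨_, rfl⟩
  have hAP : A ≤ P := by
    rcases Nat.eq_zero_or_pos A with h0 | h0
    · omega
    · rw [hP]; exact Nat.le_mul_of_pos_left _ (hKA h0)
  have hP1 : 32 * P ≤ xs.length := by rw [hP]; linarith
  rw [show 16 * K * A = 16 * P by rw [hP]; ring, show 2 * K * A = 2 * P by rw [hP]; ring,
    show 4 * K * A = 4 * P by rw [hP]; ring]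
  have hPz : (K : ℤ) * A = P := by rw [hP]; push_cast; rfl
  have hAz : (xs.length : ℤ) / (32 * K) = A := by rw [hAdef]; push_cast; rfl
  refine Sim.mono (T := 21 + ((16 * A * (20 * (d + 1) + 60) + 1) + (11 + ((16 * P * 60 + 1) +
    (25 + ((4 * P * (20 * (d + 1) + 60) + 1) + (7 + ((A * (50 * (d + 1) + 100) + 1) + 7 + 1) + 1)
    + 1) + 1) + 1) + 1) + 1) + 1) ?_ ?_
  swap
  · have i1 : 16 * A * (20 * (d + 1) + 60) ≤ 16 * P * (20 * (d + 1) + 60) :=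
      Nat.mul_le_mul_right _ (by omega)
    have i2 : A * (50 * (d + 1) + 100) ≤ P * (50 * (d + 1) + 100) :=
      Nat.mul_le_mul_right _ (by omega)
    have i3 : 32 * P * (200 * (d + 1) + 1000) ≤ M * (200 * (d + 1) + 1000) :=
      Nat.mul_le_mul_right _ (by omega)
    have i4 : (32 * P + 32) * (100 * (d + 1) + 500) ≤ 2 * M * (100 * (d + 1) + 500) :=
      Nat.mul_le_mul_right _ (by omega)
    nlinarith
  -- sizes
  refine Sim.seq_pure (R := fun σ' => (∀ q, q ≠ 2 → q ≠ 8 → q ≠ 9 → q ≠ 10 → q ≠ 23 → q ≠ 30 →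
    q ≠ 31 → σ'.reg q = σ.reg q) ∧ σ'.arr = σ.arr ∧ σ'.reg 2 = r ∧ σ'.reg 8 = A ∧ σ'.reg 9 = 0 ∧
    σ'.reg 10 = ((16 * A : ℕ) : ℤ) ∧ σ'.reg 23 = ((16 * A : ℕ) : ℤ))
    (Sim.det (by decide) (fun _ => ?_) ⟨?_, ?_, ?_⟩) ?_
  · have hr : ((r : ℤ)) < 2 ^ w := by
      have hNpos : 0 < N := by rw [hB.hN]; positivity
      have : r + 1 ≤ (r + 1) * (N * (M + 1)) := Nat.le_mul_of_pos_right (r + 1) (Nat.mul_pos hNpos (Nat.succ_pos M))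
      omega
    have e20 := hc.h20
    have e3 := hc.h3
    simp [-abs_mul, Prog.block, Prog.exec, Prog.Ok, Memory.setReg, ArithOp.eval, h2, e20, e3, h4,
      hAz]
    simp only [abs_lt]
    omega
  · intro q _ _ _ _ _ _ _
    rw [Prog.exec_reg _ _ _ (by simp [Prog.block, Prog.regs]; omega)]
  · ext a; rw [Prog.exec_arr _ _ _ (by simp [Prog.block, Prog.arrs])]
  · have e20 := hc.h20
    have e3 := hc.h3
    simp [Prog.block, Prog.exec, Memory.setReg, ArithOp.eval, h2, e20, e3, h4, hAz]
  rintro σ₁ _ ⟨f1, a1, r2, r8, r9, r10, r23⟩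
  have hc1 : Ctx d K N base σ₁ := hc.frame fun q hq => f1 q (by omega) (by omega) (by omega)
    (by omega) (by omega) (by omega) (by omega)
  -- test segment
  refine Sim.seq_pure (testBody_sim hB hc1 xs (hst.frame (by rw [a1])) hlen hbase (16 * A)
    (by omega) r10 r9 (fun i hi => by rw [a1]; exact (hfr i hi).1)) ?_
  rintro σ₂ _ ⟨f2, a2, fresh2, r9⟩
  have hc2 : Ctx d K N base σ₂ := hc1.frame fun q hq => f2 q (by omega)
  generalize hJ : maxMult ((xs.take (16 * A)).map cosetCode) = J at *
  have hJM : J ≤ M := by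
    rw [← hJ]
    refine (maxMult_le_length _).trans ?_
    simp; omega
  rw [← f2 8 (by omega)] at r8
  rw [← f2 2 (by omega)] at r2
  rw [← f2 23 (by omega)] at r23
  -- Poisson number
  refine Sim.seq_pure (R := fun σ' => (∀ q, q < 10 ∨ 13 < q → σ'.reg q = σ₂.reg q) ∧
    σ'.arr = σ₂.arr ∧ σ'.reg 10 = ((16 * P : ℕ) : ℤ) ∧ σ'.reg 11 = ((2 * P : ℕ) : ℤ) ∧
    σ'.reg 12 = 0 ∧ σ'.reg 13 = 0) (Sim.det (by decide) (fun _ => ?_) ⟨?_, ?_, ?_⟩) ?_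
  · have e3 := hc2.h3
    have e1 : (16 * (A : ℤ)) * K = 16 * P := by rw [← hPz]; ring
    have e2 : ((A : ℤ) + A) * K = 2 * P := by rw [← hPz]; ring
    simp [-abs_mul, Prog.block, Prog.exec, Prog.Ok, Memory.setReg, ArithOp.eval, r8, e3, r23,
      e1, e2]
    simp only [abs_lt]
    omega
  · intro q _
    rw [Prog.exec_reg _ _ _ (by simp [Prog.block, Prog.regs]; omega)]
  · ext a; rw [Prog.exec_arr _ _ _ (by simp [Prog.block, Prog.arrs])]
  · have e3 := hc2.h3
    have e1 : (16 * (A : ℤ)) * K = 16 * P := by rw [← hPz]; ring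
    have e2 : ((A : ℤ) + A) * K = 2 * P := by rw [← hPz]; ring
    simp [Prog.block, Prog.exec, Memory.setReg, ArithOp.eval, r8, e3, r23, e1, e2]
  rintro σ₃ _ ⟨f3, a3, r10, r11, r12, r13⟩
  have hc3 : Ctx d K N base σ₃ := hc2.frame fun q hq => f3 q (by omega)
  refine Sim.seq (poissonBody_sim hB hc3 (16 * P) (2 * P) (by omega) (by omega) r10 r11 r12 r13) ?_
  rintro ⟨_, W, _⟩ _ σ₄ _ ⟨f4, a4, r12, hW⟩
  simp only at r12 hW ⊢
  have hc4 : Ctx d K N base σ₄ := hc3.frame fun q hq => f4 q (by omega)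
  rw [← f3 8 (by omega), ← f4 8 (by omega)] at r8
  rw [← f3 9 (by omega), ← f4 9 (by omega)] at r9
  rw [← f3 2 (by omega), ← f4 2 (by omega)] at r2
  rw [← f3 23 (by omega), ← f4 23 (by omega)] at r23
  refine Sim.seq_pure (R := fun σ' => (∀ q, (q ≠ 10 ∧ q ≠ 12 ∧ q ≠ 24 ∧ q < 30) ∨ 40 ≤ q →
    σ'.reg q = σ₄.reg q) ∧
    σ'.arr = σ₄.arr ∧ σ'.reg 10 = ((min W (4 * P) : ℕ) : ℤ) ∧
    σ'.reg 24 = ((16 * A + 4 * P : ℕ) : ℤ)) (Sim.det (by decide) (fun _ => ?_) ⟨?_, ?_, ?_⟩) ?_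
  · have e3 := hc4.h3
    have e2 : ((A : ℤ) + A + (A + A)) * K = 4 * P := by rw [← hPz]; ring
    simp [-abs_mul, Prog.block, Prog.exec, Prog.Ok, Memory.setReg, ArithOp.eval, r8, e3, r23,
      r12, e2]
    split_ifs <;> simp only [abs_lt] <;> simp <;> omega
  · intro q _
    rw [Prog.exec_reg _ _ _ (by simp [Prog.block, Prog.regs]; omega)]
  · ext a; rw [Prog.exec_arr _ _ _ (by simp [Prog.block, Prog.arrs])]
  · have e3 := hc4.h3
    have e2 : ((A : ℤ) + A + (A + A)) * K = 4 * P := by rw [← hPz]; ring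
    simp [Prog.block, Prog.exec, Memory.setReg, ArithOp.eval, r8, e3, r23, r12, e2]
    split_ifs <;> simp <;> omega
  rintro σ₅ _ ⟨f5, a5, r10, r24⟩
  have hc5 : Ctx d K N base σ₅ := hc4.frame fun q hq => f5 q (by omega)
  rw [← f5 8 (by omega)] at r8
  rw [← f5 9 (by omega)] at r9
  rw [← f5 2 (by omega)] at r2
  rw [← f5 23 (by omega)] at r23
  have A5 : ∀ a, a ≠ 2 → σ₅.arr a = σ.arr a := fun a h => by rw [a5, a4, a3, a2 a h, a1]
  have A52 : σ₅.arr 2 = σ₂.arr 2 := by rw [a5, a4, a3]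
  -- dictionary
  refine Sim.seq (Sim.mono (dictBody_sim hB hc5 xs (hst.frame (A5 1 (by omega))) hlen hbase
    (min W (4 * P)) (16 * A) J (by omega) hJM r10 r9 r23
    (fun i hi => by rw [A5 3 (by omega)]; exact (hfr i hi).2.1))
    (Nat.add_le_add_right (Nat.mul_le_mul_right _ (min_le_right _ _)) 1)) ?_
  rintro dict _ σ₆ _ ⟨f6, a6, hdl, ht⟩
  have hc6 : Ctx d K N base σ₆ := hc5.frame fun q hq => f6 q (by omega)
  rw [← f6 8 (by omega)] at r8
  rw [← f6 2 (by omega)] at r2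
  rw [← f6 24 (by omega)] at r24
  refine Sim.seq_pure (R := fun σ' => (∀ q, (q ≠ 10 ∧ q ≠ 16 ∧ q < 30) ∨ 40 ≤ q →
    σ'.reg q = σ₆.reg q) ∧ σ'.arr = σ₆.arr ∧ σ'.reg 10 = A ∧ σ'.reg 16 = 0)
    (Sim.det (by decide) (fun _ => ?_) ⟨?_, ?_, ?_⟩) ?_
  · simp [Prog.block, Prog.exec, Prog.Ok, Memory.setReg, ArithOp.eval, r8]
    omega
  · intro q _
    rw [Prog.exec_reg _ _ _ (by simp [Prog.block, Prog.regs]; omega)]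
  · ext a; rw [Prog.exec_arr _ _ _ (by simp [Prog.block, Prog.arrs])]
  · simp [Prog.block, Prog.exec, Memory.setReg, ArithOp.eval, r8]
  rintro σ₇ _ ⟨f7, a7, r10, r16⟩
  have hc7 : Ctx d K N base σ₇ := hc6.frame fun q hq => f7 q (by omega)
  have A7 : ∀ a, a ≠ 2 → a ≠ 3 → a ≠ 4 → σ₇.arr a = σ.arr a := fun a h h3 h4 => by
    rw [a7, a6 a h3 h4, A5 a h]
  have hst7 : Stored B xs σ₇ := hst.frame (A7 1 (by omega) (by omega) (by omega))
  rw [← PMF.bind_pure_comp]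
  -- main segment
  refine Sim.seq (T₂ := 7) (mainBody_sim hB hc7 xs hlen hbase A (16 * A) (16 * A + 4 * P)
    (by omega) (by omega) (by omega) hKA (by rw [f7 24 (by omega), r24]) dict hdl
    ((ht.mono (by omega)).congr (by rw [a7]) (by rw [a7])) ?_) ?_
  · exact ⟨fun _ _ => rfl, fun _ _ _ => rfl, fun c hc => by
        rw [A7 5 (by omega) (by omega) (by omega)]; simp [(hfr (base + c) (by omega)).2.2],
      by simp, by simp, by simp, by simp [r16], fun o h => absurd h (by simp),
      fun v h _ => hst7.vec v h, hst7.bd, r10⟩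
  rintro ⟨seen, ys⟩ _ σ₈ _ hI
  have hc8 : Ctx d K N base σ₈ := hc7.frame fun q hq => hI.frame q (by omega)
  have r16 := hI.out
  simp only at r16
  have r7 : σ₈.reg 7 = N * (M + 1) := by
    rw [hI.frame 7 (by omega), f7 7 (by omega), f6 7 (by omega), f5 7 (by omega), f4 7 (by omega),
      f3 7 (by omega), f2 7 (by omega), f1 7 (by omega) (by omega) (by omega) (by omega) (by omega)
      (by omega) (by omega), h7]
  rw [← f7 2 (by omega), ← hI.frame 2 (by omega)] at r2
  have hlen2 := hI.len₂
  simp only at hlen2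
  have e6 := hc8.h6
  have hbz : (base : ℤ) + N * (M + 1) ≤ Z := by exact_mod_cast hbase
  have hNM0 : (0 : ℤ) ≤ N * (M + 1) := by positivity
  have hNN : (N : ℤ) ≤ N * (M + 1) := by
    have : N ≤ N * (M + 1) := Nat.le_mul_of_pos_right _ (Nat.succ_pos _)
    exact_mod_cast this
  refine Sim.det (by decide) (fun _ => ?_) ?_
  · simp [-abs_mul, Prog.block, Prog.exec, Prog.Ok, Memory.setReg, ArithOp.eval, r16, e6, r7]
    simp only [abs_lt]
    omega
  · simp only [Function.comp]
    have fE : ∀ q, q ≠ 30 → q ≠ 4 → q ≠ 6 → ((Prog.block [.const 30 0, .arith .add 4 30 16,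
        .arith .add 6 6 7]).exec σ₈).reg q = σ₈.reg q := fun q _ _ _ => by
      rw [Prog.exec_reg _ _ _ (by simp [Prog.block, Prog.regs]; omega)]
    have aE : ((Prog.block [.const 30 0, .arith .add 4 30 16,
        .arith .add 6 6 7]).exec σ₈).arr = σ₈.arr := by
      ext a; rw [Prog.exec_arr _ _ _ (by simp [Prog.block, Prog.arrs])]
    have rE4 : ((Prog.block [.const 30 0, .arith .add 4 30 16,
        .arith .add 6 6 7]).exec σ₈).reg 4 = ys.length := by
      simp [Prog.block, Prog.exec, Memory.setReg, ArithOp.eval, r16]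
    have rE6 : ((Prog.block [.const 30 0, .arith .add 4 30 16,
        .arith .add 6 6 7]).exec σ₈).reg 6 = base + N * (M + 1) := by
      simp [Prog.block, Prog.exec, Memory.setReg, ArithOp.eval, e6, r7]
    refine ⟨⟨?_, ?_, ?_, ?_, ?_, ?_⟩, ?_, ?_, rE4, ?_, ?_, ⟨?_, ?_⟩, ?_⟩
    · rw [fE 1 (by omega) (by omega) (by omega), hc8.h1]
    · rw [fE 3 (by omega) (by omega) (by omega), hc8.h3]
    · rw [fE 5 (by omega) (by omega) (by omega), hc8.h5]
    · rw [rE6]; push_cast; rfl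
    · rw [fE 20 (by omega) (by omega) (by omega), hc8.h20]
    · rw [fE 21 (by omega) (by omega) (by omega), hc8.h21]
    · rw [Nat.succ_mul] at hroom; omega
    · rw [fE 2 (by omega) (by omega) (by omega), r2]
    · rw [fE 7 (by omega) (by omega) (by omega), r7]
    · omega
    · intro o h i
      rw [aE]
      exact hI.vout o h i
    · rw [aE]; exact hI.bd
    · intro i hi
      push_cast at hi
      rw [aE]
      refine ⟨?_, ?_, ?_⟩
      · rw [hI.arr 2 (by omega) (by omega), a7, a6 2 (by omega) (by omega), A52,
          fresh2 i (by omega)]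
      -- An address past the block decodes, by division by `N`, to a label larger than `M`; no
      -- dictionary entry has such a label, so the cell is empty and its size is zero.
      · rw [hI.arr 3 (by omega) (by omega), a7]
        have hNpos : (0 : ℤ) < N := by
          have : 0 < N := by rw [hB.hN]; positivity
          exact_mod_cast this
        have hdm := Int.emod_add_mul_ediv (i - base) N
        have hm0 := Int.emod_nonneg (i - base) hNpos.ne'
        have hm1 := Int.emod_lt_of_pos (i - base) hNpos
        have hk : (M : ℤ) + 1 ≤ (i - base) / N := by
          rw [Int.le_ediv_iff_mul_le hNpos]; linarith
        have := ht.size _ _ hm0 hm1 (by omega : 0 ≤ (i - base) / N)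
        rw [show (base : ℤ) + ((i - base) / N * N + (i - base) % N) = i by linarith] at this
        rw [this]
        simp only [lookup, List.length_map, Nat.cast_eq_zero, List.length_eq_zero_iff,
          List.filter_eq_nil_iff, decide_eq_true_eq]
        intro e he hee
        have := ht.label e he
        rw [hee] at this
        simp only at this
        omega
      · obtain ⟨c, rfl⟩ : ∃ c, i = base + c := ⟨i - base, by ring⟩
        rw [hI.occ c (by omega), Nat.cast_eq_zero, List.count_eq_zero]
        intro hc
        have := hI.seen c hc
        omega

open Prog in
/-- The whole algorithm: set up constants, copy the input to array `1`, and run the stages. -/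
def samplerProg : Prog :=
  .seq (block [const 20 1, const 21 2, const 31 512, arith .div 3 3 31, const 5 1, const 31 0,
    arith .add 10 31 1])
  (.seq (.loop 10 (block [arith .sub 10 10 20, arith .add 5 5 5]))
  (.seq (block [arith .add 7 4 20, arith .mul 7 5 7, arith .mul 10 4 1])
  (.seq (.loop 10 (block [arith .sub 10 10 20, load 31 0 10, store 1 10 31]))
  (.loop 2 stageProg))))

/-- `N = 2 ^ d` is obtained by repeated doubling and the input is copied from array `0` to array
`1`; after that the stages are a loop whose invariant hides the current block of table space
existentially. -/
theorem samplerProg_sim {d w B M N Z ℓ k : ℕ} (hB : Bounds d w B M N (k / 512) Z)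
    (hZ : ℓ * (N * (M + 1)) ≤ Z) (hZ' : N * (M + 1) < 2 ^ w) (hw : 1024 ≤ 2 ^ w) {σ : Memory}
    (xs : List (Fin d → ℤ)) (hlen : xs.length = M) (h1 : σ.reg 1 = d) (h2 : σ.reg 2 = ℓ)
    (h3 : σ.reg 3 = k) (h4 : σ.reg 4 = M) (h6 : σ.reg 6 = 0)
    (hx : ∀ j (h : j < xs.length) (i : Fin d), σ.arr 0 ((j * d + (i : ℕ) : ℕ) : ℤ) = xs[j] i)
    (hxB : ∀ i, |σ.arr 0 i| < 2 ^ B) (hz : ∀ a, a ≠ 0 → ∀ i, σ.arr a i = 0) :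
    Sim (Memory.Bdd w) samplerProg σ (max 1 ℓ * M * (2000 * (d + 1)))
      (iter (fun _ => stage cosetCode vecAvg (k / 512)) ℓ xs)
      fun ys σ' => σ'.reg 4 = ys.length ∧ ∀ j (h : j < ys.length), VecAt σ' j ys[j] := by
  intro hW
  revert hW
  have hwz : (1024 : ℤ) ≤ 2 ^ w := by exact_mod_cast hw
  have hM := hB.hM
  have hMd : M * d + d + M < 2 ^ w := by nlinarith
  have h32 := hB.h32
  have hNd := hB.hN
  have hNM : (N : ℤ) * (M + 1) < 2 ^ w := by exact_mod_cast hZ'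
  have hMd' : (M : ℤ) * d + d + M < 2 ^ w := by exact_mod_cast hMd
  have hMd0 : (0 : ℤ) ≤ M * d := by positivity
  have hNM0 : (0 : ℤ) ≤ N * (M + 1) := by positivity
  have hM1 : (M : ℤ) + 1 < 2 ^ w := by
    have : M + 1 < 2 ^ w := by nlinarith
    exact_mod_cast this
  refine Sim.mono (T := 15 + ((d * (5 + 1) + 1) + (7 + ((M * d * (7 + 1) + 1) +
    (ℓ * (M * (200 * (d + 1) + 1000) + 1) + 1) + 1) + 1) + 1) + 1) ?_ ?_
  swap
  · have i1 : M * (d + 1) ≤ max 1 ℓ * (M * (d + 1)) :=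
      Nat.le_mul_of_pos_left _ (by omega)
    have i2 : ℓ * (M * (d + 1)) ≤ max 1 ℓ * (M * (d + 1)) := Nat.mul_le_mul_right _ (by omega)
    have i3 : ℓ * M ≤ ℓ * (M * (d + 1)) := Nat.mul_le_mul_left _ (by nlinarith)
    have i4 : ℓ ≤ ℓ * M := Nat.le_mul_of_pos_right _ (by omega)
    have i5 : 32 * d ≤ M * d := Nat.mul_le_mul_right _ h32
    nlinarith
  refine Sim.seq_pure (R := fun σ' => (∀ q, q ≠ 20 → q ≠ 21 → q ≠ 31 → q ≠ 3 → q ≠ 5 → q ≠ 10 →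
    σ'.reg q = σ.reg q) ∧ σ'.arr = σ.arr ∧ σ'.reg 3 = (k / 512 : ℕ) ∧ σ'.reg 5 = 1 ∧
    σ'.reg 10 = d ∧ σ'.reg 20 = 1 ∧ σ'.reg 21 = 2) (Sim.det (by decide) (fun hb => ?_) ⟨?_, ?_, ?_⟩) ?_
  · have hk := hb.1 3
    rw [h3, abs_of_nonneg (by positivity)] at hk
    have hk2 : ((k : ℤ) / 512) ≤ k := Int.ediv_le_self _ (by positivity)
    have hk3 : 0 ≤ ((k : ℤ) / 512) := by positivity
    simp [Prog.block, Prog.exec, Prog.Ok, Memory.setReg, ArithOp.eval, h3, h1]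
    simp only [abs_lt]
    omega
  · intro q _ _ _ _ _ _
    rw [Prog.exec_reg _ _ _ (by simp [Prog.block, Prog.regs]; omega)]
  · ext a; rw [Prog.exec_arr _ _ _ (by simp [Prog.block, Prog.arrs])]
  · simp [Prog.block, Prog.exec, Memory.setReg, ArithOp.eval, h1, h3]
  rintro σ₁ _ ⟨f1, a1, r3, r5, r10, r20, r21⟩
  refine Sim.seq_pure (R := fun σ' => (∀ q, q ≠ 5 → q ≠ 10 → σ'.reg q = σ₁.reg q) ∧
    σ'.arr = σ.arr ∧ σ'.reg 5 = N) ((Sim.loop_pure (W := Memory.Bdd w) (x := 10) (T := 5) (N := d)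
    (fun j σ' => (∀ q, q ≠ 5 → q ≠ 10 → σ'.reg q = σ₁.reg q) ∧
      σ'.arr = σ.arr ∧ σ'.reg 5 = 2 ^ (d - j) ∧ σ'.reg 10 = j) (fun j _ h => h.2.2.2) ?_
      ⟨fun _ _ _ => rfl, a1, by simp [r5], r10⟩).post _ le_rfl fun _ _ τ _ h => ⟨h.1, h.2.1, ?_⟩) ?_
  · rintro j τ hj _ ⟨f2, a2, k5, k10⟩
    have k20 : τ.reg 20 = 1 := by rw [f2 20 (by omega) (by omega), r20]
    have hp : (2 : ℤ) ^ (d - j) = 2 ^ (d - (j + 1)) + 2 ^ (d - (j + 1)) := by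
      rw [show d - j = d - (j + 1) + 1 by omega]; ring
    have hp2 : (2 : ℤ) ^ (d - j) < 2 ^ w := by
      have : 2 ^ (d - j) < 2 ^ w := by
        refine lt_of_le_of_lt (Nat.pow_le_pow_right (by norm_num) (Nat.sub_le _ _)) ?_
        rw [← hNd]
        exact lt_of_le_of_lt (Nat.le_mul_of_pos_right _ (Nat.succ_pos M)) hZ'
      exact_mod_cast this
    have hp3 : (0 : ℤ) < 2 ^ (d - (j + 1)) := by positivity
    refine Sim.det (by decide) (fun _ => ?_) ⟨?_, ?_, ?_⟩
    · simp [Prog.block, Prog.exec, Prog.Ok, Memory.setReg, ArithOp.eval, k5, k10, k20]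
      simp only [abs_lt]
      omega
    · intro q _ _
      rw [Prog.exec_reg _ _ _ (by simp [Prog.block, Prog.regs]; omega), f2 q (by omega) (by omega)]
    · ext a; rw [Prog.exec_arr _ _ _ (by simp [Prog.block, Prog.arrs]), a2]
    · simp [Prog.block, Prog.exec, Memory.setReg, ArithOp.eval, k5, k10, k20, hp]
  · rw [h.2.2.1, hNd]; simp
  rintro σ₂ _ ⟨f2, a2, r5⟩
  have e4 : σ₂.reg 4 = M := by
    rw [f2 4 (by omega) (by omega), f1 4 (by omega) (by omega) (by omega) (by omega) (by omega)
      (by omega), h4]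
  have e1 : σ₂.reg 1 = d := by
    rw [f2 1 (by omega) (by omega), f1 1 (by omega) (by omega) (by omega) (by omega) (by omega)
      (by omega), h1]
  have e20 : σ₂.reg 20 = 1 := by rw [f2 20 (by omega) (by omega), r20]
  refine Sim.seq_pure (R := fun σ' => (∀ q, q ≠ 7 → q ≠ 10 → σ'.reg q = σ₂.reg q) ∧
    σ'.arr = σ.arr ∧ σ'.reg 7 = N * (M + 1) ∧ σ'.reg 10 = ((M * d : ℕ) : ℤ))
    (Sim.det (by decide) (fun hb => ?_) ⟨?_, ?_, ?_⟩) ?_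
  · simp [-abs_mul, Prog.block, Prog.exec, Prog.Ok, Memory.setReg, ArithOp.eval, e4, e1, e20, r5]
    simp only [abs_lt]
    omega
  · intro q _ _
    rw [Prog.exec_reg _ _ _ (by simp [Prog.block, Prog.regs]; omega)]
  · ext a; rw [Prog.exec_arr _ _ _ (by simp [Prog.block, Prog.arrs]), a2]
  · simp [Prog.block, Prog.exec, Memory.setReg, ArithOp.eval, e1, e4, e20, r5]
  rintro σ₃ _ ⟨f3, a3, r7, r10⟩
  refine Sim.seq_pure (R := fun σ' => (∀ q, q ≠ 31 → q ≠ 10 → σ'.reg q = σ₃.reg q) ∧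
    (∀ a, a ≠ 1 → σ'.arr a = σ.arr a) ∧ (∀ i : ℤ, 0 ≤ i → i < (M * d : ℕ) →
      σ'.arr 1 i = σ.arr 0 i) ∧ ∀ i, |σ'.arr 1 i| < 2 ^ B) ((Sim.loop_pure (W := Memory.Bdd w)
    (x := 10) (T := 7) (N := M * d)
    (fun j σ' => (∀ q, q ≠ 31 → q ≠ 10 → σ'.reg q = σ₃.reg q) ∧
    (∀ a, a ≠ 1 → σ'.arr a = σ.arr a) ∧ (∀ i : ℤ, (j : ℤ) ≤ i → i < (M * d : ℕ) →
      σ'.arr 1 i = σ.arr 0 i) ∧ (∀ i, |σ'.arr 1 i| < 2 ^ B) ∧ σ'.reg 10 = j)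
      (fun j _ h => h.2.2.2.2) ?_
      ⟨fun _ _ _ => rfl, fun a _ => by rw [a3], fun i _ _ => by omega,
        fun i => by rw [a3, hz 1 (by omega)]; simp, r10⟩).post _ le_rfl
        fun _ _ τ _ h => ⟨h.1, h.2.1, fun i hi => h.2.2.1 i (by exact_mod_cast hi), h.2.2.2.1⟩) ?_
  · rintro j τ hj _ ⟨f4, a4, b4, c4, k10⟩
    have k20 : τ.reg 20 = 1 := by
      rw [f4 20 (by omega) (by omega), f3 20 (by omega) (by omega), e20]
    have hj' : (j : ℤ) < M * d := by exact_mod_cast hj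
    have s1 : ((Prog.block [.arith .sub 10 10 20, .load 31 0 10, .store 1 10 31]).exec τ).arr 1 =
        Function.update (τ.arr 1) j (τ.arr 0 j) := by
      simp [Prog.block, Prog.exec, Memory.setReg, Memory.setArr, ArithOp.eval, k10, k20]
    refine Sim.det (by decide) (fun _ => ?_) ⟨?_, ?_, ?_, ?_, ?_⟩
    · simp [Prog.block, Prog.exec, Prog.Ok, Memory.setReg, ArithOp.eval, k10, k20]
      omega
    · intro q _ _
      rw [Prog.exec_reg _ _ _ (by simp [Prog.block, Prog.regs]; omega), f4 q (by omega) (by omega)]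
    · intro a ha
      rw [Prog.exec_arr _ _ _ (by simp [Prog.block, Prog.arrs]; omega), a4 a ha]
    · intro i hi hi'
      rw [s1]
      by_cases h : i = j
      · subst h; rw [Function.update_self, a4 0 (by omega)]
      · rw [Function.update_of_ne h, b4 i (by omega) hi']
    · intro i
      rw [s1]
      by_cases h : i = j
      · subst h; rw [Function.update_self, a4 0 (by omega)]; exact hxB _
      · rw [Function.update_of_ne h]; exact c4 i
    · simp [Prog.block, Prog.exec, Memory.setReg, Memory.setArr, ArithOp.eval, k10, k20]
  rintro σ₄ _ ⟨f4, a4, b4, c4⟩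
  have hg : ∀ q, q ≠ 31 → q ≠ 10 → q ≠ 7 → q ≠ 5 → q ≠ 20 → q ≠ 21 → q ≠ 3 →
      σ₄.reg q = σ.reg q := fun q _ _ _ _ _ _ _ => by
    rw [f4 q (by omega) (by omega), f3 q (by omega) (by omega), f2 q (by omega) (by omega),
      f1 q (by omega) (by omega) (by omega) (by omega) (by omega) (by omega)]
  refine (Sim.loop (W := Memory.Bdd w) (x := 2) (T := M * (200 * (d + 1) + 1000))
    (fun _ => stage cosetCode vecAvg (k / 512))
    (fun r xs σ' => ∃ base, StageInv B M N (k / 512) Z r xs base σ')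
    (fun r _ _ ⟨_, h⟩ => h.h2) ℓ ?_ ℓ xs σ₄ le_rfl ⟨0, ⟨?_, ?_, ?_, ?_, ?_, ?_⟩, ?_, ?_, ?_, ?_,
      hlen.le, ⟨?_, c4⟩, ?_⟩).post _ le_rfl ?_
  · rintro r ys τ hr _ ⟨base, hI⟩
    exact (stageProg_sim hB ys hI).post _ le_rfl fun _ _ τ' _ h => ⟨_, h⟩
  · rw [hg 1 (by omega) (by omega) (by omega) (by omega) (by omega) (by omega) (by omega), h1]
  · rw [f4 3 (by omega) (by omega), f3 3 (by omega) (by omega), f2 3 (by omega) (by omega), r3]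
  · rw [f4 5 (by omega) (by omega), f3 5 (by omega) (by omega), r5]
  · rw [hg 6 (by omega) (by omega) (by omega) (by omega) (by omega) (by omega) (by omega), h6]; rfl
  · rw [f4 20 (by omega) (by omega), f3 20 (by omega) (by omega), e20]
  · rw [f4 21 (by omega) (by omega), f3 21 (by omega) (by omega), f2 21 (by omega) (by omega), r21]
  · omega
  · rw [hg 2 (by omega) (by omega) (by omega) (by omega) (by omega) (by omega) (by omega), h2]
  · rw [hg 4 (by omega) (by omega) (by omega) (by omega) (by omega) (by omega) (by omega), h4, hlen]
  · rw [f4 7 (by omega) (by omega), r7]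
  · intro j hj i
    rw [b4 _ (by positivity), ← hx j hj i]
    · push_cast; rfl
    · have hj' : j + 1 ≤ M := by omega
      have : j * d + d ≤ M * d := by nlinarith
      have := i.2
      push_cast
      have : j * d + i < M * d := by omega
      exact_mod_cast this
  · intro i hi
    rw [a4 2 (by omega), a4 3 (by omega), a4 5 (by omega)]
    exact ⟨hz 2 (by omega) i, hz 3 (by omega) i, hz 5 (by omega) i⟩
  · rintro ys _ τ _ ⟨base, hI⟩
    exact ⟨hI.h4, hI.stored.vec⟩

open scoped ENNReal NNReal

/-! ### Expectations and statistical closeness -/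

/-- The integral of `F` against the weights `μ`. -/
noncomputable def wsum {β : Type} (μ : β → ℝ≥0∞) (F : β → ℝ≥0∞) : ℝ≥0∞ := ∑' b, μ b * F b

section wsum

variable {β γ : Type}

theorem wsum_bind (p : PMF β) (f : β → PMF γ) (F : γ → ℝ≥0∞) :
    wsum (p.bind f) F = wsum p fun a => wsum (f a) F := by
  simp only [wsum, PMF.bind_apply]
  simp_rw [← ENNReal.tsum_mul_right, ← ENNReal.tsum_mul_left]
  rw [ENNReal.tsum_comm]
  simp_rw [mul_assoc]

theorem wsum_pure (b : β) (F : β → ℝ≥0∞) : wsum (PMF.pure b) F = F b := by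
  rw [wsum, tsum_eq_single b]
  · simp
  · intro b' hb; simp [PMF.pure_apply, hb]

theorem wsum_map (p : PMF β) (g : β → γ) (F : γ → ℝ≥0∞) :
    wsum (p.map g) F = wsum p fun a => F (g a) := by
  rw [← PMF.bind_pure_comp, wsum_bind]
  simp [wsum_pure]

theorem wsum_mono {μ : β → ℝ≥0∞} {F G : β → ℝ≥0∞} (h : ∀ b, F b ≤ G b) : wsum μ F ≤ wsum μ G :=
  ENNReal.tsum_le_tsum fun b => mul_le_mul_right (h b) _

theorem wsum_mono_support {p : PMF β} {F G : β → ℝ≥0∞} (h : ∀ b ∈ p.support, F b ≤ G b) :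
    wsum p F ≤ wsum p G := by
  refine ENNReal.tsum_le_tsum fun b => ?_
  by_cases hb : p b = 0
  · simp [hb]
  · exact mul_le_mul_right (h b ((PMF.mem_support_iff _ _).2 hb)) _

theorem wsum_congr {μ : β → ℝ≥0∞} {F G : β → ℝ≥0∞} (h : ∀ b, F b = G b) : wsum μ F = wsum μ G := by
  rw [funext h]

theorem wsum_add (μ : β → ℝ≥0∞) (F G : β → ℝ≥0∞) :
    wsum μ (fun b => F b + G b) = wsum μ F + wsum μ G := by
  simp only [wsum, mul_add, ENNReal.tsum_add]

theorem wsum_mul_left (μ : β → ℝ≥0∞) (c : ℝ≥0∞) (F : β → ℝ≥0∞) :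
    wsum μ (fun b => c * F b) = c * wsum μ F := by
  simp only [wsum, ← ENNReal.tsum_mul_left]
  exact tsum_congr fun b => by ring

theorem wsum_mul_right (μ : β → ℝ≥0∞) (c : ℝ≥0∞) (F : β → ℝ≥0∞) :
    wsum μ (fun b => F b * c) = wsum μ F * c := by
  simp only [mul_comm _ c, wsum_mul_left]

theorem wsum_const (p : PMF β) (c : ℝ≥0∞) : wsum p (fun _ => c) = c := by
  rw [wsum, ENNReal.tsum_mul_right, p.tsum_coe, one_mul]

theorem wsum_one (μ : β → ℝ≥0∞) : wsum μ (fun _ => 1) = ∑' b, μ b := by simp [wsum]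

theorem wsum_le_one (p : PMF β) {F : β → ℝ≥0∞} (h : ∀ b, F b ≤ 1) : wsum p F ≤ 1 :=
  (wsum_mono h).trans_eq (wsum_const p 1)

theorem wsum_tsum {ι : Type} (μ : β → ℝ≥0∞) (F : ι → β → ℝ≥0∞) :
    wsum μ (fun b => ∑' i, F i b) = ∑' i, wsum μ (F i) := by
  simp only [wsum, ← ENNReal.tsum_mul_left]
  exact ENNReal.tsum_comm

theorem wsum_sum {ι : Type} (s : Finset ι) (μ : β → ℝ≥0∞) (F : ι → β → ℝ≥0∞) :
    wsum μ (fun b => ∑ i ∈ s, F i b) = ∑ i ∈ s, wsum μ (F i) := by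
  simp only [wsum, Finset.mul_sum]
  exact Summable.tsum_finsetSum fun _ _ => ENNReal.summable

theorem wsum_comm (μ : β → ℝ≥0∞) (ν : γ → ℝ≥0∞) (F : β → γ → ℝ≥0∞) :
    wsum μ (fun b => wsum ν (F b)) = wsum ν fun c => wsum μ fun b => F b c := by
  simp only [wsum, ← ENNReal.tsum_mul_left]
  rw [ENNReal.tsum_comm]
  exact tsum_congr fun b => tsum_congr fun c => by ring

/-- One-sided form of: the statistical distance of `p` and `q` is at most `ε`. -/
def Close (p q : PMF β) (ε : ℝ≥0∞) : Prop :=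
  ∀ F : β → ℝ≥0∞, (∀ b, F b ≤ 1) → wsum p F ≤ wsum q F + ε

theorem Close.refl (p : PMF β) : Close p p 0 := fun _ _ => by simp

theorem Close.mono {p q : PMF β} {ε ε' : ℝ≥0∞} (h : Close p q ε) (hε : ε ≤ ε') : Close p q ε' :=
  fun F hF => (h F hF).trans (add_le_add_right hε _)

theorem Close.trans {p q r : PMF β} {ε ε' : ℝ≥0∞} (h : Close p q ε) (h' : Close q r ε') :
    Close p r (ε' + ε) := fun F hF =>
  (h F hF).trans ((add_le_add_left (h' F hF) _).trans_eq (add_assoc _ _ _))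

theorem Close.bind_left {p q : PMF β} {ε : ℝ≥0∞} (h : Close p q ε) (f : β → PMF γ) :
    Close (p.bind f) (q.bind f) ε := fun F hF => by
  rw [wsum_bind, wsum_bind]
  exact h _ fun b => wsum_le_one _ hF

theorem Close.bind_right (p : PMF β) {f g : β → PMF γ} {ε : ℝ≥0∞}
    (h : ∀ b ∈ p.support, Close (f b) (g b) ε) : Close (p.bind f) (p.bind g) ε := fun F hF => by
  rw [wsum_bind, wsum_bind, ← wsum_const p ε, ← wsum_add]
  exact wsum_mono_support fun b hb => h b hb F hF

theorem PMF.toReal_summable (p : PMF β) : Summable fun b => (p b).toReal :=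
  ENNReal.summable_toReal (by rw [p.tsum_coe]; exact ENNReal.one_ne_top)

theorem PMF.tsum_toReal (p : PMF β) : ∑' b, (p b).toReal = 1 := by
  rw [← ENNReal.tsum_toReal_eq fun b => p.apply_ne_top b, p.tsum_coe, ENNReal.toReal_one]

theorem statDist_le_one (p q : PMF β) : statDist p q ≤ 1 := by
  have h : ∑' x, |(p x).toReal - (q x).toReal| ≤ ∑' x, ((p x).toReal + (q x).toReal) := by
    refine Summable.tsum_le_tsum (fun x => ?_) ?_ (p.toReal_summable.add q.toReal_summable)
    · refine (abs_sub _ _).trans ?_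
      rw [abs_of_nonneg ENNReal.toReal_nonneg, abs_of_nonneg ENNReal.toReal_nonneg]
    · exact (p.toReal_summable.sub q.toReal_summable).abs
  rw [p.toReal_summable.tsum_add q.toReal_summable, p.tsum_toReal, q.tsum_toReal] at h
  rw [statDist]; linarith

/-- The test function is the indicator of `q < p`. As both laws have total mass one, half the `ℓ¹`
distance is the sum of the positive parts of `p - q`, which is what this test function measures. -/
theorem Close.statDist_le {p q : PMF β} {ε : ℝ} (hε : 0 ≤ ε) (h : Close p q (ENNReal.ofReal ε)) :
    statDist p q ≤ ε := by
  classical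
  have hs := p.toReal_summable.sub q.toReal_summable
  have h0 : ∑' x, ((p x).toReal - (q x).toReal) = 0 := by
    rw [p.toReal_summable.tsum_sub q.toReal_summable, p.tsum_toReal, q.tsum_toReal, sub_self]
  have h1 : ∑' x, |(p x).toReal - (q x).toReal| =
      2 * ∑' x, max ((p x).toReal - (q x).toReal) 0 := by
    have e : ∀ x, |(p x).toReal - (q x).toReal| =
        2 * max ((p x).toReal - (q x).toReal) 0 - ((p x).toReal - (q x).toReal) := fun x => by
      rcases le_total ((p x).toReal - (q x).toReal) 0 with h | h
      · rw [max_eq_right h, abs_of_nonpos h]; ring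
      · rw [max_eq_left h, abs_of_nonneg h]; ring
    have hm : Summable fun x => max ((p x).toReal - (q x).toReal) 0 :=
      Summable.of_nonneg_of_le (fun x => le_max_right _ _)
        (fun x => max_le (le_abs_self _) (abs_nonneg _)) hs.abs
    simp_rw [e]
    rw [Summable.tsum_sub (hm.mul_left 2) hs, h0, tsum_mul_left, sub_zero]
  let F : β → ℝ≥0∞ := fun x => if q x < p x then 1 else 0
  have hF : ∀ x, F x ≤ 1 := fun x => by simp only [F]; split_ifs <;> simp
  have h2 := h F hF
  have hp : wsum p F ≠ ⊤ := ((wsum_le_one p hF).trans_lt ENNReal.one_lt_top).ne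
  have hq : wsum q F ≠ ⊤ := ((wsum_le_one q hF).trans_lt ENNReal.one_lt_top).ne
  have h3 := ENNReal.toReal_mono (by finiteness) h2
  rw [ENNReal.toReal_add hq (by finiteness), ENNReal.toReal_ofReal hε] at h3
  have e1 : ∀ r : PMF β, (wsum r F).toReal = ∑' x, (r x).toReal * (F x).toReal := fun r => by
    rw [wsum, ENNReal.tsum_toReal_eq]
    · simp_rw [ENNReal.toReal_mul]
    · intro x
      exact ENNReal.mul_ne_top (r.apply_ne_top x) ((hF x).trans_lt ENNReal.one_lt_top).ne
  have hsF : ∀ r : PMF β, Summable fun x => (r x).toReal * (F x).toReal := fun r =>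
    Summable.of_nonneg_of_le (fun x => by positivity) (fun x => by
      have : (F x).toReal ≤ 1 := ENNReal.toReal_le_of_le_ofReal zero_le_one (by simpa using hF x)
      exact mul_le_of_le_one_right ENNReal.toReal_nonneg this) r.toReal_summable
  rw [e1, e1] at h3
  have h4 : ∑' x, max ((p x).toReal - (q x).toReal) 0 =
      ∑' x, (p x).toReal * (F x).toReal - ∑' x, (q x).toReal * (F x).toReal := by
    rw [← Summable.tsum_sub (hsF p) (hsF q)]
    refine tsum_congr fun x => ?_
    have : q x < p x ↔ (q x).toReal < (p x).toReal :=
      (ENNReal.toReal_lt_toReal (q.apply_ne_top x) (p.apply_ne_top x)).symm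
    simp only [F, this]
    split_ifs with h
    · rw [max_eq_left (by linarith)]; simp
    · rw [max_eq_right (by linarith)]; simp
  rw [statDist, h1, h4]
  linarith

end wsum

/-! ### Lists of independent samples -/

/-- The integral of `F` against the `n`-fold product of the weights `μ`. -/
noncomputable def psum {β : Type} (μ : β → ℝ≥0∞) : ℕ → (List β → ℝ≥0∞) → ℝ≥0∞
  | 0, F => F []
  | n + 1, F => wsum μ fun a => psum μ n fun l => F (a :: l)

/-- The law of a list of `n` independent samples. -/
noncomputable def iidList {β : Type} (p : PMF β) : ℕ → PMF (List β)
  | 0 => PMF.pure []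
  | n + 1 => p.bind fun a => (iidList p n).map (a :: ·)

section psum

variable {β γ : Type}

theorem wsum_iidList (p : PMF β) (n : ℕ) (F : List β → ℝ≥0∞) :
    wsum (iidList p n) F = psum p n F := by
  induction n generalizing F with
  | zero => rw [iidList, wsum_pure, psum]
  | succ n ih =>
    rw [iidList, wsum_bind, psum]
    refine wsum_congr fun a => ?_
    rw [wsum_map, ih]

theorem psum_mono {μ : β → ℝ≥0∞} {n : ℕ} {F G : List β → ℝ≥0∞}
    (h : ∀ l, l.length = n → F l ≤ G l) : psum μ n F ≤ psum μ n G := by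
  induction n generalizing F G with
  | zero => exact h _ rfl
  | succ n ih => exact wsum_mono fun a => ih fun l hl => h _ (by simp [hl])

theorem psum_congr {μ : β → ℝ≥0∞} {n : ℕ} {F G : List β → ℝ≥0∞}
    (h : ∀ l, l.length = n → F l = G l) : psum μ n F = psum μ n G :=
  le_antisymm (psum_mono fun l hl => (h l hl).le) (psum_mono fun l hl => (h l hl).ge)

theorem psum_append (μ : β → ℝ≥0∞) (m n : ℕ) (F : List β → ℝ≥0∞) :
    psum μ (m + n) F = psum μ m fun l => psum μ n fun l' => F (l ++ l') := by
  induction m generalizing F with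
  | zero => simp [psum]
  | succ m ih =>
    rw [show m + 1 + n = m + n + 1 by ring, psum, psum]
    exact wsum_congr fun a => by rw [ih]; rfl

theorem psum_concat (μ : β → ℝ≥0∞) (n : ℕ) (F : List β → ℝ≥0∞) :
    psum μ (n + 1) F = wsum μ fun a => psum μ n fun l => F (l ++ [a]) := by
  induction n generalizing F with
  | zero => rfl
  | succ n ih =>
    exact (wsum_congr fun a => ih _).trans (wsum_comm _ _ _)

theorem psum_wsum (μ : β → ℝ≥0∞) (ν : γ → ℝ≥0∞) (n : ℕ) (F : List β → γ → ℝ≥0∞) :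
    psum μ n (fun l => wsum ν (F l)) = wsum ν fun c => psum μ n fun l => F l c := by
  induction n generalizing F with
  | zero => rfl
  | succ n ih =>
    simp only [psum]
    rw [wsum_comm]
    exact wsum_congr fun a => ih _

theorem psum_mul_left (μ : β → ℝ≥0∞) (n : ℕ) (c : ℝ≥0∞) (F : List β → ℝ≥0∞) :
    psum μ n (fun l => c * F l) = c * psum μ n F := by
  induction n generalizing F with
  | zero => rfl
  | succ n ih =>
    rw [psum, psum, ← wsum_mul_left]
    exact wsum_congr fun a => ih _

theorem psum_add (μ : β → ℝ≥0∞) (n : ℕ) (F G : List β → ℝ≥0∞) :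
    psum μ n (fun l => F l + G l) = psum μ n F + psum μ n G := by
  induction n generalizing F G with
  | zero => rfl
  | succ n ih =>
    simp only [psum]
    rw [← wsum_add]
    exact wsum_congr fun a => ih _ _

theorem psum_const (μ : β → ℝ≥0∞) (n : ℕ) (c : ℝ≥0∞) :
    psum μ n (fun _ => c) = (∑' b, μ b) ^ n * c := by
  induction n with
  | zero => simp [psum]
  | succ n ih =>
    rw [psum]
    simp_rw [ih]
    rw [wsum, ENNReal.tsum_mul_right, pow_succ']
    ring

theorem psum_const' (p : PMF β) (n : ℕ) (c : ℝ≥0∞) : psum p n (fun _ => c) = c := by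
  rw [psum_const, p.tsum_coe, one_pow, one_mul]

theorem psum_tsum {ι : Type} (μ : β → ℝ≥0∞) (n : ℕ) (F : ι → List β → ℝ≥0∞) :
    psum μ n (fun l => ∑' i, F i l) = ∑' i, psum μ n (F i) := by
  induction n generalizing F with
  | zero => rfl
  | succ n ih =>
    simp only [psum]
    rw [← wsum_tsum]
    exact wsum_congr fun a => ih _

theorem psum_smul (μ : β → ℝ≥0∞) (c : ℝ≥0∞) (n : ℕ) (F : List β → ℝ≥0∞) :
    psum (fun b => c * μ b) n F = c ^ n * psum μ n F := by
  induction n generalizing F with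
  | zero => simp [psum]
  | succ n ih =>
    simp only [psum]
    simp_rw [ih]
    rw [wsum_mul_left, pow_succ', wsum, wsum, mul_comm c, mul_assoc]
    simp_rw [mul_assoc c]
    rw [ENNReal.tsum_mul_left]

/-- Product weights are multiplicative. -/
theorem psum_prod (μ : β → ℝ≥0∞) (f : β → ℝ≥0∞) (n : ℕ) :
    psum μ n (fun l => (l.map f).prod) = wsum μ f ^ n := by
  induction n with
  | zero => simp [psum]
  | succ n ih =>
    rw [psum]
    simp only [List.map_cons, List.prod_cons]
    simp_rw [psum_mul_left, ih]
    rw [wsum_mul_right, pow_succ']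

theorem iter_congr {S : Type} {f g : ℕ → S → PMF S} {n : ℕ} (h : ∀ j < n, f j = g j) (s : S) :
    iter f n s = iter g n s := by
  induction n generalizing s with
  | zero => rfl
  | succ n ih =>
    rw [iter, iter, h n n.lt_succ_self]
    exact congrArg _ (funext fun s' => ih (fun j hj => h j (hj.trans n.lt_succ_self)) s')

/-- A loop that consumes a segment of a list of independent samples is a loop that draws fresh
samples. -/
theorem psum_iter {S : Type} (p : PMF β) (g : β → S → PMF S) (def₀ : β) (n m : ℕ) (hn : n ≤ m)
    (s : S) (G : S → ℝ≥0∞) :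
    psum p m (fun l => wsum (iter (fun j s => g (l.getD j def₀) s) n s) G) =
      wsum (iter (fun _ s => p.bind fun x => g x s) n s) G := by
  obtain ⟨r, rfl⟩ := Nat.exists_eq_add_of_le hn
  rw [psum_append]
  have h1 : psum p n (fun l => psum p r fun l' =>
      wsum (iter (fun j s => g ((l ++ l').getD j def₀) s) n s) G) =
      psum p n (fun l => wsum (iter (fun j s => g (l.getD j def₀) s) n s) G) := by
    refine psum_congr fun l hl => ?_
    rw [← psum_const' p r (wsum (iter (fun j s => g (l.getD j def₀) s) n s) G)]
    refine psum_congr fun l' _ => ?_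
    rw [iter_congr fun j hj => ?_]
    funext s
    rw [List.getD_append _ _ _ _ (by omega)]
  rw [h1]
  clear h1 hn
  induction n generalizing s with
  | zero => exact psum_const' p 0 _
  | succ n ih =>
    -- The round counter runs downwards and serves as the index, so the first round reads the last
    -- sample; hence that sample is split off at the end of the list.
    rw [psum_concat, iter, wsum_bind, wsum_bind]
    refine wsum_congr fun a => ?_
    simp_rw [← ih]
    rw [← psum_wsum]
    refine psum_congr fun l hl => ?_
    rw [iter, wsum_bind, List.getD_append_right _ _ _ _ (by omega)]
    simp only [hl, Nat.sub_self, List.getD_cons_zero]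
    refine wsum_congr fun s' => ?_
    rw [iter_congr fun j hj => ?_]
    funext s
    rw [List.getD_append _ _ _ _ (by omega)]

end psum

/-! ### Poisson processes -/

/-- The exponential series in `ℝ≥0∞`. -/
noncomputable def eexp (v : ℝ≥0∞) : ℝ≥0∞ := ∑' n : ℕ, (n.factorial : ℝ≥0∞)⁻¹ * v ^ n

/-- The unnormalized integral of `F` against the Poisson process with intensity `μ`. -/
noncomputable def poissonSum {β : Type} (μ : β → ℝ≥0∞) (F : List β → ℝ≥0∞) : ℝ≥0∞ :=
  ∑' n : ℕ, (n.factorial : ℝ≥0∞)⁻¹ * psum μ n F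

/-- The expectation of `F` of a Poisson process with intensity `μ`, as a randomly ordered list. -/
noncomputable def poissonMean {β : Type} (μ : β → ℝ≥0∞) (F : List β → ℝ≥0∞) : ℝ≥0∞ :=
  (eexp (∑' b, μ b))⁻¹ * poissonSum μ F

/-- The restriction of the weights `μ` to the elements that satisfy `p`. -/
def restrict {β : Type} (p : β → Bool) (μ : β → ℝ≥0∞) (b : β) : ℝ≥0∞ := if p b then μ b else 0

theorem eexp_ne_zero (v : ℝ≥0∞) : eexp v ≠ 0 := by
  intro h
  have := ENNReal.tsum_eq_zero.1 h 0
  simp at this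

theorem eexp_eq_ofReal {v : ℝ} (hv : 0 ≤ v) :
    eexp (ENNReal.ofReal v) = ENNReal.ofReal (Real.exp v) := by
  rw [eexp, Real.exp_eq_exp_ℝ, NormedSpace.exp_eq_tsum_div, ENNReal.ofReal_tsum_of_nonneg]
  · refine tsum_congr fun n => ?_
    rw [ENNReal.ofReal_div_of_pos (by positivity), ENNReal.ofReal_pow hv, ENNReal.ofReal_natCast,
      ENNReal.div_eq_inv_mul]
  · intro n; positivity
  · exact NormedSpace.expSeries_div_summable v

theorem eexp_mono {v w : ℝ≥0∞} (h : v ≤ w) : eexp v ≤ eexp w :=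
  ENNReal.tsum_le_tsum fun n => mul_le_mul_right (pow_le_pow_left' h n) _

theorem eexp_ne_top {v : ℝ≥0∞} (hv : v ≠ ⊤) : eexp v ≠ ⊤ := by
  rw [← ENNReal.ofReal_toReal hv, eexp_eq_ofReal ENNReal.toReal_nonneg]
  exact ENNReal.ofReal_ne_top

theorem eexp_add (v w : ℝ≥0∞) : eexp (v + w) = eexp v * eexp w := by
  by_cases hv : v = ⊤
  · have h : eexp ⊤ = ⊤ := by
      refine top_le_iff.1 (le_trans ?_ (ENNReal.le_tsum 1))
      simp
    subst hv
    rw [top_add, h, ENNReal.top_mul (eexp_ne_zero w)]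
  by_cases hw : w = ⊤
  · have h : eexp ⊤ = ⊤ := by
      refine top_le_iff.1 (le_trans ?_ (ENNReal.le_tsum 1))
      simp
    subst hw
    rw [add_top, h, ENNReal.mul_top (eexp_ne_zero v)]
  rw [← ENNReal.ofReal_toReal hv, ← ENNReal.ofReal_toReal hw,
    ← ENNReal.ofReal_add ENNReal.toReal_nonneg ENNReal.toReal_nonneg, eexp_eq_ofReal (by positivity),
    eexp_eq_ofReal (by positivity), eexp_eq_ofReal (by positivity), Real.exp_add,
    ENNReal.ofReal_mul (by positivity)]

theorem factorial_inv_choose (i j : ℕ) :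
    ((i + j).factorial : ℝ≥0∞)⁻¹ * ((i + j).choose i : ℝ≥0∞) =
      (i.factorial : ℝ≥0∞)⁻¹ * (j.factorial : ℝ≥0∞)⁻¹ := by
  have h := Nat.add_choose_mul_factorial_mul_factorial i j
  have h' : ((i + j).choose i : ℝ≥0∞) * i.factorial * j.factorial = (i + j).factorial := by
    rw [Nat.choose_symm_add] at *
    exact_mod_cast h
  have hi : (i.factorial : ℝ≥0∞) ≠ 0 := by exact_mod_cast i.factorial_ne_zero
  have hj : (j.factorial : ℝ≥0∞) ≠ 0 := by exact_mod_cast j.factorial_ne_zero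
  have hc : ((i + j).choose i : ℝ≥0∞) ≠ 0 := by
    exact_mod_cast (Nat.choose_pos (Nat.le_add_right i j)).ne'
  rw [← h', ENNReal.mul_inv (by right; simp) (by right; exact hj),
    ENNReal.mul_inv (by right; simp) (by right; exact hi)]
  calc _ = ((i + j).choose i : ℝ≥0∞) * ((i + j).choose i : ℝ≥0∞)⁻¹ *
        ((i.factorial : ℝ≥0∞)⁻¹ * (j.factorial : ℝ≥0∞)⁻¹) := by ring
    _ = _ := by rw [ENNReal.mul_inv_cancel hc (by simp), one_mul]

theorem tsum_sum_antidiagonal (f : ℕ → ℕ → ℝ≥0∞) :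
    ∑' n, ∑ ij ∈ Finset.HasAntidiagonal.antidiagonal n, f ij.1 ij.2 = ∑' i, ∑' j, f i j := by
  rw [← ENNReal.tsum_prod, ← Finset.HasAntidiagonal.sigmaAntidiagonalEquivProd.tsum_eq fun ij : ℕ × ℕ => f ij.1 ij.2,
    ENNReal.tsum_sigma']
  refine tsum_congr fun n => ?_
  rw [tsum_fintype, ← Finset.sum_coe_sort]
  rfl

/-- Product rule for exponential generating functions: dividing by `n!` turns a binomial convolution
into a product of two series. This is the mechanism behind the independence properties of Poisson
processes. -/
theorem tsum_choose (f : ℕ → ℕ → ℝ≥0∞) :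
    ∑' n : ℕ, (n.factorial : ℝ≥0∞)⁻¹ *
        ∑ ij ∈ Finset.HasAntidiagonal.antidiagonal n, (n.choose ij.1 : ℝ≥0∞) * f ij.1 ij.2 =
      ∑' i : ℕ, ∑' j : ℕ, (i.factorial : ℝ≥0∞)⁻¹ * ((j.factorial : ℝ≥0∞)⁻¹ * f i j) := by
  rw [← tsum_sum_antidiagonal]
  refine tsum_congr fun n => ?_
  rw [Finset.mul_sum]
  refine Finset.sum_congr rfl fun ij hij => ?_
  rw [Finset.HasAntidiagonal.mem_antidiagonal] at hij
  rw [← hij, ← mul_assoc, factorial_inv_choose, mul_assoc]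

section poisson

variable {β γ : Type}

theorem wsum_restrict (p : β → Bool) (μ : β → ℝ≥0∞) (F : β → ℝ≥0∞) :
    wsum (restrict p μ) F = wsum μ fun b => if p b then F b else 0 :=
  tsum_congr fun b => by by_cases h : p b <;> simp [restrict, h]

theorem restrict_restrict (p r : β → Bool) (μ : β → ℝ≥0∞) :
    restrict p (restrict r μ) = restrict (fun b => p b && r b) μ := by
  funext b; by_cases h : p b <;> by_cases h' : r b <;> simp [restrict, h, h']

theorem tsum_restrict_le (p : β → Bool) (μ : β → ℝ≥0∞) : ∑' b, restrict p μ b ≤ ∑' b, μ b :=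
  ENNReal.tsum_le_tsum fun b => by unfold restrict; split_ifs <;> simp

theorem wsum_split (p : β → Bool) (μ : β → ℝ≥0∞) (F : β → ℝ≥0∞) :
    wsum μ F = wsum (restrict p μ) F + wsum (restrict (fun b => !p b) μ) F := by
  rw [wsum_restrict, wsum_restrict, ← wsum_add]
  exact wsum_congr fun b => by cases p b <;> simp

/-- Induction on the list: its head either satisfies `p` or does not, and the two cases add up by
Pascal's rule. The binomial coefficient counts the positions of the elements satisfying `p`, which
the two filtered lists forget. -/
theorem psum_split (p : β → Bool) (μ : β → ℝ≥0∞) (n : ℕ) (F : List β → List β → ℝ≥0∞) :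
    psum μ n (fun l => F (l.filter p) (l.filter fun b => !p b)) =
      ∑ ij ∈ Finset.HasAntidiagonal.antidiagonal n, (n.choose ij.1 : ℝ≥0∞) *
        psum (restrict p μ) ij.1 fun a => psum (restrict (fun b => !p b) μ) ij.2 (F a) := by
  induction n generalizing F with
  | zero => simp [psum]
  | succ n ih =>
    rw [psum, wsum_split p, wsum_restrict, wsum_restrict,
      Finset.sum_antidiagonal_choose_succ_mul (fun i j => psum (restrict p μ) i fun a =>
        psum (restrict (fun b => !p b) μ) j (F a)), add_comm]
    congr 1
    · simp only [psum]
      simp_rw [psum_wsum, wsum_restrict]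
      simp_rw [← wsum_mul_left]
      rw [← wsum_sum]
      refine wsum_congr fun b => ?_
      cases h : p b
      · simp only [List.filter_cons, h]
        simpa using ih fun a c => F a (b :: c)
      · simp
    · simp only [psum]
      simp_rw [← wsum_mul_left]
      rw [← wsum_sum, wsum_restrict]
      refine wsum_congr fun b => ?_
      cases h : p b
      · simp
      · simp only [List.filter_cons, h]
        have := ih fun a c => F (b :: a) c
        simp only [if_true, Bool.not_true, Bool.false_eq_true, if_false] at this ⊢
        rw [this]
        refine Finset.sum_congr rfl fun ij hij => ?_
        rw [Finset.HasAntidiagonal.mem_antidiagonal] at hij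
        rw [← hij, Nat.choose_symm_add]

theorem poissonSum_split (p : β → Bool) (μ : β → ℝ≥0∞) (F : List β → List β → ℝ≥0∞) :
    poissonSum μ (fun l => F (l.filter p) (l.filter fun b => !p b)) =
      poissonSum (restrict p μ) fun a => poissonSum (restrict (fun b => !p b) μ) (F a) := by
  unfold poissonSum
  simp_rw [psum_split p μ, psum_tsum, psum_mul_left, ← ENNReal.tsum_mul_left]
  rw [tsum_choose fun i j => psum (restrict p μ) i fun a =>
    psum (restrict (fun b => !p b) μ) j (F a)]

theorem poissonSum_const (μ : β → ℝ≥0∞) (c : ℝ≥0∞) :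
    poissonSum μ (fun _ => c) = eexp (∑' b, μ b) * c := by
  simp_rw [poissonSum, psum_const, eexp, ← mul_assoc]
  rw [ENNReal.tsum_mul_right]

/-- The two parts of a Poisson process, each in its inherited order, are independent Poisson
processes. Independence appears as a nested expectation, because the normalizing exponential factors
over the two parts. -/
theorem poissonMean_split (p : β → Bool) (μ : β → ℝ≥0∞) (F : List β → List β → ℝ≥0∞) :
    poissonMean μ (fun l => F (l.filter p) (l.filter fun b => !p b)) =
      poissonMean (restrict p μ) fun a => poissonMean (restrict (fun b => !p b) μ) (F a) := by
  have h : ∀ c G, poissonSum (restrict p μ) (fun l => c * G l) =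
      c * poissonSum (restrict p μ) G := fun c G => by
    simp_rw [poissonSum, psum_mul_left, ← ENNReal.tsum_mul_left]
    exact tsum_congr fun n => by ring
  have e := wsum_split p μ fun _ => 1
  simp only [wsum_one] at e
  rw [poissonMean, poissonSum_split, e, eexp_add,
    ENNReal.mul_inv (Or.inl (eexp_ne_zero _)) (Or.inr (eexp_ne_zero _))]
  simp_rw [poissonMean]
  rw [h, mul_assoc]

theorem poissonMean_const {μ : β → ℝ≥0∞} (hμ : ∑' b, μ b ≠ ⊤) (c : ℝ≥0∞) :
    poissonMean μ (fun _ => c) = c := by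
  rw [poissonMean, poissonSum_const, ← mul_assoc,
    ENNReal.inv_mul_cancel (eexp_ne_zero _) (eexp_ne_top hμ), one_mul]

theorem poissonMean_mono {μ : β → ℝ≥0∞} {F G : List β → ℝ≥0∞} (h : ∀ l, F l ≤ G l) :
    poissonMean μ F ≤ poissonMean μ G :=
  mul_le_mul_right (ENNReal.tsum_le_tsum fun _ => mul_le_mul_right (psum_mono fun l _ => h l) _) _

theorem poissonMean_add (μ : β → ℝ≥0∞) (F G : List β → ℝ≥0∞) :
    poissonMean μ (fun l => F l + G l) = poissonMean μ F + poissonMean μ G := by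
  simp_rw [poissonMean, poissonSum, psum_add, mul_add, ENNReal.tsum_add, mul_add]

theorem poissonMean_mul_left (μ : β → ℝ≥0∞) (c : ℝ≥0∞) (F : List β → ℝ≥0∞) :
    poissonMean μ (fun l => c * F l) = c * poissonMean μ F := by
  simp_rw [poissonMean, poissonSum, psum_mul_left, mul_left_comm _ c, ENNReal.tsum_mul_left]
  ring

theorem poissonMean_wsum (μ : β → ℝ≥0∞) (ν : γ → ℝ≥0∞) (F : List β → γ → ℝ≥0∞) :
    poissonMean μ (fun l => wsum ν (F l)) = wsum ν fun c => poissonMean μ fun l => F l c := by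
  simp_rw [poissonMean, poissonSum, psum_wsum, wsum_mul_left]
  rw [wsum_tsum]
  simp_rw [wsum_mul_left]

/-- A Poisson process is a Poisson number of independent samples. -/
theorem poissonMean_smul (D : PMF β) (Λ : ℝ≥0∞) (F : List β → ℝ≥0∞) :
    poissonMean (fun b => Λ * D b) F =
      ∑' n : ℕ, (eexp Λ)⁻¹ * ((n.factorial : ℝ≥0∞)⁻¹ * Λ ^ n) * psum D n F := by
  rw [poissonMean, ENNReal.tsum_mul_left, D.tsum_coe, mul_one, poissonSum, ← ENNReal.tsum_mul_left]
  exact tsum_congr fun n => by rw [psum_smul]; ring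

/-- For mean `v` the value is `e^{-v} e^{2v}`. It serves as the exponential moment in the estimate
for overfull cells. -/
theorem poissonMean_two_pow_length {μ : β → ℝ≥0∞} (hμ : ∑' b, μ b ≠ ⊤) :
    poissonMean μ (fun l => 2 ^ l.length) = eexp (∑' b, μ b) := by
  have h : poissonSum μ (fun l => 2 ^ l.length) = eexp (∑' b, μ b + ∑' b, μ b) := by
    refine tsum_congr fun n => ?_
    rw [psum_congr (G := fun _ => 2 ^ n) fun l hl => by rw [hl], psum_const, ← mul_pow, mul_two]
  rw [poissonMean, h, eexp_add, ← mul_assoc,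
    ENNReal.inv_mul_cancel (eexp_ne_zero _) (eexp_ne_top hμ), one_mul]

theorem psum_sum_map (μ : β → ℝ≥0∞) (f : β → ℝ≥0∞) (n : ℕ) :
    psum μ (n + 1) (fun l => (l.map f).sum) = (n + 1) * (∑' b, μ b) ^ n * wsum μ f := by
  induction n with
  | zero => simp [psum]
  | succ n ih =>
    rw [psum]
    have e : ∀ c, wsum μ (fun _ => c) = (∑' b, μ b) * c := fun c => ENNReal.tsum_mul_right
    simp only [List.map_cons, List.sum_cons, psum_add, psum_const, wsum_add, ih, wsum_mul_left, e]
    push_cast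
    ring

/-- Campbell's formula. -/
theorem poissonMean_sum_map {μ : β → ℝ≥0∞} (hμ : ∑' b, μ b ≠ ⊤) (f : β → ℝ≥0∞) :
    poissonMean μ (fun l => (l.map f).sum) = wsum μ f := by
  have h : poissonSum μ (fun l => (l.map f).sum) = eexp (∑' b, μ b) * wsum μ f := by
    rw [poissonSum, tsum_eq_zero_add' ENNReal.summable, eexp, ← ENNReal.tsum_mul_right]
    simp only [psum, List.map_nil, List.sum_nil, mul_zero, zero_add]
    refine tsum_congr fun n => ?_
    have e := psum_sum_map μ f n
    rw [psum] at e
    rw [e, Nat.factorial_succ]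
    push_cast
    rw [ENNReal.mul_inv (by simp) (by simp)]
    calc _ = ((n : ℝ≥0∞) + 1)⁻¹ * (n + 1) * ((n.factorial : ℝ≥0∞)⁻¹ * (∑' b, μ b) ^ n *
          wsum μ f) := by ring
      _ = _ := by rw [ENNReal.inv_mul_cancel (by simp) (by simp), one_mul]
  rw [poissonMean, h, ← mul_assoc, ENNReal.inv_mul_cancel (eexp_ne_zero _) (eexp_ne_top hμ),
    one_mul]

theorem sum_range_getElem?_le (f : Option β → ℝ≥0∞) (l : List β) (K : ℕ) :
    ∑ u ∈ Finset.range K, f l[u]? ≤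
      (l.map fun b => f (some b)).sum + ((K - l.length : ℕ) : ℝ≥0∞) * f none := by
  induction l generalizing K with
  | nil => simp
  | cons b l ih =>
    cases K with
    | zero => simp
    | succ K =>
      rw [Finset.sum_range_succ']
      have := ih K
      simp only [List.getElem?_cons_succ, List.getElem?_cons_zero, List.map_cons, List.sum_cons,
        List.length_cons, Nat.add_sub_add_right]
      calc _ ≤ _ := add_le_add_left this _
        _ = _ := by ring

theorem wsum_uniformBelow {K : ℕ} (hK : 0 < K) (F : ℤ → ℝ≥0∞) :
    wsum (uniformBelow K) F = (K : ℝ≥0∞)⁻¹ * ∑ u ∈ Finset.range K, F u := by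
  have hK' : (0 : ℤ) < K := by exact_mod_cast hK
  have hu : ∀ z, uniformBelow K z = if z ∈ Finset.Ico (0 : ℤ) K then (K : ℝ≥0∞)⁻¹ else 0 := by
    intro z
    rw [uniformBelow, dif_pos hK']
    refine (PMF.uniformOfFinset_apply _ _).trans ?_
    simp
  rw [wsum, tsum_eq_sum (s := Finset.Ico (0 : ℤ) K)]
  · have e : ∀ z ∈ Finset.Ico (0 : ℤ) K, uniformBelow K z * F z = (K : ℝ≥0∞)⁻¹ * F z := by
      intro z hz
      rw [hu, if_pos hz]
    rw [Finset.sum_congr rfl e, ← Finset.mul_sum]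
    congr 1
    refine Finset.sum_nbij' (fun z => z.toNat) (fun u => (u : ℤ)) ?_ ?_ ?_ ?_ ?_
    · intro z hz; rw [Finset.mem_Ico] at hz; rw [Finset.mem_range]; omega
    · intro u hu; rw [Finset.mem_range] at hu; rw [Finset.mem_Ico]; omega
    · intro z hz; rw [Finset.mem_Ico] at hz; omega
    · intro u _; simp
    · intro z hz; rw [Finset.mem_Ico] at hz; congr 1; omega
  · intro z hz
    rw [hu, if_neg hz, zero_mul]

/-- Picking a uniform element among the first `K` elements of a Poisson process. -/
theorem poissonMean_pick_le {μ : β → ℝ≥0∞} {K : ℕ} (hK : 0 < K) (hμ : ∑' b, μ b ≤ K)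
    {f : Option β → ℝ≥0∞} (hf : f none ≤ 1) :
    poissonMean μ (fun l => wsum (uniformBelow K) fun u => f l[u.toNat]?) ≤
      (K : ℝ≥0∞)⁻¹ * wsum μ (fun b => f (some b)) + (1 - (K : ℝ≥0∞)⁻¹ * ∑' b, μ b) * f none +
        2⁻¹ ^ K * eexp (∑' b, μ b) := by
  have hμ' : ∑' b, μ b ≠ ⊤ := ne_top_of_le_ne_top (by simp) hμ
  have hK0 : (K : ℝ≥0∞) ≠ 0 := by exact_mod_cast hK.ne'
  have h1 : poissonMean μ (fun l => wsum (uniformBelow K) fun u => f l[u.toNat]?) ≤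
      (K : ℝ≥0∞)⁻¹ * wsum μ (fun b => f (some b)) +
        (K : ℝ≥0∞)⁻¹ * poissonMean μ (fun l => ((K - l.length : ℕ) : ℝ≥0∞)) * f none := by
    rw [mul_assoc, mul_comm (poissonMean _ _), ← poissonMean_mul_left, ← poissonMean_sum_map hμ',
      ← mul_add, ← poissonMean_add, ← poissonMean_mul_left]
    refine poissonMean_mono fun l => ?_
    rw [wsum_uniformBelow hK]
    simp only [Int.toNat_natCast]
    rw [mul_comm (f none)]
    exact mul_le_mul_right (sum_range_getElem?_le f l K) _
  -- Pointwise, `(K - len)⁺ + len` equals `K` unless the process has more than `K` points. In that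
  -- case the excess `len - K` is at most `2 ^ (len - K)`, whose expectation is the exponential
  -- moment above.
  have h2 : poissonMean μ (fun l => ((K - l.length : ℕ) : ℝ≥0∞)) + ∑' b, μ b ≤
      K + 2⁻¹ ^ K * eexp (∑' b, μ b) := by
    rw [← poissonMean_two_pow_length hμ', ← wsum_one, ← poissonMean_sum_map hμ',
      ← poissonMean_mul_left, ← poissonMean_const hμ' (K : ℝ≥0∞), ← poissonMean_add,
      ← poissonMean_add]
    refine poissonMean_mono fun l => ?_
    rw [List.map_const', List.sum_replicate, nsmul_eq_mul, mul_one]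
    rcases le_total l.length K with h | h
    · have : ((K - l.length : ℕ) : ℝ≥0∞) + l.length = K := by
        exact_mod_cast Nat.sub_add_cancel h
      rw [this]
      exact le_self_add
    · rw [Nat.sub_eq_zero_of_le h, Nat.cast_zero, zero_add]
      have e : (2⁻¹ : ℝ≥0∞) ^ K * 2 ^ l.length = 2 ^ (l.length - K) := by
        rw [← Nat.add_sub_cancel' h, pow_add, ← mul_assoc, ← mul_pow,
          ENNReal.inv_mul_cancel (by simp) (by simp), one_pow, one_mul, Nat.add_sub_cancel_left]
      rw [e]
      have : l.length ≤ K + 2 ^ (l.length - K) := by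
        have := (Nat.lt_two_pow_self (n := l.length - K)).le
        omega
      exact_mod_cast this
  have hle : (K : ℝ≥0∞)⁻¹ * ∑' b, μ b ≤ 1 := by
    rw [← ENNReal.inv_mul_cancel hK0 (by simp)]
    exact mul_le_mul_right hμ _
  have h3 : (K : ℝ≥0∞)⁻¹ * poissonMean μ (fun l => ((K - l.length : ℕ) : ℝ≥0∞)) ≤
      (1 - (K : ℝ≥0∞)⁻¹ * ∑' b, μ b) + 2⁻¹ ^ K * eexp (∑' b, μ b) := by
    have hne : (K : ℝ≥0∞)⁻¹ * ∑' b, μ b ≠ ⊤ := ne_top_of_le_ne_top (by simp) hle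
    refine (ENNReal.add_le_add_iff_right hne).1 ?_
    calc _ = (K : ℝ≥0∞)⁻¹ * (poissonMean μ (fun l => ((K - l.length : ℕ) : ℝ≥0∞)) + ∑' b, μ b) := by
          ring
      _ ≤ (K : ℝ≥0∞)⁻¹ * (K + 2⁻¹ ^ K * eexp (∑' b, μ b)) := mul_le_mul_right h2 _
      _ = 1 + (K : ℝ≥0∞)⁻¹ * (2⁻¹ ^ K * eexp (∑' b, μ b)) := by
          rw [mul_add, ENNReal.inv_mul_cancel hK0 (by simp)]
      _ ≤ 1 + 2⁻¹ ^ K * eexp (∑' b, μ b) := by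
          refine add_le_add_right (mul_le_of_le_one_left' ?_) _
          rw [ENNReal.inv_le_one]
          exact_mod_cast hK
      _ = _ := by rw [add_right_comm, tsub_add_cancel_of_le hle]
  calc _ ≤ _ := h1
    _ ≤ (K : ℝ≥0∞)⁻¹ * wsum μ (fun b => f (some b)) +
        ((1 - (K : ℝ≥0∞)⁻¹ * ∑' b, μ b) + 2⁻¹ ^ K * eexp (∑' b, μ b)) * f none :=
        add_le_add_right (mul_le_mul_left h3 _) _
    _ ≤ _ := by
        rw [add_mul, ← add_assoc]
        exact add_le_add_right (mul_le_of_le_one_right' hf) _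

end poisson

/-! ### The main loop with a Poisson dictionary -/

section mainLoop

variable {α : Type} (cs : α → ℤ) (av : α → α → α) (K : ℕ) (q : PMF α)

/-- The law of a dictionary entry. -/
noncomputable def dictLaw (J : ℕ) : PMF ((ℤ × ℤ) × α) :=
  q.bind fun y => (uniformBelow J).map fun r => ((cs y, r), y)

/-- The main loop, with fresh samples. -/
noncomputable def mainLoop (dict : List ((ℤ × ℤ) × α)) :
    ℕ → List ℤ × List α → PMF (List ℤ × List α) :=
  iter fun _ s => q.bind fun x => mainStep cs av K dict x s

theorem wsum_iter_concat {β : Type} (D : PMF β) (n : ℕ) (l₀ : List β) (G : List β → ℝ≥0∞) :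
    wsum (iter (fun _ l => D.map fun b => l ++ [b]) n l₀) G = psum D n fun l => G (l₀ ++ l) := by
  induction n generalizing l₀ with
  | zero => simp [iter, wsum_pure, psum]
  | succ n ih =>
    rw [iter, wsum_bind, wsum_map, psum]
    refine wsum_congr fun b => ?_
    rw [ih]
    simp

theorem wsum_iter_dictStep (J n : ℕ) (G : List ((ℤ × ℤ) × α) → ℝ≥0∞) :
    wsum (iter (fun _ l => q.bind fun y => dictStep cs J y l) n []) G =
      psum (dictLaw cs q J) n G := by
  have h : (fun (_ : ℕ) (l : List ((ℤ × ℤ) × α)) => q.bind fun y => dictStep cs J y l) =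
      fun _ l => (dictLaw cs q J).map fun b => l ++ [b] := by
    funext _ l
    rw [dictLaw, PMF.map_bind]
    congr 1
    funext y
    rw [dictStep, PMF.map_comp]
    rfl
  rw [h, wsum_iter_concat]
  simp

theorem wsum_mainLoop_succ (dict : List ((ℤ × ℤ) × α)) (n : ℕ) (s : List ℤ × List α)
    (G : List ℤ × List α → ℝ≥0∞) :
    wsum (mainLoop cs av K q dict (n + 1) s) G = wsum q fun x => wsum (uniformBelow K) fun u =>
      wsum (mainLoop cs av K q dict n (cs x :: s.1,
        s.2 ++ ((lookup dict (cs x, s.1.count (cs x)))[u.toNat]?.map (av x)).toList)) G := by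
  rw [mainLoop, iter, wsum_bind, wsum_bind]
  refine wsum_congr fun x => ?_
  rw [mainStep, wsum_map]

/-- Cell `z` has been visited, if `cl` are the classes of the elements treated so far. -/
def visited (cl : List ℤ) (z : ℤ × ℤ) : Bool := decide (0 ≤ z.2 ∧ z.2 < cl.count z.1)

theorem visited_cons (c : ℤ) (cl : List ℤ) (z : ℤ × ℤ) :
    visited (c :: cl) z = (visited cl z || decide (z = (c, (cl.count c : ℤ)))) := by
  obtain ⟨z₁, z₂⟩ := z
  simp only [visited, List.count_cons, Prod.mk.injEq]
  by_cases h : c = z₁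
  · subst h
    simp only [BEq.rfl, if_true, true_and, ← Bool.decide_or]
    congr 1
    push_cast
    apply propext
    omega
  · have h' : ¬ z₁ = c := fun e => h e.symm
    simp [h, h']

theorem visited_self (c : ℤ) (cl : List ℤ) : visited cl (c, (cl.count c : ℤ)) = false := by
  simp [visited]

/-- A visited cell is never opened again, because the label used for a class is the number of its
earlier occurrences. The contents of visited cells can therefore be forgotten. -/
theorem wsum_mainLoop_congr {dict dict' : List ((ℤ × ℤ) × α)} (n : ℕ) (s : List ℤ × List α)
    (G : List ℤ × List α → ℝ≥0∞) (h : ∀ z, visited s.1 z = false → lookup dict z = lookup dict' z) :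
    wsum (mainLoop cs av K q dict n s) G = wsum (mainLoop cs av K q dict' n s) G := by
  induction n generalizing s with
  | zero => rfl
  | succ n ih =>
    rw [wsum_mainLoop_succ, wsum_mainLoop_succ]
    refine wsum_congr fun x => wsum_congr fun u => ?_
    rw [h _ (visited_self _ _)]
    refine ih _ fun z hz => h z ?_
    rw [visited_cons] at hz
    exact (Bool.or_eq_false_iff.1 hz).1

/-- The expectation of `G` after the main loop if every visited cell is a fresh Poisson process. -/
noncomputable def freshMean (μ : (ℤ × ℤ) × α → ℝ≥0∞) (G : List α → ℝ≥0∞) :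
    ℕ → List ℤ → List α → ℝ≥0∞
  | 0, _, out => G out
  | n + 1, cl, out => wsum q fun x =>
      poissonMean (restrict (fun e => decide (e.1 = (cs x, (cl.count (cs x) : ℤ)))) μ) fun a =>
        wsum (uniformBelow K) fun u =>
          freshMean μ G n (cs x :: cl) (out ++ ((a.map Prod.snd)[u.toNat]?.map (av x)).toList)

/-- Principle of deferred decisions. At each round the process on the unvisited cells splits into
the cell opened now and the rest, which are independent; the first is revealed, and the second is
again the process on the unvisited cells. -/
theorem poissonMean_mainLoop (μ : (ℤ × ℤ) × α → ℝ≥0∞) (hμ : ∑' e, μ e ≠ ⊤) (G : List α → ℝ≥0∞)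
    (n : ℕ) (cl : List ℤ) (out : List α) :
    poissonMean (restrict (fun e => !visited cl e.1) μ) (fun dict =>
      wsum (mainLoop cs av K q dict n (cl, out)) fun s => G s.2) =
        freshMean cs av K q μ G n cl out := by
  induction n generalizing cl out with
  | zero =>
    simp only [mainLoop, iter, wsum_pure, freshMean]
    exact poissonMean_const (ne_top_of_le_ne_top hμ (tsum_restrict_le _ _)) _
  | succ n ih =>
    simp only [wsum_mainLoop_succ, freshMean]
    rw [poissonMean_wsum]
    refine wsum_congr fun x => ?_
    have key := poissonMean_split (fun e : (ℤ × ℤ) × α => decide (e.1 = (cs x, (cl.count (cs x) : ℤ))))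
      (restrict (fun e => !visited cl e.1) μ) fun a b => wsum (uniformBelow K) fun u =>
        wsum (mainLoop cs av K q b n (cs x :: cl,
          out ++ ((a.map Prod.snd)[u.toNat]?.map (av x)).toList)) fun s => G s.2
    have e1 : restrict (fun e : (ℤ × ℤ) × α => decide (e.1 = (cs x, (cl.count (cs x) : ℤ))))
        (restrict (fun e => !visited cl e.1) μ) =
        restrict (fun e => decide (e.1 = (cs x, (cl.count (cs x) : ℤ)))) μ := by
      rw [restrict_restrict]
      congr 1
      funext e
      by_cases h : e.1 = (cs x, (cl.count (cs x) : ℤ))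
      · simp [h, visited_self]
      · simp [h]
    have e2 : restrict (fun e : (ℤ × ℤ) × α => !decide (e.1 = (cs x, (cl.count (cs x) : ℤ))))
        (restrict (fun e => !visited cl e.1) μ) =
        restrict (fun e => !visited (cs x :: cl) e.1) μ := by
      rw [restrict_restrict]
      congr 1
      funext e
      rw [visited_cons, Bool.not_or, Bool.and_comm]
    rw [e1, e2] at key
    simp_rw [poissonMean_wsum, ih] at key
    simp_rw [poissonMean_wsum]
    rw [← key]
    refine wsum_congr fun u => ?_
    congr 1
    funext dict
    refine wsum_mainLoop_congr cs av K q n _ _ fun z hz => ?_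
    rw [visited_cons] at hz
    have hz' := (Bool.or_eq_false_iff.1 hz).2
    simp only [decide_eq_false_iff_not] at hz'
    unfold lookup
    rw [List.filter_filter]
    congr 1
    refine List.filter_congr fun e _ => ?_
    by_cases h : e.1 = z
    · simp [h, hz']
    · simp [h]

/-- Random labels spread the mass of a class evenly over its `J` cells, so each cell sees the
intensity restricted to the class and divided by `J`. The condition `r < J` matters: cells with
larger labels stay empty. -/
theorem wsum_cell {J : ℕ} (hJ : 0 < J) (Λ : ℝ≥0∞) (c : ℤ) {r : ℕ} (hr : r < J) (F : α → ℝ≥0∞) :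
    wsum (restrict (fun e => decide (e.1 = (c, (r : ℤ)))) fun e => Λ * dictLaw cs q J e)
      (fun e => F e.2) = Λ * (J : ℝ≥0∞)⁻¹ * wsum q fun y => if cs y = c then F y else 0 := by
  have h : ∀ H : (ℤ × ℤ) × α → ℝ≥0∞, wsum (fun e => Λ * dictLaw cs q J e) H =
      Λ * wsum (dictLaw cs q J) H := fun H => by
    simp only [wsum, mul_assoc, ENNReal.tsum_mul_left]
  rw [wsum_restrict, h, mul_assoc]
  congr 1
  rw [dictLaw, wsum_bind, ← wsum_mul_left]
  refine wsum_congr fun y => ?_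
  rw [wsum_map, wsum_uniformBelow hJ]
  congr 1
  rw [Finset.sum_eq_single r]
  · simp
  · intro r' _ hr'
    simp [hr']
  · intro h; exact absurd (Finset.mem_range.2 hr) h

/-- The probability of class `c`. -/
noncomputable def classProb (c : ℤ) : ℝ≥0∞ := wsum q fun y => if cs y = c then 1 else 0

theorem classProb_le_one (c : ℤ) : classProb cs q c ≤ 1 :=
  wsum_le_one q fun y => by split_ifs <;> simp

/-- The expectation of `G` after the main loop if each sample `x` is combined with a given element
`y` of its class with probability `θ * q y`. -/
noncomputable def idealMean (θ : ℝ≥0∞) (G : List α → ℝ≥0∞) : ℕ → List α → ℝ≥0∞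
  | 0, out => G out
  | n + 1, out => wsum q fun x =>
      θ * wsum q (fun y => if cs y = cs x then idealMean θ G n (out ++ [av x y]) else 0) +
        (1 - θ * classProb cs q (cs x)) * idealMean θ G n out

/-- Weight of the event that the next cell does not exist. -/
noncomputable def classPotential (cl : List ℤ) : ℝ≥0∞ := wsum q fun x => 2 ^ cl.count (cs x)

variable {cs av K q}

theorem freshMean_le_one {μ : (ℤ × ℤ) × α → ℝ≥0∞} (hμ : ∑' e, μ e ≠ ⊤) {G : List α → ℝ≥0∞}
    (hG : ∀ l, G l ≤ 1) (n : ℕ) (cl : List ℤ) (out : List α) :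
    freshMean cs av K q μ G n cl out ≤ 1 := by
  rw [← poissonMean_mainLoop cs av K q μ hμ]
  refine (poissonMean_mono fun l => wsum_le_one _ fun s => hG _).trans_eq ?_
  exact poissonMean_const (ne_top_of_le_ne_top hμ (tsum_restrict_le _ _)) _

/-- A new sample doubles the weight of its own class and of no other, and a given class is hit with
probability at most `p₀`. -/
theorem wsum_classPotential_le {p₀ : ℝ≥0∞} (hp : ∀ c, classProb cs q c ≤ p₀) (cl : List ℤ) :
    wsum q (fun x => classPotential cs q (cs x :: cl)) ≤ (1 + p₀) * classPotential cs q cl := by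
  simp only [classPotential]
  rw [wsum_comm, ← wsum_mul_left]
  refine wsum_mono fun x => ?_
  have h : ∀ y, (2 : ℝ≥0∞) ^ (cs y :: cl).count (cs x) =
      2 ^ cl.count (cs x) * (1 + if cs y = cs x then 1 else 0) := fun y => by
    rw [List.count_cons]
    by_cases h : cs y = cs x
    · simp only [h, BEq.rfl, if_true, pow_succ]
      norm_num
    · simp [h]
  simp_rw [h, wsum_mul_left, wsum_add, wsum_const]
  rw [mul_comm]
  exact mul_le_mul_left (add_le_add_right (hp _) _) _

/-- There are two sources of error per round: an overfull cell, charged `δ`, and a class that has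
already used up its `J` cells. In the second case the trivial bound `1 ≤ 2^{-J} 2^{count}` is used,
and its expectation is controlled by `classPotential`, which grows by at most `1 + p₀` per round.
The probabilities of picking and of not picking an element sum to one, so the errors of later rounds
are passed on without amplification. -/
theorem freshMean_le {J : ℕ} {Λ θ p₀ δ : ℝ≥0∞} (hK : 0 < K) (hJ : 0 < J) (hΛ : Λ ≠ ⊤)
    (hp : ∀ c, classProb cs q c ≤ p₀) (hθ : θ = (K : ℝ≥0∞)⁻¹ * (Λ * (J : ℝ≥0∞)⁻¹))
    (hθp : θ * p₀ ≤ 1) (hδ : 2⁻¹ ^ K * eexp (Λ * (J : ℝ≥0∞)⁻¹ * p₀) ≤ δ)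
    {G : List α → ℝ≥0∞} (hG : ∀ l, G l ≤ 1) (n : ℕ) (cl : List ℤ) (out : List α) :
    freshMean cs av K q (fun e => Λ * dictLaw cs q J e) G n cl out ≤
      idealMean cs av q θ G n out + (n * δ +
        n * (2⁻¹ ^ J * (1 + p₀) ^ n) * classPotential cs q cl) := by
  have hμ : ∑' e, Λ * dictLaw cs q J e ≠ ⊤ := by
    rw [ENNReal.tsum_mul_left, PMF.tsum_coe, mul_one]; exact hΛ
  have hK0 : (K : ℝ≥0∞) ≠ 0 := by exact_mod_cast hK.ne'
  have hθ1 : ∀ c, θ * classProb cs q c ≤ 1 := fun c => (mul_le_mul_right (hp c) _).trans hθp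
  induction n generalizing cl out with
  | zero => simp [freshMean, idealMean]
  | succ n ih =>
    set f : ℕ → List ℤ → List α → ℝ≥0∞ :=
      freshMean cs av K q (fun e => Λ * dictLaw cs q J e) G with hf
    have hf1 : ∀ n cl out, f n cl out ≤ 1 := freshMean_le_one hμ hG
    set err : List ℤ → ℝ≥0∞ := fun cl =>
      n * δ + n * (2⁻¹ ^ J * (1 + p₀) ^ n) * classPotential cs q cl with herr
    set g := idealMean cs av q θ G with hg
    have step : ∀ x, poissonMean (restrict (fun e => decide (e.1 = (cs x, (cl.count (cs x) : ℤ))))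
        fun e => Λ * dictLaw cs q J e) (fun a => wsum (uniformBelow K) fun u =>
          f n (cs x :: cl) (out ++ ((a.map Prod.snd)[u.toNat]?.map (av x)).toList)) ≤
        (θ * wsum q (fun y => if cs y = cs x then g n (out ++ [av x y]) else 0) +
          (1 - θ * classProb cs q (cs x)) * g n out) + err (cs x :: cl) + δ +
          2⁻¹ ^ J * 2 ^ cl.count (cs x) := by
      intro x
      rcases lt_or_ge (cl.count (cs x)) J with hr | hr
      · refine le_trans ?_ le_self_add
        have hm := wsum_cell cs q hJ Λ (cs x) hr fun _ => 1
        rw [wsum_one] at hm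
        have hm' : (K : ℝ≥0∞)⁻¹ * ∑' b, restrict (fun e : (ℤ × ℤ) × α =>
            decide (e.1 = (cs x, (cl.count (cs x) : ℤ)))) (fun e => Λ * dictLaw cs q J e) b =
            θ * classProb cs q (cs x) := by
          rw [hm, hθ, classProb]; ring
        have hle : ∑' b, restrict (fun e : (ℤ × ℤ) × α =>
            decide (e.1 = (cs x, (cl.count (cs x) : ℤ)))) (fun e => Λ * dictLaw cs q J e) b ≤ K := by
          have := hθ1 (cs x)
          rw [← hm'] at this
          have := mul_le_mul_right this (K : ℝ≥0∞)
          rwa [← mul_assoc, ENNReal.mul_inv_cancel hK0 (by simp), one_mul, mul_one] at this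
        have := poissonMean_pick_le hK hle (f := fun o => f n (cs x :: cl)
          (out ++ ((o.map Prod.snd).map (av x)).toList)) (hf1 _ _ _)
        simp only [List.getElem?_map] at this ⊢
        refine this.trans ?_
        rw [hm']
        have e2 := wsum_cell cs q hJ Λ (cs x) hr fun y => f n (cs x :: cl) (out ++ [av x y])
        simp only [Option.map_some, Option.toList_some, Option.map_none, Option.toList_none,
          List.append_nil]
        rw [e2, ← mul_assoc, ← hθ]
        refine add_le_add ?_ (le_trans (mul_le_mul_right (eexp_mono ?_) _) hδ)
        · calc _ ≤ θ * wsum q (fun y => if cs y = cs x then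
                g n (out ++ [av x y]) + err (cs x :: cl) else 0) +
              (1 - θ * classProb cs q (cs x)) * (g n out + err (cs x :: cl)) := by
                refine add_le_add (mul_le_mul_right (wsum_mono fun y => ?_) _)
                  (mul_le_mul_right (ih _ _) _)
                split_ifs
                · exact ih _ _
                · exact le_rfl
            _ = (θ * wsum q (fun y => if cs y = cs x then g n (out ++ [av x y]) else 0) +
                (1 - θ * classProb cs q (cs x)) * g n out) +
                (θ * classProb cs q (cs x) + (1 - θ * classProb cs q (cs x))) *
                  err (cs x :: cl) := by
                have : (fun y => if cs y = cs x then g n (out ++ [av x y]) + err (cs x :: cl)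
                    else 0) = fun y => (if cs y = cs x then g n (out ++ [av x y]) else 0) +
                    (if cs y = cs x then 1 else 0) * err (cs x :: cl) := by
                  funext y; split_ifs <;> simp
                rw [this, wsum_add, wsum_mul_right, classProb]
                ring
            _ = _ := by rw [add_tsub_cancel_of_le (hθ1 _), one_mul]
        · rw [hm]
          exact mul_le_mul_right (hp _) _
      · refine le_trans ?_ le_add_self
        refine le_trans ((poissonMean_mono fun l => wsum_le_one _ fun u => hf1 _ _ _).trans_eq
          (poissonMean_const (ne_top_of_le_ne_top hμ (tsum_restrict_le _ _)) _)) ?_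
        rw [← one_pow J, ← ENNReal.inv_mul_cancel (a := 2) (by simp) (by simp), mul_pow]
        exact mul_le_mul_right (pow_le_pow_right₀ (by norm_num) hr) _
    have h1 : f (n + 1) cl out ≤ g (n + 1) out + wsum q (fun x => err (cs x :: cl)) + δ +
        2⁻¹ ^ J * classPotential cs q cl := by
      refine (wsum_mono step).trans_eq ?_
      rw [wsum_add, wsum_add, wsum_add, wsum_const, wsum_mul_left]
      rfl
    have h2 : wsum q (fun x => err (cs x :: cl)) ≤ n * δ +
        n * (2⁻¹ ^ J * (1 + p₀) ^ (n + 1)) * classPotential cs q cl := by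
      simp only [herr]
      rw [wsum_add, wsum_const, wsum_mul_left]
      refine add_le_add_right ((mul_le_mul_right (wsum_classPotential_le hp cl) _).trans_eq ?_) _
      rw [pow_succ]; ring
    have h3 : 2⁻¹ ^ J * classPotential cs q cl ≤
        2⁻¹ ^ J * (1 + p₀) ^ (n + 1) * classPotential cs q cl :=
      mul_le_mul_left (le_mul_of_one_le_right' (one_le_pow₀ le_self_add)) _
    calc _ ≤ _ := h1
      _ ≤ g (n + 1) out + (n * δ + n * (2⁻¹ ^ J * (1 + p₀) ^ (n + 1)) * classPotential cs q cl) +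
          δ + 2⁻¹ ^ J * (1 + p₀) ^ (n + 1) * classPotential cs q cl :=
          add_le_add (add_le_add_left (add_le_add_right h2 _) _) h3
      _ = _ := by push_cast; ring

end mainLoop

/-! ### Independent trials -/

/-- A biased coin. -/
noncomputable def coin (t : ℝ≥0∞) (h : t ≤ 1) : PMF Bool :=
  PMF.ofFintype (fun b => if b then t else 1 - t) (by simp [add_tsub_cancel_of_le h])

theorem wsum_coin (t : ℝ≥0∞) (h : t ≤ 1) (F : Bool → ℝ≥0∞) :
    wsum (coin t h) F = t * F true + (1 - t) * F false := by
  rw [wsum, tsum_fintype, Fintype.sum_bool]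
  rfl

/-- The number of successes in `n` independent trials. -/
noncomputable def trialCount (t : ℝ≥0∞) (h : t ≤ 1) : ℕ → PMF ℕ
  | 0 => PMF.pure 0
  | n + 1 => (coin t h).bind fun b => (trialCount t h n).map fun k => if b then k + 1 else k

theorem wsum_trialCount_succ (t : ℝ≥0∞) (h : t ≤ 1) (n : ℕ) (F : ℕ → ℝ≥0∞) :
    wsum (trialCount t h (n + 1)) F = t * wsum (trialCount t h n) (fun k => F (k + 1)) +
      (1 - t) * wsum (trialCount t h n) F := by
  rw [trialCount, wsum_bind, wsum_coin, wsum_map, wsum_map]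
  simp

theorem trialCount_le (t : ℝ≥0∞) (h : t ≤ 1) (n : ℕ) : ∀ k ∈ (trialCount t h n).support, k ≤ n := by
  induction n with
  | zero => intro k hk; rw [trialCount, PMF.mem_support_pure_iff] at hk; omega
  | succ n ih =>
    intro k hk
    rw [trialCount, PMF.mem_support_bind_iff] at hk
    obtain ⟨b, _, hk⟩ := hk
    rw [PMF.mem_support_map_iff] at hk
    obtain ⟨k', hk', rfl⟩ := hk
    have := ih k' hk'
    split_ifs <;> omega

theorem wsum_trialCount_half_pow (t : ℝ≥0∞) (h : t ≤ 1) (n : ℕ) :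
    wsum (trialCount t h n) (fun k => 2⁻¹ ^ k) = (t * 2⁻¹ + (1 - t)) ^ n := by
  induction n with
  | zero => rw [trialCount, wsum_pure]; simp
  | succ n ih =>
    rw [wsum_trialCount_succ]
    simp_rw [pow_succ]
    rw [wsum_mul_right, ih]
    ring

/-- The ideal main loop produces a random number of independent samples. -/
theorem idealMean_eq {α : Type} {cs : α → ℤ} {av : α → α → α} {q q' : PMF α} {θ C : ℝ≥0∞}
    (hav : ∀ F : α → ℝ≥0∞, wsum q (fun x => wsum q fun y => if cs y = cs x then F (av x y) else 0) =
      C * wsum q' F) (hθ : ∀ c, θ * classProb cs q c ≤ 1) (ht : θ * C ≤ 1) (G : List α → ℝ≥0∞)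
    (n : ℕ) (out : List α) : idealMean cs av q θ G n out =
      wsum (trialCount (θ * C) ht n) fun k => psum q' k fun l => G (out ++ l) := by
  induction n generalizing out with
  | zero => simp [idealMean, trialCount, wsum_pure, psum]
  | succ n ih =>
    have e1 : wsum q (fun x => θ * classProb cs q (cs x)) = θ * C := by
      have := hav fun _ => 1
      rw [wsum_const, mul_one] at this
      rw [wsum_mul_left, ← this]
      rfl
    have e2 : wsum q (fun x => 1 - θ * classProb cs q (cs x)) = 1 - θ * C := by
      refine ENNReal.eq_sub_of_add_eq (ne_top_of_le_ne_top (by simp) ht) ?_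
      rw [← e1, ← wsum_add, wsum_congr fun x => tsub_add_cancel_of_le (hθ (cs x)), wsum_const]
    rw [idealMean, wsum_add, wsum_mul_left, wsum_mul_right, e2, wsum_trialCount_succ,
      hav fun z => idealMean cs av q θ G n (out ++ [z]), ih, ← mul_assoc]
    congr 2
    simp_rw [ih, psum]
    rw [wsum_comm]
    simp

/-! ### Tail bounds -/

section multiplicity

variable {α : Type} {cs : α → ℤ} {q : PMF α}

theorem count_le_maxMult (c : ℤ) (l : List ℤ) : l.count c ≤ maxMult l := by
  induction l with
  | nil => simp
  | cons a l ih =>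
    rw [List.count_cons, maxMult]
    by_cases h : a = c
    · subst h; simp
    · simp [h]; omega

theorem pow_count_eq_prod (b : ℝ≥0∞) (c : ℤ) (l : List α) :
    b ^ (l.map cs).count c = (l.map fun x => if cs x = c then b else 1).prod := by
  induction l with
  | nil => simp
  | cons a l ih =>
    rw [List.map_cons, List.count_cons, pow_add, ih, List.map_cons, List.prod_cons, mul_comm]
    by_cases h : cs a = c <;> simp [h]

theorem psum_two_pow_count (c : ℤ) (n : ℕ) :
    psum q n (fun l => 2 ^ (l.map cs).count c) = (1 + classProb cs q c) ^ n := by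
  simp_rw [pow_count_eq_prod, psum_prod]
  congr 1
  rw [classProb, ← wsum_const q 1, ← wsum_add]
  refine wsum_congr fun x => ?_
  rw [wsum_const]
  split_ifs <;> norm_num

theorem psum_half_pow_count (c : ℤ) (n : ℕ) :
    psum q n (fun l => 2⁻¹ ^ (l.map cs).count c) =
      (classProb cs q c * 2⁻¹ + (1 - classProb cs q c)) ^ n := by
  simp_rw [pow_count_eq_prod, psum_prod]
  congr 1
  have hle := classProb_le_one cs q c
  have hne : classProb cs q c ≠ ⊤ := ne_top_of_le_ne_top (by simp) hle
  have h : 1 - classProb cs q c = wsum q fun x => if cs x = c then 0 else 1 := by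
    refine (ENNReal.eq_sub_of_add_eq hne ?_).symm
    rw [classProb, ← wsum_add, ← wsum_const q 1]
    refine wsum_congr fun x => ?_
    rw [wsum_const]
    split_ifs <;> simp
  rw [h, classProb, ← wsum_mul_right, ← wsum_add]
  exact wsum_congr fun x => by split_ifs <;> simp

/-- The union bound runs over the samples rather than over the classes, so the number `2 ^ d` of
classes does not enter. A sample can raise the maximum to `j` only if its class already has at least
`j - 1` members, and this is bounded by the exponential moment of the count. -/
theorem psum_le_maxMult {p₀ : ℝ≥0∞} (hp : ∀ c, classProb cs q c ≤ p₀) {j : ℕ} (hj : 0 < j) (n : ℕ) :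
    psum q n (fun l => if j ≤ maxMult (l.map cs) then 1 else 0) ≤
      n * (2 * 2⁻¹ ^ j * (1 + p₀) ^ n) := by
  induction n with
  | zero => simp [psum, maxMult]; omega
  | succ n ih =>
    have h1 : ∀ a (l : List α), (if j ≤ maxMult ((a :: l).map cs) then (1 : ℝ≥0∞) else 0) ≤
        (if j ≤ maxMult (l.map cs) then 1 else 0) + 2 * 2⁻¹ ^ j * 2 ^ (l.map cs).count (cs a) := by
      intro a l
      simp only [List.map_cons, maxMult]
      split_ifs with h2 h3 h3
      · exact le_self_add
      · rw [zero_add]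
        have h4 : j ≤ (l.map cs).count (cs a) + 1 := by omega
        calc (1 : ℝ≥0∞) = 2⁻¹ ^ j * 2 ^ j := by
              rw [← mul_pow, ENNReal.inv_mul_cancel (by simp) (by simp), one_pow]
          _ ≤ 2⁻¹ ^ j * 2 ^ ((l.map cs).count (cs a) + 1) :=
              mul_le_mul_right (pow_le_pow_right₀ (by norm_num) h4) _
          _ = _ := by rw [pow_succ]; ring
      · simp
      · simp
    rw [psum]
    calc _ ≤ wsum q fun a => n * (2 * 2⁻¹ ^ j * (1 + p₀) ^ n) + 2 * 2⁻¹ ^ j * (1 + p₀) ^ n := by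
          refine wsum_mono fun a => (psum_mono fun l _ => h1 a l).trans ?_
          rw [psum_add, psum_mul_left, psum_two_pow_count]
          exact add_le_add ih (mul_le_mul_right (pow_le_pow_left' (add_le_add_right (hp _) _) _) _)
      _ = ((n + 1 : ℕ) : ℝ≥0∞) * (2 * 2⁻¹ ^ j * (1 + p₀) ^ n) := by
          rw [wsum_const]; push_cast; ring
      _ ≤ _ := mul_le_mul_right (mul_le_mul_right
          (pow_le_pow_right₀ le_self_add n.le_succ) _) _

/-- The maximum dominates the count of any single class, so a Chernoff bound for one class suffices;
it is applied later to the most likely one. -/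
theorem psum_maxMult_lt (c : ℤ) (j n : ℕ) :
    psum q n (fun l => if maxMult (l.map cs) < j then 1 else 0) ≤
      2 ^ j * (classProb cs q c * 2⁻¹ + (1 - classProb cs q c)) ^ n := by
  rw [← psum_half_pow_count, ← psum_mul_left]
  refine psum_mono fun l _ => ?_
  split_ifs with h
  · have h4 := (count_le_maxMult c (l.map cs)).trans h.le
    calc (1 : ℝ≥0∞) = 2 ^ (l.map cs).count c * 2⁻¹ ^ (l.map cs).count c := by
          rw [← mul_pow, ENNReal.mul_inv_cancel (by simp) (by simp), one_pow]
      _ ≤ _ := mul_le_mul_left (pow_le_pow_right₀ (by norm_num) h4) _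
  · simp

end multiplicity

/-! ### The Poisson generator -/

/-- The Poisson distribution. -/
noncomputable def poissonWeight (v : ℝ≥0∞) (n : ℕ) : ℝ≥0∞ :=
  (eexp v)⁻¹ * ((n.factorial : ℝ≥0∞)⁻¹ * v ^ n)

theorem wsum_poissonWeight_two_pow {v : ℝ≥0∞} (hv : v ≠ ⊤) :
    wsum (poissonWeight v) (fun n => 2 ^ n) = eexp v := by
  have h : wsum (poissonWeight v) (fun n => 2 ^ n) = (eexp v)⁻¹ * eexp (v + v) := by
    have h0 : eexp (v + v) = ∑' n : ℕ, (n.factorial : ℝ≥0∞)⁻¹ * (v + v) ^ n := rfl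
    rw [h0, wsum, ← ENNReal.tsum_mul_left]
    refine tsum_congr fun n => ?_
    rw [poissonWeight, ← mul_two, mul_pow]
    ring
  rw [h, eexp_add, ← mul_assoc, ENNReal.inv_mul_cancel (eexp_ne_zero _) (eexp_ne_top hv), one_mul]

theorem tsum_poissonWeight {v : ℝ≥0∞} (hv : v ≠ ⊤) : ∑' n, poissonWeight v n = 1 := by
  simp_rw [poissonWeight]
  rw [ENNReal.tsum_mul_left, ← eexp, ENNReal.inv_mul_cancel (eexp_ne_zero _) (eexp_ne_top hv)]

/-- The Poisson distributions form a convolution semigroup. -/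
theorem wsum_poissonWeight_add (v w : ℝ≥0∞) (F : ℕ → ℝ≥0∞) :
    wsum (poissonWeight v) (fun i => wsum (poissonWeight w) fun j => F (i + j)) =
      wsum (poissonWeight (v + w)) F := by
  have h := tsum_choose fun i j => v ^ i * w ^ j * F (i + j)
  have h1 : ∀ n : ℕ, ∑ ij ∈ Finset.HasAntidiagonal.antidiagonal n,
      (n.choose ij.1 : ℝ≥0∞) * (v ^ ij.1 * w ^ ij.2 * F (ij.1 + ij.2)) = (v + w) ^ n * F n := by
    intro n
    rw [(Commute.all v w).add_pow', Finset.sum_mul]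
    refine Finset.sum_congr rfl fun ij hij => ?_
    rw [Finset.HasAntidiagonal.mem_antidiagonal] at hij
    rw [hij, nsmul_eq_mul]; ring
  simp_rw [h1] at h
  simp only [wsum, poissonWeight, mul_assoc, ENNReal.tsum_mul_left]
  rw [eexp_add, ENNReal.mul_inv (Or.inl (eexp_ne_zero _)) (Or.inr (eexp_ne_zero _)), h, mul_assoc]
  congr 1
  rw [← ENNReal.tsum_mul_left]
  refine tsum_congr fun i => ?_
  rw [← ENNReal.tsum_mul_left, ← ENNReal.tsum_mul_left, ← ENNReal.tsum_mul_left,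
    ← ENNReal.tsum_mul_left]
  exact tsum_congr fun j => by ring

/-- Of the `2k + 2` outcomes, `k + 1` accept the level `k`, one climbs to `k + 1`, and the remaining
`k` restart. Acceptance therefore has weight proportional to `2^{-k} / k!`, which is Poisson of mean
`1/2`. -/
theorem wsum_poissonStep (k W u : ℕ) (H : ℕ × ℕ × ℕ → ℝ≥0∞) :
    wsum (poissonStep (k, W, u + 1)) H = 2⁻¹ * H (0, W + k, u) +
      (2 * ((k : ℝ≥0∞) + 1))⁻¹ * (H (k + 1, W, u + 1) + k * H (0, W, u + 1)) := by
  have hK : (2 * (k : ℤ) + 2) = ((2 * k + 2 : ℕ) : ℤ) := by push_cast; ring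
  set f : ℕ → ℝ≥0∞ := fun r => H (if (r : ℤ) < (k : ℤ) + 1 then (0, W + k, u)
    else if (k : ℤ) + 1 < r then (0, W, u + 1) else (k + 1, W, u + 1)) with hf
  have s1 : ∑ r ∈ Finset.range (k + 1), f r = ((k : ℝ≥0∞) + 1) * H (0, W + k, u) := by
    rw [Finset.sum_congr rfl (g := fun _ => H (0, W + k, u)), Finset.sum_const, Finset.card_range,
      nsmul_eq_mul]
    · push_cast; rfl
    · intro r hr
      rw [Finset.mem_range] at hr
      simp only [hf]
      rw [if_pos (by omega)]
  have s2 : f (k + 1) = H (k + 1, W, u + 1) := by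
    simp only [hf]
    rw [if_neg (by push_cast; omega), if_neg (by push_cast; omega)]
  have s3 : ∑ r ∈ Finset.range k, f (k + 1 + 1 + r) = k * H (0, W, u + 1) := by
    rw [Finset.sum_congr rfl (g := fun _ => H (0, W, u + 1)), Finset.sum_const, Finset.card_range,
      nsmul_eq_mul]
    intro r hr
    simp only [hf]
    rw [if_neg (by push_cast; omega), if_pos (by push_cast; omega)]
  have s4 : ∑ r ∈ Finset.range (2 * k + 2), f r =
      ((k : ℝ≥0∞) + 1) * H (0, W + k, u) + (H (k + 1, W, u + 1) + k * H (0, W, u + 1)) := by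
    rw [show 2 * k + 2 = (k + 1 + 1) + k by ring, Finset.sum_range_add, Finset.sum_range_succ, s1, s2,
      s3, add_assoc]
  have e : wsum (poissonStep (k, W, u + 1)) H =
      ((2 * k + 2 : ℕ) : ℝ≥0∞)⁻¹ * ∑ r ∈ Finset.range (2 * k + 2), f r := by
    rw [poissonStep, if_pos (by simp), wsum_map, hK, wsum_uniformBelow (by omega)]
    rfl
  have e' : ((2 * k + 2 : ℕ) : ℝ≥0∞) = 2 * ((k : ℝ≥0∞) + 1) := by push_cast; ring
  rw [e, s4, mul_add, e', ENNReal.mul_inv (by simp) (by simp)]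
  congr 1
  calc _ = 2⁻¹ * (((k : ℝ≥0∞) + 1)⁻¹ * (k + 1)) * H (0, W + k, u) := by ring
    _ = _ := by rw [ENNReal.inv_mul_cancel (by simp) (by simp), mul_one]

/-- The probability that a proposal that has reached level `k` gets accepted at level `k + i`
without a restart. -/
noncomputable def acceptWeight (k i : ℕ) : ℝ≥0∞ :=
  2⁻¹ * 2⁻¹ ^ i * (k.factorial * ((k + i).factorial : ℝ≥0∞)⁻¹)

theorem acceptWeight_zero_right (k : ℕ) : acceptWeight k 0 = 2⁻¹ := by
  rw [acceptWeight, add_zero, ENNReal.mul_inv_cancel (by exact_mod_cast k.factorial_ne_zero) (by simp)]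
  simp

theorem acceptWeight_succ (k i : ℕ) :
    acceptWeight k (i + 1) = (2 * ((k : ℝ≥0∞) + 1))⁻¹ * acceptWeight (k + 1) i := by
  rw [acceptWeight, acceptWeight, ENNReal.mul_inv (by simp) (by simp), Nat.factorial_succ k,
    show k + 1 + i = k + (i + 1) by ring]
  push_cast
  calc _ = 2⁻¹ * 2⁻¹ ^ i * 2⁻¹ * (k.factorial * ((k + (i + 1)).factorial : ℝ≥0∞)⁻¹) := by ring
    _ = 2⁻¹ * 2⁻¹ ^ i * 2⁻¹ * (k.factorial * ((k + (i + 1)).factorial : ℝ≥0∞)⁻¹) *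
        (((k : ℝ≥0∞) + 1)⁻¹ * (k + 1)) := by
          rw [ENNReal.inv_mul_cancel (by simp) (by simp), mul_one]
    _ = _ := by ring

theorem tsum_acceptWeight_le (k : ℕ) : ∑' i, acceptWeight k i ≤ 1 := by
  calc ∑' i, acceptWeight k i ≤ ∑' i : ℕ, 2⁻¹ * 2⁻¹ ^ i := by
        refine ENNReal.tsum_le_tsum fun i => mul_le_of_le_one_right' ?_
        rw [← ENNReal.div_eq_inv_mul.trans (mul_comm _ _)]
        refine ENNReal.div_le_of_le_mul ?_
        rw [one_mul]
        exact_mod_cast Nat.factorial_le (Nat.le_add_right k i)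
    _ = 1 := by
        rw [ENNReal.tsum_mul_left, ENNReal.tsum_geometric, ENNReal.one_sub_inv_two, inv_inv,
          ENNReal.inv_mul_cancel (by simp) (by simp)]

/-- The restart probability of a proposal that has reached level `k`. -/
noncomputable def restartWeight (k : ℕ) : ℝ≥0∞ := 1 - ∑' i, acceptWeight k i

/-- From level `k` a restart either happens at once, in `k` of the `2 (k + 1)` outcomes, or after a
climb. Together with the corresponding recursion for `acceptWeight` this is a one-step decomposition
of the walk. -/
theorem restartWeight_eq (k : ℕ) :
    restartWeight k = (2 * ((k : ℝ≥0∞) + 1))⁻¹ * (restartWeight (k + 1) + k) := by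
  have hle := tsum_acceptWeight_le k
  have hne : ∑' i, acceptWeight k i ≠ ⊤ := ne_top_of_le_ne_top (by simp) hle
  have hm : ∑' i, acceptWeight k i =
      2⁻¹ + (2 * ((k : ℝ≥0∞) + 1))⁻¹ * ∑' i, acceptWeight (k + 1) i := by
    rw [tsum_eq_zero_add' ENNReal.summable, acceptWeight_zero_right, ← ENNReal.tsum_mul_left]
    simp_rw [acceptWeight_succ]
  refine (ENNReal.add_left_inj hne).1 ?_
  rw [restartWeight, tsub_add_cancel_of_le hle, hm]
  calc (1 : ℝ≥0∞) = 2⁻¹ + (2 * ((k : ℝ≥0∞) + 1))⁻¹ * (1 + k) := by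
        rw [ENNReal.mul_inv (by simp) (by simp), mul_assoc, add_comm 1,
          ENNReal.inv_mul_cancel (by simp) (by simp), mul_one, ENNReal.inv_two_add_inv_two]
    _ = 2⁻¹ + (2 * ((k : ℝ≥0∞) + 1))⁻¹ *
        (restartWeight (k + 1) + ∑' i, acceptWeight (k + 1) i + k) := by
        rw [restartWeight, tsub_add_cancel_of_le (tsum_acceptWeight_le _)]
    _ = _ := by ring

/-- The expectation of `F` after the Poisson generator has finished, from a given state. -/
noncomputable def poissonValue (F : ℕ → ℝ≥0∞) : ℕ × ℕ × ℕ → ℝ≥0∞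
  | (_, W, 0) => F W
  | (k, W, u + 1) => (∑' i, acceptWeight k i *
        wsum (poissonWeight (u * 2⁻¹)) fun j => F (W + k + i + j)) +
      restartWeight k * wsum (poissonWeight ((u + 1 : ℕ) * 2⁻¹)) fun j => F (W + j)

theorem poissonWeight_zero (F : ℕ → ℝ≥0∞) : wsum (poissonWeight 0) F = F 0 := by
  have h : eexp 0 = 1 := by
    rw [eexp, tsum_eq_single 0]
    · simp
    · intro n hn; simp [hn]
  rw [wsum, tsum_eq_single 0]
  · simp [poissonWeight, h]
  · intro n hn; simp [poissonWeight, hn]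

/-- From level `0` the acceptance weights are a constant multiple of the Poisson law of mean `1/2`.
A restart leads back to the same expectation, so conditioning on acceptance disappears and the
convolution property merges the current summand with the remaining ones. -/
theorem poissonValue_zero_left (F : ℕ → ℝ≥0∞) (W u : ℕ) :
    poissonValue F (0, W, u) = wsum (poissonWeight (u * 2⁻¹)) fun j => F (W + j) := by
  cases u with
  | zero => simp [poissonValue, poissonWeight_zero]
  | succ u =>
    have h2 : eexp 2⁻¹ ≠ ⊤ := eexp_ne_top (by simp)
    have ha : ∀ i, acceptWeight 0 i = 2⁻¹ * eexp 2⁻¹ * poissonWeight 2⁻¹ i := fun i => by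
      rw [acceptWeight, poissonWeight]
      simp only [Nat.factorial_zero, Nat.cast_one, one_mul, zero_add]
      calc _ = 2⁻¹ * (eexp 2⁻¹ * (eexp 2⁻¹)⁻¹) * ((i.factorial : ℝ≥0∞)⁻¹ * 2⁻¹ ^ i) := by
            rw [ENNReal.mul_inv_cancel (eexp_ne_zero _) h2]; ring
        _ = _ := by ring
    have hs : ∑' i, acceptWeight 0 i = 2⁻¹ * eexp 2⁻¹ := by
      simp_rw [ha]
      rw [ENNReal.tsum_mul_left, tsum_poissonWeight (by simp), mul_one]
    have hle : 2⁻¹ * eexp 2⁻¹ ≤ 1 := hs ▸ tsum_acceptWeight_le 0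
    rw [poissonValue, restartWeight, hs]
    have e : ∑' i, acceptWeight 0 i * wsum (poissonWeight (u * 2⁻¹)) (fun j => F (W + 0 + i + j)) =
        2⁻¹ * eexp 2⁻¹ * wsum (poissonWeight ((u + 1 : ℕ) * 2⁻¹)) fun j => F (W + j) := by
      simp_rw [ha, mul_assoc (2⁻¹ * eexp 2⁻¹)]
      rw [ENNReal.tsum_mul_left]
      congr 1
      have := wsum_poissonWeight_add 2⁻¹ (u * 2⁻¹) fun j => F (W + j)
      rw [show ((u + 1 : ℕ) : ℝ≥0∞) * 2⁻¹ = 2⁻¹ + u * 2⁻¹ by push_cast; ring, ← this]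
      simp only [wsum, add_zero, add_assoc]
    rw [e, ← add_mul, add_tsub_cancel_of_le hle, one_mul]

/-- The exact value function is harmonic for the walk. Expectations after finitely many rounds thus
differ from it only through runs that have not finished. -/
theorem wsum_poissonStep_value (F : ℕ → ℝ≥0∞) (s : ℕ × ℕ × ℕ) :
    wsum (poissonStep s) (poissonValue F) = poissonValue F s := by
  obtain ⟨k, W, u⟩ := s
  cases u with
  | zero => rw [poissonStep, if_neg (by simp), wsum_pure]
  | succ u =>
    set g : ℕ → ℝ≥0∞ := fun m => wsum (poissonWeight (u * 2⁻¹)) fun j => F (W + m + j) with hg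
    have e : ∀ k, ∑' i, acceptWeight k i * wsum (poissonWeight (u * 2⁻¹))
        (fun j => F (W + k + i + j)) = ∑' i, acceptWeight k i * g (k + i) := fun k => by
      simp only [hg, ← add_assoc]
    have hs : ∑' i, acceptWeight k i * g (k + i) = 2⁻¹ * g k + (2 * ((k : ℝ≥0∞) + 1))⁻¹ *
        ∑' i, acceptWeight (k + 1) i * g (k + 1 + i) := by
      rw [tsum_eq_zero_add' ENNReal.summable, acceptWeight_zero_right, ← ENNReal.tsum_mul_left]
      simp_rw [acceptWeight_succ, mul_assoc]
      congr 1
      exact tsum_congr fun i => by rw [show k + (i + 1) = k + 1 + i by ring]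
    rw [wsum_poissonStep, poissonValue_zero_left, poissonValue_zero_left, poissonValue, poissonValue,
      e, e, hs, restartWeight_eq k]
    ring

/-- The Poisson generator outputs a Poisson distributed number, unless it runs out of time. -/
theorem wsum_iter_poissonStep_le {F : ℕ → ℝ≥0∞} (hF : ∀ n, F n ≤ 1) (R : ℕ) (s : ℕ × ℕ × ℕ) :
    wsum (iter (fun _ => poissonStep) R s) (fun s => F s.2.1) ≤
      poissonValue F s + (3 * 4⁻¹) ^ R * if 0 < s.2.2 then 2 ^ s.2.2 else 0 := by
  induction R generalizing s with
  | zero =>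
    obtain ⟨k, W, u⟩ := s
    rw [iter, wsum_pure]
    cases u with
    | zero => simp [poissonValue]
    | succ u =>
      simp only [pow_zero, one_mul, Nat.succ_pos, if_true]
      exact (hF _).trans (le_add_left (one_le_pow₀ (by norm_num)))
  | succ R ih =>
    rw [iter, wsum_bind]
    refine (wsum_mono fun s => ih s).trans ?_
    rw [wsum_add, wsum_poissonStep_value, wsum_mul_left]
    refine add_le_add_right ?_ _
    rw [pow_succ, mul_assoc]
    refine mul_le_mul_right ?_ _
    obtain ⟨k, W, u⟩ := s
    cases u with
    | zero => rw [poissonStep, if_neg (by simp), wsum_pure]; simp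
    | succ u =>
      rw [wsum_poissonStep]
      simp only [Nat.succ_pos, if_true]
      -- With probability `1/2` a summand is completed, and otherwise their number is unchanged. So
      -- the potential `2 ^ u`, for `u` unfinished summands, shrinks in mean by the factor `1/2 ·
      -- 1/2 + 1/2 = 3/4`.
      calc _ ≤ 2⁻¹ * 2 ^ u + (2 * ((k : ℝ≥0∞) + 1))⁻¹ * (2 ^ (u + 1) + k * 2 ^ (u + 1)) := by
            refine add_le_add_left (mul_le_mul_right ?_ _) _
            split_ifs <;> simp
        _ = 2⁻¹ * 2 ^ u + (((k : ℝ≥0∞) + 1)⁻¹ * (k + 1)) * ((2⁻¹ * 2) * 2 ^ u) := by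
            rw [ENNReal.mul_inv (by simp) (by simp), pow_succ]; ring
        _ = (2⁻¹ + 1) * 2 ^ u := by
            rw [ENNReal.inv_mul_cancel (by simp) (by simp),
              ENNReal.inv_mul_cancel (by simp) (by simp)]; ring
        _ = (3 * 4⁻¹ * 2) * 2 ^ u := by
            congr 1
            rw [← ENNReal.toReal_eq_toReal_iff' (by finiteness) (by finiteness),
              ENNReal.toReal_add (by finiteness) (by finiteness)]
            simp
            norm_num
        _ ≤ _ := by rw [pow_succ]; exact le_of_eq (by ring)

/-! ### One combining stage on independent samples -/

/-- This and the next three bounds trade sharp constants for plain exponentials, so that the tail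
estimates below become linear inequalities between exponents. -/
theorem half_pow_le_exp (j : ℕ) : (2⁻¹ : ℝ≥0∞) ^ j ≤ ENNReal.ofReal (Real.exp (-(j / 2))) := by
  have h : (2⁻¹ : ℝ≥0∞) = ENNReal.ofReal 2⁻¹ := by
    rw [ENNReal.ofReal_inv_of_pos two_pos]; simp
  rw [h, ← ENNReal.ofReal_pow (by norm_num)]
  refine ENNReal.ofReal_le_ofReal ?_
  have e : Real.exp (-((j : ℝ) / 2)) = Real.exp (-(1 / 2)) ^ j := by
    rw [← Real.exp_nat_mul]; congr 1; ring
  rw [e]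
  refine pow_le_pow_left₀ (by norm_num) ?_ _
  have := Real.add_one_le_exp (-(1 / 2 : ℝ))
  linarith

theorem two_pow_le_exp (j : ℕ) : (2 : ℝ≥0∞) ^ j ≤ ENNReal.ofReal (Real.exp j) := by
  have h : (2 : ℝ≥0∞) = ENNReal.ofReal 2 := by simp
  rw [h, ← ENNReal.ofReal_pow (by norm_num)]
  refine ENNReal.ofReal_le_ofReal ?_
  rw [← mul_one (j : ℝ), Real.exp_nat_mul]
  refine pow_le_pow_left₀ (by norm_num) ?_ _
  have := Real.add_one_le_exp (1 : ℝ)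
  linarith

theorem one_add_pow_le_exp {p : ℝ} (hp : 0 ≤ p) (n : ℕ) :
    (1 + ENNReal.ofReal p) ^ n ≤ ENNReal.ofReal (Real.exp (n * p)) := by
  rw [← ENNReal.ofReal_one, ← ENNReal.ofReal_add zero_le_one hp, ← ENNReal.ofReal_pow (by positivity),
    Real.exp_nat_mul]
  refine ENNReal.ofReal_le_ofReal (pow_le_pow_left₀ (by positivity) ?_ _)
  have := Real.add_one_le_exp p
  linarith

theorem coin_pow_le_exp {t : ℝ} (h0 : 0 ≤ t) (h1 : t ≤ 1) (n : ℕ) :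
    (ENNReal.ofReal t * 2⁻¹ + (1 - ENNReal.ofReal t)) ^ n ≤
      ENNReal.ofReal (Real.exp (-(n * t / 2))) := by
  have h : (2⁻¹ : ℝ≥0∞) = ENNReal.ofReal 2⁻¹ := by
    rw [ENNReal.ofReal_inv_of_pos two_pos]; simp
  rw [h, ← ENNReal.ofReal_mul h0, ← ENNReal.ofReal_one, ← ENNReal.ofReal_sub _ h0,
    ← ENNReal.ofReal_add (by positivity) (by linarith),
    ← ENNReal.ofReal_pow (add_nonneg (by positivity) (by linarith))]
  refine ENNReal.ofReal_le_ofReal ?_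
  have e : Real.exp (-(n * t / 2)) = Real.exp (-(t / 2)) ^ n := by
    rw [← Real.exp_nat_mul]; congr 1; ring
  rw [e]
  refine pow_le_pow_left₀ (add_nonneg (by positivity) (by linarith)) ?_ _
  have := Real.add_one_le_exp (-(t / 2))
  linarith

section stage

variable {α : Type} {cs : α → ℤ} {av : α → α → α} {q q' : PMF α} {K m A : ℕ}

/-- The three parts of the input of a stage are used independently. -/
theorem psum_stage [Inhabited α] (hA : m / (32 * K) = A) (hK : 0 < K) (F : List α → ℝ≥0∞) :
    psum q m (fun xs => wsum (stage cs av K xs) F) =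
      psum q (16 * A) fun l => wsum (iter (fun _ => poissonStep) (16 * K * A) (0, 0, 2 * K * A))
        fun p => psum (dictLaw cs q (maxMult (l.map cs))) (min p.2.1 (4 * K * A)) fun dict =>
          wsum (mainLoop cs av K q dict A ([], [])) fun s => F s.2 := by
  have h1 : 32 * K * A ≤ m := by rw [← hA]; exact Nat.mul_div_le _ _
  have h2 : A ≤ K * A := Nat.le_mul_of_pos_left _ hK
  obtain ⟨r, hr⟩ : ∃ r, m = 16 * A + (4 * K * A + (A + r)) := by
    refine ⟨m - (16 * A + (4 * K * A + A)), ?_⟩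
    have : 16 * A + (4 * K * A + A) ≤ 32 * K * A := by nlinarith
    omega
  have h3 : psum q m (fun xs => wsum (stage cs av K xs) F) = psum q m (fun xs =>
      wsum (iter (fun _ => poissonStep) (16 * K * A) (0, 0, 2 * K * A)) fun p =>
        wsum (iter (fun j l => dictStep cs (maxMult ((xs.take (16 * A)).map cs))
          (xs.getD (16 * A + j) default) l) (min p.2.1 (4 * K * A)) []) fun dict =>
        wsum (iter (fun j s => mainStep cs av K dict
          (xs.getD (16 * A + 4 * K * A + j) default) s) A ([], [])) fun s => F s.2) := by
    refine psum_congr fun xs hxs => ?_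
    simp only [stage]
    rw [hxs, hA, wsum_bind]
    simp_rw [wsum_bind, wsum_map]
  rw [h3, hr, psum_append]
  refine psum_congr fun l₁ hl₁ => ?_
  rw [psum_append]
  have h4 : (psum q (4 * K * A) fun l₂ => psum q (A + r) fun l₃ =>
      wsum (iter (fun _ => poissonStep) (16 * K * A) (0, 0, 2 * K * A)) fun p =>
        wsum (iter (fun j l => dictStep cs (maxMult (((l₁ ++ (l₂ ++ l₃)).take (16 * A)).map cs))
          ((l₁ ++ (l₂ ++ l₃)).getD (16 * A + j) default) l) (min p.2.1 (4 * K * A)) []) fun dict =>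
        wsum (iter (fun j s => mainStep cs av K dict
          ((l₁ ++ (l₂ ++ l₃)).getD (16 * A + 4 * K * A + j) default) s) A ([], []))
          fun s => F s.2) =
      psum q (4 * K * A) fun l₂ => psum q (A + r) fun l₃ =>
      wsum (iter (fun _ => poissonStep) (16 * K * A) (0, 0, 2 * K * A)) fun p =>
        wsum (iter (fun j l => dictStep cs (maxMult (l₁.map cs)) (l₂.getD j default) l)
          (min p.2.1 (4 * K * A)) []) fun dict =>
        wsum (iter (fun j s => mainStep cs av K dict (l₃.getD j default) s) A ([], []))
          fun s => F s.2 := by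
    refine psum_congr fun l₂ hl₂ => psum_congr fun l₃ hl₃ => wsum_congr fun p => ?_
    rw [List.take_append_of_le_length hl₁.ge, List.take_of_length_le hl₁.le]
    rw [iter_congr (g := fun j l => dictStep cs (maxMult (l₁.map cs)) (l₂.getD j default) l)
      fun j hj => ?_]
    · refine wsum_congr fun dict => ?_
      rw [iter_congr fun j hj => ?_]
      funext s
      rw [List.getD_append_right _ _ _ _ (by omega), List.getD_append_right _ _ _ _ (by omega)]
      congr 2
      omega
    · funext s
      rw [List.getD_append_right _ _ _ _ (by omega), List.getD_append _ _ _ _ (by omega)]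
      congr 2
      omega
  rw [h4]
  simp_rw [psum_wsum]
  refine wsum_congr fun p => ?_
  have h5 : ∀ dict, (psum q (A + r) fun l₃ =>
      wsum (iter (fun j s => mainStep cs av K dict (l₃.getD j default) s) A ([], []))
        fun s => F s.2) = wsum (mainLoop cs av K q dict A ([], [])) fun s => F s.2 := fun dict => by
    rw [psum_iter q (fun x s => mainStep cs av K dict x s) default A (A + r) (by omega)]
    rfl
  simp_rw [h5]
  rw [psum_iter q (fun x l => dictStep cs (maxMult (l₁.map cs)) x l) default _ _ (min_le_right _ _),
    wsum_iter_dictStep]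

/-- A stage with a given number `J` of cells per class. -/
theorem wsum_stage_le {F : List α → ℝ≥0∞} (hF : ∀ l, F l ≤ 1) (hK : 0 < K) {J : ℕ} (hJ : 0 < J)
    {p₀ C θ δ : ℝ≥0∞} (hp : ∀ c, classProb cs q c ≤ p₀)
    (hav : ∀ F : α → ℝ≥0∞, wsum q (fun x => wsum q fun y => if cs y = cs x then F (av x y) else 0) =
      C * wsum q' F)
    (hθ : θ = A * (J : ℝ≥0∞)⁻¹) (hθp : θ * p₀ ≤ 1)
    (hδ : 2⁻¹ ^ K * eexp (K * θ * p₀) ≤ δ) (ht : θ * C ≤ 1) (thr : ℕ) :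
    (wsum (iter (fun _ => poissonStep) (16 * K * A) (0, 0, 2 * K * A)) fun p =>
      psum (dictLaw cs q J) (min p.2.1 (4 * K * A)) fun dict =>
          wsum (mainLoop cs av K q dict A ([], [])) fun s => F s.2) ≤
    wsum ((trialCount (θ * C) ht A).map (max thr)) (fun k => psum q' k F) +
      ((3 * 4⁻¹) ^ (16 * K * A) * 2 ^ (2 * K * A) +
        2⁻¹ ^ (4 * K * A) * eexp ((K * A : ℕ) : ℝ≥0∞) +
        (A * δ + A * (2⁻¹ ^ J * (1 + p₀) ^ A)) + 2 ^ thr * (θ * C * 2⁻¹ + (1 - θ * C)) ^ A) := by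
  have hK0 : (K : ℝ≥0∞) ≠ 0 := by exact_mod_cast hK.ne'
  set H : ℕ → ℝ≥0∞ := fun n => psum (dictLaw cs q J) n fun dict =>
    wsum (mainLoop cs av K q dict A ([], [])) fun s => F s.2 with hH
  have hH1 : ∀ n, H n ≤ 1 := fun n =>
    (psum_mono fun l _ => wsum_le_one _ fun s => hF _).trans_eq (psum_const' _ _ _)
  -- First the generator is replaced by an exact Poisson number of mean `K A`, the sum of `2 K A`
  -- variables of mean `1/2`; the price is the probability of running out of rounds.
  have s1 := wsum_iter_poissonStep_le (F := fun W => H (min W (4 * K * A))) (fun n => hH1 _)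
    (16 * K * A) (0, 0, 2 * K * A)
  have eΛ : ((2 * K * A : ℕ) : ℝ≥0∞) * 2⁻¹ = ((K * A : ℕ) : ℝ≥0∞) := by
    push_cast
    calc _ = (K : ℝ≥0∞) * A * (2⁻¹ * 2) := by ring
      _ = _ := by rw [ENNReal.inv_mul_cancel (by simp) (by simp), mul_one]
  rw [poissonValue_zero_left, eΛ] at s1
  -- Removing the cap `4 K A` on the dictionary size costs at most `2^{-4KA} E 2^n`, by Markov's
  -- inequality.
  have s2 : wsum (poissonWeight ((K * A : ℕ) : ℝ≥0∞)) (fun j => H (min (0 + j) (4 * K * A))) ≤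
      wsum (poissonWeight ((K * A : ℕ) : ℝ≥0∞)) H +
        2⁻¹ ^ (4 * K * A) * eexp ((K * A : ℕ) : ℝ≥0∞) := by
    rw [← wsum_poissonWeight_two_pow (ENNReal.natCast_ne_top _), ← wsum_mul_left, ← wsum_add]
    refine wsum_mono fun n => ?_
    rw [zero_add]
    rcases le_total n (4 * K * A) with h | h
    · rw [min_eq_left h]; exact le_self_add
    · refine (hH1 _).trans (le_add_left ?_)
      calc (1 : ℝ≥0∞) = 2⁻¹ ^ (4 * K * A) * 2 ^ (4 * K * A) := by
            rw [← mul_pow, ENNReal.inv_mul_cancel (by simp) (by simp), one_pow]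
        _ ≤ _ := mul_le_mul_right (pow_le_pow_right₀ (by norm_num) h) _
  have hμ : ∑' e, ((K * A : ℕ) : ℝ≥0∞) * dictLaw cs q J e ≠ ⊤ := by
    rw [ENNReal.tsum_mul_left, PMF.tsum_coe, mul_one]; exact ENNReal.natCast_ne_top _
  have s3 : wsum (poissonWeight ((K * A : ℕ) : ℝ≥0∞)) H =
      freshMean cs av K q (fun e => ((K * A : ℕ) : ℝ≥0∞) * dictLaw cs q J e) F A [] [] := by
    rw [← poissonMean_mainLoop cs av K q _ hμ]
    have e : restrict (fun e : (ℤ × ℤ) × α => !visited [] e.1)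
        (fun e => ((K * A : ℕ) : ℝ≥0∞) * dictLaw cs q J e) =
        fun e => ((K * A : ℕ) : ℝ≥0∞) * dictLaw cs q J e := by
      funext e
      have : visited [] e.1 = false := by simp [visited]
      simp [restrict, this]
    rw [e, poissonMean_smul]
    rfl
  have eθ : θ = (K : ℝ≥0∞)⁻¹ * (((K * A : ℕ) : ℝ≥0∞) * (J : ℝ≥0∞)⁻¹) := by
    rw [hθ]
    push_cast
    calc _ = ((K : ℝ≥0∞)⁻¹ * K) * (A * (J : ℝ≥0∞)⁻¹) := by
          rw [ENNReal.inv_mul_cancel hK0 (by simp), one_mul]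
      _ = _ := by ring
  have eθ' : ((K * A : ℕ) : ℝ≥0∞) * (J : ℝ≥0∞)⁻¹ = K * θ := by rw [hθ]; push_cast; ring
  have s4 := freshMean_le (av := av) (δ := δ) hK hJ (ENNReal.natCast_ne_top (K * A)) hp eθ hθp (by rw [eθ']; exact hδ) hF A [] []
  have hθc : ∀ c, θ * classProb cs q c ≤ 1 := fun c => (mul_le_mul_right (hp c) _).trans hθp
  rw [idealMean_eq hav hθc ht F A []] at s4
  have e1 : classPotential cs q [] = 1 := by simp [classPotential, wsum_const]
  rw [e1, mul_one] at s4
  -- Raising a count below `thr` to `thr` costs at most the probability of a shortfall, again by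
  -- Markov's inequality, now applied to `2^{-k}`. This makes the lower bound on the number of
  -- outputs deterministic.
  have s5 : wsum (trialCount (θ * C) ht A) (fun k => psum q' k fun l => F ([] ++ l)) ≤
      wsum ((trialCount (θ * C) ht A).map (max thr)) (fun k => psum q' k F) +
        2 ^ thr * (θ * C * 2⁻¹ + (1 - θ * C)) ^ A := by
    rw [wsum_map, ← wsum_trialCount_half_pow (θ * C) ht, ← wsum_mul_left, ← wsum_add]
    refine wsum_mono fun k => ?_
    simp only [List.nil_append]
    rcases le_total thr k with h | h
    · rw [max_eq_right h]; exact le_self_add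
    · refine ((psum_mono fun l _ => hF l).trans_eq (psum_const' _ _ _)).trans (le_add_left ?_)
      calc (1 : ℝ≥0∞) = 2 ^ k * 2⁻¹ ^ k := by
            rw [← mul_pow, ENNReal.mul_inv_cancel (by simp) (by simp), one_pow]
        _ ≤ _ := mul_le_mul_left (pow_le_pow_right₀ (by norm_num) h) _
  have s6 : (3 * 4⁻¹ : ℝ≥0∞) ^ (16 * K * A) * (if 0 < 2 * K * A then 2 ^ (2 * K * A) else 0) ≤
      (3 * 4⁻¹) ^ (16 * K * A) * 2 ^ (2 * K * A) := by
    refine mul_le_mul_right ?_ _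
    split_ifs <;> simp
  calc _ ≤ _ := s1
    _ ≤ (wsum ((trialCount (θ * C) ht A).map (max thr)) (fun k => psum q' k F) +
          2 ^ thr * (θ * C * 2⁻¹ + (1 - θ * C)) ^ A +
          (A * δ + A * (2⁻¹ ^ J * (1 + p₀) ^ A)) +
          2⁻¹ ^ (4 * K * A) * eexp ((K * A : ℕ) : ℝ≥0∞)) +
          (3 * 4⁻¹) ^ (16 * K * A) * 2 ^ (2 * K * A) := by
        refine add_le_add (s2.trans (add_le_add_left ?_ _)) s6
        rw [s3]
        exact s4.trans (add_le_add_left s5 _)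
    _ = _ := by ring

/-- The error of a stage with `J` cells per class, for `J` in the typical range. -/
theorem stage_error_le {p c : ℝ} (hp : 0 < p) (hc : 0 ≤ c) (hcp : c ≤ p) (hK : 0 < K)
    (hKA : K ≤ A * p) {thr J : ℕ} (hthr : K ≤ thr) (hthr' : 256 * thr * p ≤ A * c)
    (hJ : 4 * (A * p) ≤ J) (hJ' : J ≤ 64 * (A * p)) :
    ((3 * 4⁻¹) ^ (16 * K * A) * 2 ^ (2 * K * A) +
        2⁻¹ ^ (4 * K * A) * eexp ((K * A : ℕ) : ℝ≥0∞) +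
        (A * ENNReal.ofReal (Real.exp (-(K / 4))) +
          A * (2⁻¹ ^ J * (1 + ENNReal.ofReal p) ^ A)) +
        2 ^ thr * (ENNReal.ofReal (A / J * c) * 2⁻¹ + (1 - ENNReal.ofReal (A / J * c))) ^ A) ≤
      ENNReal.ofReal ((2 * A + 3) * Real.exp (-(K / 4))) := by
  have hK' : (1 : ℝ) ≤ K := by exact_mod_cast hK
  have hA0 : (0 : ℝ) ≤ A := by positivity
  have hA1 : (1 : ℝ) ≤ A := by
    rcases Nat.eq_zero_or_pos A with h | h
    · subst h; simp at hKA; linarith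
    · exact_mod_cast h
  have hJ0 : (0 : ℝ) < J := by nlinarith
  have hKK : (K : ℝ) ≤ K * A := by nlinarith
  -- Numerically, `(3/4)^16 · 2^2` is below `e^{-1}`, so the time-out probability is at most
  -- `e^{-KA}`.
  have e1 : (3 * 4⁻¹ : ℝ≥0∞) ^ (16 * K * A) * 2 ^ (2 * K * A) ≤
      ENNReal.ofReal (Real.exp (-(K / 4))) := by
    have h : (3 * 4⁻¹ : ℝ≥0∞) = ENNReal.ofReal (3 / 4) := by
      rw [div_eq_mul_inv, ENNReal.ofReal_mul (by norm_num), ENNReal.ofReal_inv_of_pos (by norm_num)]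
      simp
    have h2 : (2 : ℝ≥0∞) = ENNReal.ofReal 2 := by simp
    rw [h, h2, ← ENNReal.ofReal_pow (by norm_num), ← ENNReal.ofReal_pow (by norm_num),
      ← ENNReal.ofReal_mul (by positivity)]
    refine ENNReal.ofReal_le_ofReal ?_
    rw [mul_assoc 16, mul_assoc 2, pow_mul _ 16, pow_mul _ 2, ← mul_pow]
    have e : Real.exp (-((K * A : ℕ) : ℝ)) = Real.exp (-1) ^ (K * A) := by
      rw [← Real.exp_nat_mul]; congr 1; ring
    calc _ ≤ Real.exp (-1) ^ (K * A) := by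
          refine pow_le_pow_left₀ (by norm_num) (le_trans ?_ Real.exp_neg_one_gt_d9.le) _
          norm_num
      _ ≤ _ := by
          rw [← e]
          refine Real.exp_le_exp.2 ?_
          push_cast
          linarith
  have e2 : 2⁻¹ ^ (4 * K * A) * eexp ((K * A : ℕ) : ℝ≥0∞) ≤
      ENNReal.ofReal (Real.exp (-(K / 4))) := by
    rw [← ENNReal.ofReal_natCast, eexp_eq_ofReal (by positivity)]
    refine (mul_le_mul_left (half_pow_le_exp _) _).trans ?_
    rw [← ENNReal.ofReal_mul (by positivity), ← Real.exp_add]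
    refine ENNReal.ofReal_le_ofReal (Real.exp_le_exp.2 ?_)
    push_cast
    linarith
  -- The exponent is `-J/2 + A p ≤ -A p ≤ -K`.
  have e3 : 2⁻¹ ^ J * (1 + ENNReal.ofReal p) ^ A ≤ ENNReal.ofReal (Real.exp (-(K / 4))) := by
    refine (mul_le_mul' (half_pow_le_exp _) (one_add_pow_le_exp hp.le _)).trans ?_
    rw [← ENNReal.ofReal_mul (by positivity), ← Real.exp_add]
    refine ENNReal.ofReal_le_ofReal (Real.exp_le_exp.2 ?_)
    linarith
  have e4 : 2 ^ thr * (ENNReal.ofReal (A / J * c) * 2⁻¹ + (1 - ENNReal.ofReal (A / J * c))) ^ A ≤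
      ENNReal.ofReal (Real.exp (-(K / 4))) := by
    have ht : A / J * c ≤ 1 := by
      rw [div_mul_eq_mul_div, div_le_one hJ0]
      nlinarith
    refine (mul_le_mul' (two_pow_le_exp _) (coin_pow_le_exp (by positivity) ht _)).trans ?_
    rw [← ENNReal.ofReal_mul (by positivity), ← Real.exp_add]
    refine ENNReal.ofReal_le_ofReal (Real.exp_le_exp.2 ?_)
    -- The mean number of outputs `A² c / J` is at least `A c / (64 p)`, hence at least `4 thr`.
    -- This leaves the exponent `thr - 2 thr ≤ -K`.
    have h5 : 4 * (thr : ℝ) ≤ A * (A / J * c) := by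
      rw [show (A : ℝ) * (A / J * c) = A * (A * c) / J by ring, le_div_iff₀ hJ0]
      have : A * (256 * thr * p) ≤ A * (A * c) := mul_le_mul_of_nonneg_left hthr' hA0
      have : (thr : ℝ) * J ≤ thr * (64 * (A * p)) := mul_le_mul_of_nonneg_left hJ' (by positivity)
      nlinarith
    have : (K : ℝ) ≤ thr := by exact_mod_cast hthr
    linarith
  calc _ ≤ ENNReal.ofReal (Real.exp (-(K / 4))) + ENNReal.ofReal (Real.exp (-(K / 4))) +
        (A * ENNReal.ofReal (Real.exp (-(K / 4))) + A * ENNReal.ofReal (Real.exp (-(K / 4)))) +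
        ENNReal.ofReal (Real.exp (-(K / 4))) :=
        add_le_add (add_le_add (add_le_add e1 e2) (add_le_add_right (mul_le_mul_right e3 _) _)) e4
    _ = _ := by
        rw [ENNReal.ofReal_mul (by positivity), ENNReal.ofReal_add (by positivity) (by norm_num),
          ENNReal.ofReal_mul (by norm_num), ENNReal.ofReal_natCast]
        simp
        ring

/-- The output of a stage is close to a random number of independent samples. -/
theorem stage_close [Inhabited α] {p c : ℝ} (hA : m / (32 * K) = A) (hK : 0 < K) (hp0 : 0 < p)
    (hc : 0 ≤ c) (hp : ∀ z, classProb cs q z ≤ ENNReal.ofReal p) {z₀ : ℤ}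
    (hz : classProb cs q z₀ = ENNReal.ofReal p)
    (hav : ∀ F : α → ℝ≥0∞, wsum q (fun x => wsum q fun y => if cs y = cs x then F (av x y) else 0) =
      ENNReal.ofReal c * wsum q' F)
    (hKA : K ≤ A * p) {thr : ℕ} (hthr : K ≤ thr) (hthr' : 256 * thr * p ≤ A * c) :
    ∃ ω : PMF ℕ, (∀ k ∈ ω.support, thr ≤ k ∧ k ≤ A) ∧
      Close ((iidList q m).bind (stage cs av K)) (ω.bind (iidList q'))
        (ENNReal.ofReal (2 * m * Real.exp (-(K / 4)))) := by
  have hK' : (1 : ℝ) ≤ K := by exact_mod_cast hK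
  have hA1 : (1 : ℝ) ≤ A := by
    rcases Nat.eq_zero_or_pos A with h | h
    · subst h; simp at hKA; linarith
    · exact_mod_cast h
  have hAm : (32 : ℝ) * A ≤ m := by
    have h1 : 32 * K * A ≤ m := by rw [← hA]; exact Nat.mul_div_le _ _
    have : 32 * A ≤ m := by nlinarith
    exact_mod_cast this
  have hp1 : p ≤ 1 := by
    rw [← ENNReal.ofReal_le_one, ← hz]; exact classProb_le_one _ _ _
  -- Taking the constant function `1` in `hav` shows that `c` is the probability that two samples
  -- share a class, that is, the mean of `classProb` over a sample.
  have hcp : c ≤ p := by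
    rw [← ENNReal.ofReal_le_ofReal_iff hp0.le]
    have h := hav fun _ => 1
    rw [wsum_const, mul_one] at h
    rw [← h, ← wsum_const q (ENNReal.ofReal p)]
    exact wsum_mono fun x => hp _
  have hthrA : thr ≤ A := by
    have : (256 : ℝ) * thr * p ≤ A * p := hthr'.trans (mul_le_mul_of_nonneg_left hcp (by positivity))
    have : (256 : ℝ) * thr ≤ A := le_of_mul_le_mul_right this hp0
    have : (thr : ℝ) ≤ A := by linarith [(Nat.cast_nonneg thr : (0 : ℝ) ≤ thr)]
    exact_mod_cast this
  set a := (A : ℝ) * p with ha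
  -- The test segment has `16 A` samples, so the most likely class occurs about `16 a` times; the
  -- window leaves a factor `4` on each side.
  let Good : ℕ → Prop := fun J => 4 * a ≤ J ∧ J ≤ 64 * a
  have hJ0 : ∀ J, Good J → 0 < J := fun J h => by
    have : (0 : ℝ) < J := by linarith [h.1]
    exact_mod_cast this
  have hθ : ∀ J, Good J → (A : ℝ≥0∞) * (J : ℝ≥0∞)⁻¹ = ENNReal.ofReal (A / J) := fun J h => by
    have : (0 : ℝ) < J := by exact_mod_cast hJ0 J h
    rw [ENNReal.ofReal_div_of_pos this, ENNReal.ofReal_natCast, ENNReal.ofReal_natCast,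
      div_eq_mul_inv]
  have ht : ∀ J, Good J → (A : ℝ≥0∞) * (J : ℝ≥0∞)⁻¹ * ENNReal.ofReal c ≤ 1 := fun J h => by
    have : (0 : ℝ) < J := by exact_mod_cast hJ0 J h
    rw [hθ J h, ← ENNReal.ofReal_mul (by positivity), ENNReal.ofReal_le_one, div_mul_eq_mul_div,
      div_le_one this]
    have := h.1
    nlinarith
  classical
  -- For `J` outside the window any law on `[thr, A]` would do, since the probability of such `J` is
  -- charged separately by the two indicators in `hb`. The random output size is then a mixture over
  -- the observed `J`.
  let ω' : ℕ → PMF ℕ := fun J => if h : Good J then (trialCount _ (ht J h) A).map (max thr)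
    else PMF.pure thr
  refine ⟨(iidList q (16 * A)).bind fun l => ω' (maxMult (l.map cs)), fun k hk => ?_, fun F hF => ?_⟩
  · rw [PMF.mem_support_bind_iff] at hk
    obtain ⟨l, _, hk⟩ := hk
    simp only [ω'] at hk
    split_ifs at hk with h
    · rw [PMF.mem_support_map_iff] at hk
      obtain ⟨k', hk', rfl⟩ := hk
      have := trialCount_le _ _ _ k' hk'
      omega
    · rw [PMF.mem_support_pure_iff] at hk
      omega
  · set e := Real.exp (-((K : ℝ) / 4)) with he
    have hb : ∀ J : ℕ, (wsum (iter (fun _ => poissonStep) (16 * K * A) (0, 0, 2 * K * A)) fun p =>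
        psum (dictLaw cs q J) (min p.2.1 (4 * K * A)) fun dict =>
          wsum (mainLoop cs av K q dict A ([], [])) fun s => F s.2) ≤
        wsum (ω' J) (fun k => psum q' k F) + ENNReal.ofReal ((2 * A + 3) * e) +
        ((if J < ⌈4 * a⌉₊ then 1 else 0) + (if ⌊64 * a⌋₊ + 1 ≤ J then 1 else 0)) := by
      intro J
      by_cases h : Good J
      · refine le_trans ?_ le_self_add
        have hJ := hJ0 J h
        have hJr : (0 : ℝ) < J := by exact_mod_cast hJ
        simp only [ω', dif_pos h]
        have h1 := wsum_stage_le (A := A) (av := av) (q' := q') hF hK hJ hp hav rfl (by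
          rw [hθ J h, ← ENNReal.ofReal_mul (by positivity), ENNReal.ofReal_le_one,
            div_mul_eq_mul_div, div_le_one hJr]
          linarith [h.1]) (δ := ENNReal.ofReal e) (by
          rw [hθ J h, ← ENNReal.ofReal_natCast, ← ENNReal.ofReal_mul (by positivity),
            ← ENNReal.ofReal_mul (by positivity), eexp_eq_ofReal (by positivity)]
          refine (mul_le_mul_left (half_pow_le_exp _) _).trans ?_
          rw [← ENNReal.ofReal_mul (by positivity), ← Real.exp_add, he]
          refine ENNReal.ofReal_le_ofReal (Real.exp_le_exp.2 ?_)
          have : (K : ℝ) * (A / J) * p ≤ K / 4 := by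
            rw [show (K : ℝ) * (A / J) * p = K * a / J by rw [ha]; ring, div_le_iff₀ hJr]
            have := h.1
            nlinarith
          linarith) (ht J h) thr
        refine h1.trans (add_le_add_right ?_ _)
        rw [hθ J h, ← ENNReal.ofReal_mul (by positivity)]
        exact stage_error_le hp0 hc hcp hK hKA hthr hthr' h.1 h.2
      · refine le_trans ((wsum_le_one _ fun s => ?_)) (le_add_left ?_)
        · exact (psum_mono fun l _ => wsum_le_one _ fun s => hF _).trans_eq (psum_const' _ _ _)
        · simp only [Good, not_and_or, not_le] at h
          rcases h with h | h
          · rw [if_pos (Nat.lt_ceil.2 h)]; exact le_self_add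
          · rw [if_pos (c := ⌊64 * a⌋₊ + 1 ≤ J) (Nat.floor_lt (by positivity)|>.2 h)]
            exact le_add_self
    -- The exponent is at most `(4a + 1) - 8a`, the second term being half the expected count `16
    -- a`; as `a ≥ K ≥ 1` this is below `-K/4`.
    have hlow : psum q (16 * A) (fun l => if maxMult (l.map cs) < ⌈4 * a⌉₊ then 1 else 0) ≤
        ENNReal.ofReal e := by
      refine (psum_maxMult_lt z₀ _ _).trans ?_
      rw [hz]
      refine (mul_le_mul' (two_pow_le_exp _) (coin_pow_le_exp hp0.le hp1 _)).trans ?_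
      rw [← ENNReal.ofReal_mul (by positivity), ← Real.exp_add]
      refine ENNReal.ofReal_le_ofReal (Real.exp_le_exp.2 ?_)
      have := (Nat.ceil_lt_add_one (show 0 ≤ 4 * a by positivity)).le
      push_cast
      nlinarith
    -- Here the exponent is at most `-32a + 16a`, and the union bound contributes the prefactor `2 ·
    -- 16 A`.
    have hhigh : psum q (16 * A) (fun l => if ⌊64 * a⌋₊ + 1 ≤ maxMult (l.map cs) then 1 else 0) ≤
        ENNReal.ofReal (32 * A * e) := by
      refine (psum_le_maxMult hp (show 0 < ⌊64 * a⌋₊ + 1 by omega) _).trans ?_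
      have h1 : (2⁻¹ : ℝ≥0∞) ^ (⌊64 * a⌋₊ + 1) * (1 + ENNReal.ofReal p) ^ (16 * A) ≤
          ENNReal.ofReal e := by
        refine (mul_le_mul' (half_pow_le_exp _) (one_add_pow_le_exp hp0.le _)).trans ?_
        rw [← ENNReal.ofReal_mul (by positivity), ← Real.exp_add]
        refine ENNReal.ofReal_le_ofReal (Real.exp_le_exp.2 ?_)
        have := (Nat.lt_floor_add_one (64 * a)).le
        push_cast
        nlinarith
      calc _ = ((32 * A : ℕ) : ℝ≥0∞) * (2⁻¹ ^ (⌊64 * a⌋₊ + 1) *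
            (1 + ENNReal.ofReal p) ^ (16 * A)) := by push_cast; ring
        _ ≤ ((32 * A : ℕ) : ℝ≥0∞) * ENNReal.ofReal e := mul_le_mul_right h1 _
        _ = _ := by
            rw [ENNReal.ofReal_mul (by positivity), ← ENNReal.ofReal_natCast]
            push_cast; rfl
    rw [wsum_bind, wsum_iidList, psum_stage hA hK, wsum_bind, wsum_bind, wsum_iidList]
    refine (psum_mono fun l _ => hb _).trans ?_
    rw [psum_add, psum_add, psum_const', psum_add, add_assoc]
    simp_rw [wsum_iidList]
    refine add_le_add_right ?_ _
    refine (add_le_add_right (add_le_add hlow hhigh) _).trans ?_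
    have he0 : 0 < e := Real.exp_pos _
    rw [← ENNReal.ofReal_add (by positivity) (by positivity),
      ← ENNReal.ofReal_add (by positivity) (by positivity)]
    -- The total prefactor is `(2A + 3) + 1 + 32A = 34A + 4`, which is at most `2m` since `m ≥ 32A`
    -- and `A ≥ 1`.
    refine ENNReal.ofReal_le_ofReal ?_
    nlinarith

end stage

/-! ### Gaussian weights on a lattice in coordinates -/

section lattice

variable {n d : ℕ} {L : Submodule ℤ (EuclideanSpace ℝ (Fin n))} (b : Module.Basis (Fin d) ℤ L)

/-- The lattice vector with given coordinates. -/
noncomputable def latticeVec (x : Fin d → ℤ) : EuclideanSpace ℝ (Fin n) := (b.equivFun.symm x : L)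

theorem latticeVec_add (x y : Fin d → ℤ) :
    latticeVec b (x + y) = latticeVec b x + latticeVec b y := by
  simp only [latticeVec, map_add, Submodule.coe_add]

theorem latticeVec_sub (x y : Fin d → ℤ) :
    latticeVec b (x - y) = latticeVec b x - latticeVec b y := by
  simp only [latticeVec, map_sub, AddSubgroupClass.coe_sub]

/-- The Gaussian weight of a coordinate vector. -/
noncomputable def gaussWeight (s : ℝ) (x : Fin d → ℤ) : ℝ≥0∞ :=
  ENNReal.ofReal (Real.exp (-Real.pi * ‖latticeVec b x‖ ^ 2 / s ^ 2))

/-- Parallelogram law: `‖z + v‖² + ‖z - v‖² = 2 (‖z‖² + ‖v‖²)`, and the factor `2` is absorbed by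
dividing the parameter by `√2`. -/
theorem gaussWeight_add_mul_sub (s : ℝ) (z v : Fin d → ℤ) :
    gaussWeight b s (z + v) * gaussWeight b s (z - v) =
      gaussWeight b (s / Real.sqrt 2) z * gaussWeight b (s / Real.sqrt 2) v := by
  unfold gaussWeight
  rw [← ENNReal.ofReal_mul (by positivity), ← ENNReal.ofReal_mul (by positivity), ← Real.exp_add,
    ← Real.exp_add, latticeVec_add, latticeVec_sub]
  congr 2
  have h := parallelogram_law_with_norm ℝ (latticeVec b z) (latticeVec b v)
  rw [div_pow, Real.sq_sqrt (by norm_num)]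
  have h' : ‖latticeVec b z + latticeVec b v‖ ^ 2 + ‖latticeVec b z - latticeVec b v‖ ^ 2 =
      2 * (‖latticeVec b z‖ ^ 2 + ‖latticeVec b v‖ ^ 2) := by linarith
  rw [← add_div, ← mul_add, h', ← add_div, ← mul_add]
  field_simp

/-- The class of a coordinate vector modulo `2`. -/
def parity (x : Fin d → ℤ) : Fin d → ZMod 2 := fun i => (x i : ZMod 2)

theorem parity_add (x y : Fin d → ℤ) : parity (x + y) = parity x + parity y := by
  funext i; simp [parity]

theorem cosetCode_eq_iff_parity (x y : Fin d → ℤ) :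
    cosetCode x = cosetCode y ↔ parity x = parity y := by
  rw [cosetCode_eq_iff, funext_iff]
  refine forall_congr' fun i => ?_
  exact (ZMod.intCast_eq_intCast_iff' (x i) (y i) 2).symm

theorem parity_sub_eq (z v : Fin d → ℤ) : parity (z - v) = parity (z + v) := by
  funext i
  simp only [parity, Pi.sub_apply, Pi.add_apply]
  push_cast
  have h : ∀ a b : ZMod 2, a - b = a + b := by decide
  exact h _ _

theorem vecAvg_add_sub (z v : Fin d → ℤ) : vecAvg (z + v) (z - v) = z := by
  funext i
  simp only [vecAvg, Pi.add_apply, Pi.sub_apply]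
  omega

/-- The bijection `(z, v) ↦ (z + v, z - v)` onto the pairs of vectors of the same class. -/
theorem tsum_same_parity (G : (Fin d → ℤ) → (Fin d → ℤ) → ℝ≥0∞) :
    ∑' x, ∑' y, (if parity y = parity x then G x y else 0) = ∑' z, ∑' v, G (z + v) (z - v) := by
  rw [← ENNReal.tsum_prod, ← ENNReal.tsum_prod]
  let φ : (Fin d → ℤ) × (Fin d → ℤ) → (Fin d → ℤ) × (Fin d → ℤ) := fun p => (p.1 + p.2, p.1 - p.2)
  have hφ : Function.Injective φ := by
    rintro ⟨z, v⟩ ⟨z', v'⟩ h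
    simp only [φ, Prod.mk.injEq] at h
    obtain ⟨h1, h2⟩ := h
    have e1 : z = z' := by rw [← vecAvg_add_sub z v, h1, h2, vecAvg_add_sub]
    subst e1
    rw [Prod.mk.injEq]
    exact ⟨rfl, add_left_cancel h1⟩
  rw [← hφ.tsum_eq]
  · refine tsum_congr fun p => ?_
    rw [if_pos (parity_sub_eq _ _)]
  · rintro ⟨x, y⟩ h
    simp only [Function.mem_support, ne_eq, ite_eq_right_iff, Classical.not_imp] at h
    -- The preimage is `((x + y)/2, (x - y)/2)`; equal parities make both halves exact.
    refine ⟨(vecAvg x y, vecAvg x (-y)), ?_⟩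
    have hp : ∀ i, x i % 2 = y i % 2 := fun i =>
      (ZMod.intCast_eq_intCast_iff' (x i) (y i) 2).1 (congrFun h.1 i).symm
    simp only [φ, Prod.mk.injEq]
    constructor
    · funext i
      have := hp i
      simp only [vecAvg, Pi.add_apply, Pi.neg_apply]
      omega
    · funext i
      have := hp i
      simp only [vecAvg, Pi.sub_apply, Pi.neg_apply]
      omega

theorem wsum_same_parity (s : ℝ) (F : (Fin d → ℤ) → (Fin d → ℤ) → ℝ≥0∞) :
    wsum (gaussWeight b s) (fun x => wsum (gaussWeight b s) fun y =>
      if parity y = parity x then F x y else 0) =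
    wsum (gaussWeight b (s / Real.sqrt 2)) fun z => wsum (gaussWeight b (s / Real.sqrt 2)) fun v =>
      F (z + v) (z - v) := by
  have h := tsum_same_parity fun x y => gaussWeight b s x * gaussWeight b s y * F x y
  simp only [wsum, ← ENNReal.tsum_mul_left, ← mul_assoc]
  simp_rw [gaussWeight_add_mul_sub] at h
  rw [← h]
  exact tsum_congr fun x => tsum_congr fun y => by split_ifs <;> simp

/-- The total Gaussian weight. -/
noncomputable def gaussTotal (s : ℝ) : ℝ≥0∞ := ∑' x, gaussWeight b s x

/-- The Gaussian weight of a class modulo `2`. -/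
noncomputable def parityWeight (s : ℝ) (c : Fin d → ZMod 2) : ℝ≥0∞ :=
  wsum (gaussWeight b s) fun x => if parity x = c then 1 else 0

theorem wsum_gaussWeight_parity (s : ℝ) (f : (Fin d → ZMod 2) → ℝ≥0∞) :
    wsum (gaussWeight b s) (fun x => f (parity x)) = ∑ c, parityWeight b s c * f c := by
  simp_rw [parityWeight, ← wsum_mul_right]
  rw [← wsum_sum]
  refine wsum_congr fun x => ?_
  simp

theorem sum_parityWeight (s : ℝ) : ∑ c, parityWeight b s c = gaussTotal b s := by
  have := wsum_gaussWeight_parity b s fun _ => 1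
  rw [wsum_one] at this
  simpa [gaussTotal] using this.symm

theorem sum_parityWeight_sq (s : ℝ) :
    ∑ c, parityWeight b s c ^ 2 = gaussTotal b (s / Real.sqrt 2) ^ 2 := by
  have h := wsum_same_parity b s fun _ _ => 1
  have h1 := wsum_gaussWeight_parity b s fun c => parityWeight b s c
  simp only [wsum_one] at h
  have h2 : ∀ μ : (Fin d → ℤ) → ℝ≥0∞, ∀ c, wsum μ (fun _ => c) = (∑' x, μ x) * c := fun μ c =>
    ENNReal.tsum_mul_right
  rw [h2] at h
  rw [pow_two, gaussTotal, ← h]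
  simp_rw [pow_two]
  rw [← h1]
  rfl

/-- Under the change of variables, a pair lying in class `c` becomes a pair whose classes sum to
`c`. So the squared weights at `s` are a self-convolution on `(ℤ/2)^d` of the weights at `s/√2`. -/
theorem parityWeight_sq (s : ℝ) (c : Fin d → ZMod 2) : parityWeight b s c ^ 2 =
    ∑ e, parityWeight b (s / Real.sqrt 2) e * parityWeight b (s / Real.sqrt 2) (c - e) := by
  have h := wsum_same_parity b s fun x y => if parity x = c then 1 else 0
  have h1 : wsum (gaussWeight b s) (fun x => wsum (gaussWeight b s) fun y =>
      if parity y = parity x then if parity x = c then 1 else 0 else 0) = parityWeight b s c ^ 2 := by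
    have : ∀ x y : Fin d → ℤ, (if parity y = parity x then if parity x = c then (1 : ℝ≥0∞) else 0
        else 0) = (if parity y = c then 1 else 0) * if parity x = c then 1 else 0 := by
      intro x y
      by_cases hx : parity x = c
      · simp [hx]
      · simp [hx]
    simp_rw [this, wsum_mul_right, wsum_mul_left]
    rw [pow_two]
    rfl
  rw [← h1, h, ← wsum_gaussWeight_parity b (s / Real.sqrt 2) fun e =>
    parityWeight b (s / Real.sqrt 2) (c - e)]
  refine wsum_congr fun z => wsum_congr fun v => ?_
  rw [parity_add]
  have : parity z + parity v = c ↔ parity v = c - parity z := by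
    rw [eq_sub_iff_add_eq, add_comm]
  simp only [this]

theorem ENNReal.two_mul_mul_le (x y : ℝ≥0∞) : 2 * (x * y) ≤ x ^ 2 + y ^ 2 := by
  rcases eq_or_ne x ⊤ with rfl | hx
  · simp
  rcases eq_or_ne y ⊤ with rfl | hy
  · simp
  lift x to ℝ≥0 using hx
  lift y to ℝ≥0 using hy
  have := two_mul_le_add_sq x y
  rw [mul_assoc] at this
  exact_mod_cast this

theorem gaussTotal_eq [DiscreteTopology L] {s : ℝ} (hs : 0 < s) :
    gaussTotal b s = ENNReal.ofReal (gaussianMass s (L : Set (EuclideanSpace ℝ (Fin n)))) := by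
  rw [gaussianMass, gaussTotal]
  have h := summable_gaussian L hs
  erw [ENNReal.ofReal_tsum_of_nonneg (fun x => by positivity) h]
  exact b.equivFun.symm.toEquiv.tsum_eq fun x : L =>
    ENNReal.ofReal (Real.exp (-Real.pi * ‖(x : EuclideanSpace ℝ (Fin n))‖ ^ 2 / s ^ 2))

theorem gaussTotal_ne_top [DiscreteTopology L] {s : ℝ} (hs : 0 < s) : gaussTotal b s ≠ ⊤ := by
  rw [gaussTotal_eq b hs]; exact ENNReal.ofReal_ne_top

theorem gaussianMass_pos [DiscreteTopology L] {s : ℝ} (hs : 0 < s) :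
    0 < gaussianMass s (L : Set (EuclideanSpace ℝ (Fin n))) := by
  have h := summable_gaussian L hs
  exact h.tsum_pos (fun x => by positivity) 0 (by positivity)

/-- A self-convolution on a group of exponent two is largest at `0`, where it is the sum of squares;
elsewhere `2 R(e) R(c - e) ≤ R(e)² + R(c - e)²` bounds it by the same sum. -/
theorem parityWeight_le_zero (s : ℝ) (c : Fin d → ZMod 2) :
    parityWeight b s c ≤ parityWeight b s 0 := by
  have h : parityWeight b s c ^ 2 ≤ parityWeight b s 0 ^ 2 := by
    rw [parityWeight_sq, parityWeight_sq]
    set R := parityWeight b (s / Real.sqrt 2) with hR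
    have e0 : ∀ e : Fin d → ZMod 2, (0 : Fin d → ZMod 2) - e = e := fun e => by
      funext i
      have : ∀ a : ZMod 2, 0 - a = a := by decide
      exact this _
    simp_rw [e0]
    have h2 : 2 * ∑ e, R e * R (c - e) ≤ 2 * ∑ e, R e * R e := by
      calc 2 * ∑ e, R e * R (c - e) ≤ ∑ e, (R e ^ 2 + R (c - e) ^ 2) := by
            rw [Finset.mul_sum]
            exact Finset.sum_le_sum fun e _ => ENNReal.two_mul_mul_le _ _
        _ = ∑ e, R e ^ 2 + ∑ e, R e ^ 2 := by
            rw [Finset.sum_add_distrib]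
            congr 1
            exact (Equiv.subLeft c).sum_comp fun e => R e ^ 2
        _ = _ := by rw [two_mul]; simp_rw [pow_two]
    exact (ENNReal.mul_le_mul_iff_right (by simp) (by simp)).1 h2
  exact (ENNReal.pow_le_pow_left_iff two_ne_zero).1 h

theorem parityWeight_zero (s : ℝ) : parityWeight b s 0 = gaussTotal b (s / 2) := by
  have hi : Function.Injective fun z : Fin d → ℤ => z + z := by
    intro z z' h
    funext i
    have := congrFun h i
    simp only [Pi.add_apply] at this
    omega
  rw [parityWeight, wsum, ← hi.tsum_eq]
  · refine tsum_congr fun z => ?_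
    have hz : parity (z + z) = 0 := by
      rw [parity_add]
      funext i
      have : ∀ a : ZMod 2, a + a = 0 := by decide
      exact this _
    rw [if_pos hz, mul_one, gaussWeight, gaussWeight, latticeVec_add, ← two_smul ℝ, norm_smul]
    congr 2
    rw [mul_pow, div_pow, Real.norm_ofNat]
    field_simp
  · intro x h
    simp only [Function.mem_support, ne_eq, mul_eq_zero, ite_eq_right_iff, one_ne_zero, imp_false,
      not_or, not_not] at h
    refine ⟨fun i => x i / 2, ?_⟩
    funext i
    have : ((x i : ℤ) : ZMod 2) = ((0 : ℤ) : ZMod 2) := by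
      have := congrFun h.2 i
      simpa [parity] using this
    have := (ZMod.intCast_eq_intCast_iff' (x i) 0 2).1 this
    simp only [Pi.add_apply]
    omega

theorem gaussianMass_two_smul (s : ℝ) :
    gaussianMass s ((fun x => (2 : ℝ) • x) '' (L : Set (EuclideanSpace ℝ (Fin n)))) =
      gaussianMass (s / 2) (L : Set (EuclideanSpace ℝ (Fin n))) := by
  rw [gaussianMass, gaussianMass, tsum_image
    (fun x : EuclideanSpace ℝ (Fin n) => Real.exp (-Real.pi * ‖x‖ ^ 2 / s ^ 2))
    ((smul_right_injective _ (two_ne_zero' ℝ)).injOn)]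
  refine tsum_congr fun x => ?_
  rw [norm_smul, mul_pow, div_pow, Real.norm_ofNat]
  congr 1
  field_simp

/-- The discrete Gaussian distribution in coordinates. -/
noncomputable def gaussCoord [DiscreteTopology L] (s : ℝ) (hs : 0 < s) : PMF (Fin d → ℤ) :=
  (discreteGaussian L s hs).map b.equivFun

theorem wsum_gaussCoord [DiscreteTopology L] {s : ℝ} (hs : 0 < s) (F : (Fin d → ℤ) → ℝ≥0∞) :
    wsum (gaussCoord b s hs) F = (gaussTotal b s)⁻¹ * wsum (gaussWeight b s) F := by
  rw [gaussCoord, wsum_map, wsum, wsum, ← b.equivFun.symm.toEquiv.tsum_eq, ← ENNReal.tsum_mul_left]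
  refine tsum_congr fun x => ?_
  have ht : ∑' x : L, ENNReal.ofReal
      (Real.exp (-Real.pi * ‖(x : EuclideanSpace ℝ (Fin n))‖ ^ 2 / s ^ 2)) = gaussTotal b s :=
    (b.equivFun.symm.toEquiv.tsum_eq fun x : L => ENNReal.ofReal
      (Real.exp (-Real.pi * ‖(x : EuclideanSpace ℝ (Fin n))‖ ^ 2 / s ^ 2))).symm
  rw [discreteGaussian, PMF.normalize_apply, ht]
  simp only [LinearEquiv.coe_toEquiv, LinearEquiv.apply_symm_apply]
  rw [gaussWeight, latticeVec]
  ring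

end lattice

/-! ### Consequences for the discrete Gaussian distribution. -/

section lattice

variable {n d : ℕ} {L : Submodule ℤ (EuclideanSpace ℝ (Fin n))} [DiscreteTopology L]

/-- For a discrete subgroup, independence over `ℤ` and over `ℝ` give the same rank. -/
theorem rank_le_dim (L : Submodule ℤ (EuclideanSpace ℝ (Fin n))) [hL : DiscreteTopology L]
    (b : Module.Basis (Fin d) ℤ L) : d ≤ n := by
  have hs : Submodule.span ℤ (L : Set (EuclideanSpace ℝ (Fin n))) = L := Submodule.span_eq L
  have hd : DiscreteTopology
      (Submodule.span ℤ (L : Set (EuclideanSpace ℝ (Fin n))) : Submodule ℤ _) := by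
    rw [hs]; exact hL
  have h := Real.finrank_eq_int_finrank_of_discrete hd
  have h1 : Set.finrank ℤ (L : Set (EuclideanSpace ℝ (Fin n))) = d := by
    rw [Set.finrank, hs, Module.finrank_eq_card_basis b, Fintype.card_fin]
  rw [← h1, ← h]
  exact (Submodule.finrank_le _).trans_eq (by simp)

/-- Cauchy–Schwarz over the `2 ^ d` classes: the class weights sum to the mass at `s`, and their
squares sum to the squared mass at `s/√2`. -/
theorem gaussianMass_sq_le (b : Module.Basis (Fin d) ℤ L) {s : ℝ} (hs : 0 < s) :
    gaussianMass s (L : Set (EuclideanSpace ℝ (Fin n))) ^ 2 ≤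
      2 ^ d * gaussianMass (s / Real.sqrt 2) (L : Set (EuclideanSpace ℝ (Fin n))) ^ 2 := by
  have hs' : 0 < s / Real.sqrt 2 := by positivity
  have hne : ∀ c, parityWeight b s c ≠ ⊤ := fun c => by
    refine ne_top_of_le_ne_top (gaussTotal_ne_top b hs) ?_
    rw [← sum_parityWeight]
    exact Finset.single_le_sum (f := fun c => parityWeight b s c) (fun _ _ => zero_le)
      (Finset.mem_univ c)
  have e1 := congrArg ENNReal.toReal (sum_parityWeight b s)
  have e2 := congrArg ENNReal.toReal (sum_parityWeight_sq b s)
  rw [ENNReal.toReal_sum fun c _ => hne c, gaussTotal_eq b hs,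
    ENNReal.toReal_ofReal (gaussianMass_pos hs).le] at e1
  rw [ENNReal.toReal_sum fun c _ => by finiteness [hne c], gaussTotal_eq b hs', ENNReal.toReal_pow,
    ENNReal.toReal_ofReal (gaussianMass_pos hs').le] at e2
  rw [← e1, ← e2]
  simp_rw [ENNReal.toReal_pow]
  refine (sq_sum_le_card_mul_sum_sq (s := Finset.univ)
    (f := fun c => (parityWeight b s c).toReal)).trans_eq ?_
  rw [Finset.card_univ]
  simp

theorem gaussianMass_le {s : ℝ} (hs : 0 < s) :
    gaussianMass (s / Real.sqrt 2) (L : Set (EuclideanSpace ℝ (Fin n))) ≤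
      gaussianMass s (L : Set (EuclideanSpace ℝ (Fin n))) := by
  have hs' : 0 < s / Real.sqrt 2 := by positivity
  refine Summable.tsum_le_tsum (fun x => Real.exp_le_exp.2 ?_) (summable_gaussian L hs')
    (summable_gaussian L hs)
  rw [div_pow, Real.sq_sqrt (by norm_num), neg_mul, neg_div, neg_div, neg_le_neg_iff]
  have : 0 ≤ Real.pi * ‖(x : EuclideanSpace ℝ (Fin n))‖ ^ 2 / s ^ 2 := by positivity
  calc _ ≤ 2 * (Real.pi * ‖(x : EuclideanSpace ℝ (Fin n))‖ ^ 2 / s ^ 2) := by linarith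
    _ = _ := by field_simp

/-- After the change of variables the average of the pair is `z` alone. The half-difference `v`
integrates out, so the average has exactly the target law, and the constant is the collision
probability. -/
theorem wsum_gaussCoord_same_class (b : Module.Basis (Fin d) ℤ L) {s : ℝ} (hs : 0 < s) (hs' : 0 < s / Real.sqrt 2)
    (F : (Fin d → ℤ) → ℝ≥0∞) :
    wsum (gaussCoord b s hs) (fun x => wsum (gaussCoord b s hs) fun y =>
      if cosetCode y = cosetCode x then F (vecAvg x y) else 0) =
    ENNReal.ofReal (gaussianMass (s / Real.sqrt 2) (L : Set (EuclideanSpace ℝ (Fin n))) ^ 2 /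
      gaussianMass s (L : Set (EuclideanSpace ℝ (Fin n))) ^ 2) *
      wsum (gaussCoord b (s / Real.sqrt 2) hs') F := by
  simp_rw [wsum_gaussCoord, cosetCode_eq_iff_parity, wsum_mul_left]
  rw [wsum_same_parity b s fun x y => F (vecAvg x y)]
  simp_rw [vecAvg_add_sub]
  have h2 : ∀ μ : (Fin d → ℤ) → ℝ≥0∞, ∀ c, wsum μ (fun _ => c) = (∑' x, μ x) * c := fun μ c =>
    ENNReal.tsum_mul_right
  have h3 : ∑' x, gaussWeight b (s / Real.sqrt 2) x = gaussTotal b (s / Real.sqrt 2) := rfl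
  have hm := gaussianMass_pos (L := L) hs
  have hm' := gaussianMass_pos (L := L) hs'
  simp_rw [h2, h3, wsum_mul_left]
  rw [gaussTotal_eq b hs, gaussTotal_eq b hs', ← mul_assoc, ← mul_assoc, ← mul_assoc,
    ← ENNReal.ofReal_inv_of_pos hm, ← ENNReal.ofReal_inv_of_pos hm', ← ENNReal.ofReal_mul (by positivity),
    ← ENNReal.ofReal_mul (by positivity), ← ENNReal.ofReal_mul (by positivity)]
  congr 2
  field_simp

theorem classProb_gaussCoord (b : Module.Basis (Fin d) ℤ L) {s : ℝ} (hs : 0 < s) (x : Fin d → ℤ) :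
    classProb cosetCode (gaussCoord b s hs) (cosetCode x) =
      (gaussTotal b s)⁻¹ * parityWeight b s (parity x) := by
  rw [classProb, wsum_gaussCoord, parityWeight]
  simp_rw [cosetCode_eq_iff_parity]

theorem classProb_gaussCoord_zero (b : Module.Basis (Fin d) ℤ L) {s : ℝ} (hs : 0 < s) :
    classProb cosetCode (gaussCoord b s hs) (cosetCode (0 : Fin d → ℤ)) =
      ENNReal.ofReal (gaussianMass (s / 2) (L : Set (EuclideanSpace ℝ (Fin n))) /
        gaussianMass s (L : Set (EuclideanSpace ℝ (Fin n)))) := by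
  have h0 : parity (0 : Fin d → ℤ) = 0 := by funext i; simp [parity]
  have hm := gaussianMass_pos (L := L) hs
  rw [classProb_gaussCoord, h0, parityWeight_zero, gaussTotal_eq b hs, gaussTotal_eq b (by positivity),
    ← ENNReal.ofReal_inv_of_pos hm, ← ENNReal.ofReal_mul (by positivity), ← div_eq_inv_mul]

theorem classProb_gaussCoord_le (b : Module.Basis (Fin d) ℤ L) {s : ℝ} (hs : 0 < s) (c : ℤ) :
    classProb cosetCode (gaussCoord b s hs) c ≤
      ENNReal.ofReal (gaussianMass (s / 2) (L : Set (EuclideanSpace ℝ (Fin n))) /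
        gaussianMass s (L : Set (EuclideanSpace ℝ (Fin n)))) := by
  by_cases h : ∃ x : Fin d → ℤ, cosetCode x = c
  · obtain ⟨x, rfl⟩ := h
    rw [← classProb_gaussCoord_zero b hs, classProb_gaussCoord, classProb_gaussCoord]
    refine mul_le_mul_right ?_ _
    have h0 : parity (0 : Fin d → ℤ) = 0 := by funext i; simp [parity]
    rw [h0]
    exact parityWeight_le_zero b s _
  · rw [classProb]
    have : ∀ x : Fin d → ℤ, (if cosetCode x = c then (1 : ℝ≥0∞) else 0) = 0 := fun x =>
      if_neg fun e => h ⟨x, e⟩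
    simp_rw [this, wsum_const]
    exact zero_le

end lattice

/-! ### The sequence of parameters and the accumulated loss. -/

/-- The parameter after `i` stages. -/
noncomputable def stageParam (s : ℝ) (i : ℕ) : ℝ := s / Real.sqrt 2 ^ i

theorem stageParam_pos {s : ℝ} (hs : 0 < s) (i : ℕ) : 0 < stageParam s i := by
  unfold stageParam; positivity

theorem stageParam_succ (s : ℝ) (i : ℕ) : stageParam s (i + 1) = stageParam s i / Real.sqrt 2 := by
  rw [stageParam, stageParam, pow_succ, div_div]

theorem stageParam_add_two (s : ℝ) (i : ℕ) : stageParam s (i + 2) = stageParam s i / 2 := by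
  rw [stageParam_succ, stageParam_succ, div_div, Real.mul_self_sqrt (by norm_num)]

theorem rpow_mul_eq_stageParam (s : ℝ) (i : ℕ) :
    (2 : ℝ) ^ (-(i : ℝ) / 2) * s = stageParam s i := by
  rw [stageParam, Real.sqrt_eq_rpow, ← Real.rpow_natCast, ← Real.rpow_mul (by norm_num),
    div_eq_inv_mul s, ← Real.rpow_neg (by norm_num)]
  congr 2
  ring

section loss

variable {n d : ℕ} (L : Submodule ℤ (EuclideanSpace ℝ (Fin n)))

/-- The Gaussian mass of the lattice after `i` stages. -/
noncomputable def stageMass (s : ℝ) (i : ℕ) : ℝ :=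
  gaussianMass (stageParam s i) (L : Set (EuclideanSpace ℝ (Fin n)))

theorem stageMass_pos [DiscreteTopology L] {s : ℝ} (hs : 0 < s) (i : ℕ) : 0 < stageMass L s i :=
  gaussianMass_pos (stageParam_pos hs i)

theorem stageMass_succ_le [DiscreteTopology L] {s : ℝ} (hs : 0 < s) (i : ℕ) : stageMass L s (i + 1) ≤ stageMass L s i := by
  rw [stageMass, stageMass, stageParam_succ]
  exact gaussianMass_le (stageParam_pos hs i)

theorem lossFactor_eq (s : ℝ) (i : ℕ) : lossFactor L (stageParam s i) =
    stageMass L s (i + 1) ^ 2 / (stageMass L s i * stageMass L s (i + 2)) := by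
  rw [lossFactor, gaussianMass_two_smul, stageMass, stageMass, stageMass, stageParam_succ,
    stageParam_add_two]

/-- With `θ_i` the mass at stage `i`, the factor is `(θ_{i+1}/θ_i) / (θ_{i+2}/θ_{i+1})`, a quotient
of consecutive ratios, because doubling the lattice amounts to two halving steps of the squared
parameter. The product telescopes. -/
theorem prod_lossFactor [DiscreteTopology L] {s : ℝ} (hs : 0 < s) (ℓ : ℕ) :
    ∏ i ∈ Finset.range ℓ, lossFactor L (stageParam s i) =
      stageMass L s 1 / stageMass L s 0 * (stageMass L s ℓ / stageMass L s (ℓ + 1)) := by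
  have hp := stageMass_pos L hs
  induction ℓ with
  | zero =>
    have := hp 0
    have := hp 1
    simp only [Finset.range_zero, Finset.prod_empty]
    field_simp
  | succ ℓ ih =>
    have := hp 0
    have := hp ℓ
    have := hp (ℓ + 1)
    have := hp (ℓ + 2)
    rw [Finset.prod_range_succ, ih, lossFactor_eq]
    field_simp

/-- Square root of the Cauchy–Schwarz bound, with the rank `d` replaced by the dimension `n`. -/
theorem stageMass_ratio_ge [DiscreteTopology L] (b : Module.Basis (Fin d) ℤ L) {s : ℝ} (hs : 0 < s) (i : ℕ) :
    (2 : ℝ) ^ (-(n : ℝ) / 2) ≤ stageMass L s (i + 1) / stageMass L s i := by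
  have h := gaussianMass_sq_le b (stageParam_pos hs i)
  rw [← stageParam_succ] at h
  have hd : (2 : ℝ) ^ d ≤ 2 ^ n := pow_le_pow_right₀ (by norm_num) (rank_le_dim L b)
  have h0 := stageMass_pos L hs i
  have h1 := stageMass_pos L hs (i + 1)
  rw [le_div_iff₀ h0]
  refine (pow_le_pow_iff_left₀ (by positivity) h1.le two_ne_zero).1 ?_
  rw [mul_pow, ← Real.rpow_natCast ((2 : ℝ) ^ (-(n : ℝ) / 2)), ← Real.rpow_mul (by norm_num)]
  have e : (-(n : ℝ) / 2 * (2 : ℕ)) = -n := by push_cast; ring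
  rw [e, Real.rpow_neg (by norm_num), Real.rpow_natCast, inv_mul_le_iff₀ (by positivity)]
  exact h.trans (mul_le_mul_of_nonneg_right hd (by positivity))

theorem prod_lossFactor_ge [DiscreteTopology L] (b : Module.Basis (Fin d) ℤ L) {s : ℝ} (hs : 0 < s) (ℓ : ℕ) :
    (2 : ℝ) ^ (-(n : ℝ) / 2) ≤ ∏ i ∈ Finset.range ℓ, lossFactor L (stageParam s i) := by
  rw [prod_lossFactor L hs]
  have h1 : 1 ≤ stageMass L s ℓ / stageMass L s (ℓ + 1) := by
    rw [one_le_div (stageMass_pos L hs _)]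
    exact stageMass_succ_le L hs ℓ
  exact (stageMass_ratio_ge L b hs 0).trans (le_mul_of_one_le_right
    (div_nonneg (stageMass_pos L hs _).le (stageMass_pos L hs _).le) h1)

end loss

/-! ### Composition of the stages on Gaussian input. -/

section stages

variable {n d : ℕ} {L : Submodule ℤ (EuclideanSpace ℝ (Fin n))} [DiscreteTopology L]

/-- A lower bound for the number of vectors before stage `i`. -/
noncomputable def stageSize (L : Submodule ℤ (EuclideanSpace ℝ (Fin n))) (s κ : ℝ) (ℓ i : ℕ) : ℝ :=
  (32 * κ) ^ (ℓ + 1 - i) * 2 ^ n *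
    (stageMass L s 1 / stageMass L s 0 * (stageMass L s i / stageMass L s (i + 1)))

theorem two_pow_eq_mul (n : ℕ) :
    (2 : ℝ) ^ n * ((2 : ℝ) ^ (-(n : ℝ) / 2) * (2 : ℝ) ^ (-(n : ℝ) / 2)) = 1 := by
  rw [← Real.rpow_natCast, ← Real.rpow_add two_pos, ← Real.rpow_add two_pos]
  ring_nf
  exact Real.rpow_zero 2

/-- Only the first ratio of masses can be small, and it costs `2^{-n/2}` once, however many stages
have been run. -/
theorem stageSize_ge (b : Module.Basis (Fin d) ℤ L) {s κ : ℝ} (hs : 0 < s) (hκ : 2 ≤ κ) {ℓ i : ℕ}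
    (hi : i ≤ ℓ) : 32 * κ * (2 : ℝ) ^ ((n : ℝ) / 2) ≤ stageSize L s κ ℓ i := by
  have h1 := stageMass_ratio_ge L b hs 0
  have h2 : 1 ≤ stageMass L s i / stageMass L s (i + 1) := by
    rw [one_le_div (stageMass_pos L hs _)]
    exact stageMass_succ_le L hs i
  have h3 : 32 * κ ≤ (32 * κ) ^ (ℓ + 1 - i) := le_self_pow₀ (by linarith) (by omega)
  have h4 : (2 : ℝ) ^ ((n : ℝ) / 2) = 2 ^ n * (2 : ℝ) ^ (-(n : ℝ) / 2) := by
    rw [← Real.rpow_natCast, ← Real.rpow_add two_pos]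
    congr 1
    ring
  have h5 : (2 : ℝ) ^ (-(n : ℝ) / 2) ≤
      stageMass L s 1 / stageMass L s 0 * (stageMass L s i / stageMass L s (i + 1)) :=
    h1.trans (le_mul_of_one_le_right
      (div_nonneg (stageMass_pos L hs _).le (stageMass_pos L hs _).le) h2)
  rw [h4, stageSize, ← mul_assoc]
  exact mul_le_mul (mul_le_mul_of_nonneg_right h3 (by positivity)) h5 (by positivity)
    (by positivity)

theorem gaussCoord_congr (b : Module.Basis (Fin d) ℤ L) {s s' : ℝ} (h : s = s') (hs : 0 < s)
    (hs' : 0 < s') : gaussCoord b s hs = gaussCoord b s' hs' := by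
  subst h; rfl

/-- The effect of a stage on discrete Gaussian vectors. -/
theorem stage_gauss_close (b : Module.Basis (Fin d) ℤ L) {s κ : ℝ} (hs : 0 < s) (hκ : 2 ≤ κ)
    {ℓ i K m : ℕ} (hi : i < ℓ) (hK : 0 < K) (hKκ : 512 * (K : ℝ) ≤ κ)
    (hm : stageSize L s κ ℓ i ≤ m) :
    ∃ ω : PMF ℕ, (∀ k ∈ ω.support, stageSize L s κ ℓ (i + 1) ≤ k ∧ k ≤ m) ∧
      Close ((iidList (gaussCoord b (stageParam s i) (stageParam_pos hs i)) m).bind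
          (stage cosetCode vecAvg K))
        (ω.bind (iidList (gaussCoord b (stageParam s (i + 1)) (stageParam_pos hs (i + 1)))))
        (ENNReal.ofReal (2 * m * Real.exp (-(K / 4)))) := by
  have hp := stageMass_pos L hs
  have hK' : (1 : ℝ) ≤ K := by exact_mod_cast hK
  set θ := stageMass L s with hθ
  set p := θ (i + 2) / θ i with hpdef
  set c := θ (i + 1) ^ 2 / θ i ^ 2 with hcdef
  set t₀ := stageSize L s κ ℓ i with ht₀
  set t₁ := stageSize L s κ ℓ (i + 1) with ht₁
  have hp0 : 0 < p := div_pos (hp _) (hp _)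
  have hc0 : 0 ≤ c := by positivity
  have hp1 : p ≤ 1 := by
    rw [hpdef, div_le_one (hp i)]
    exact (stageMass_succ_le L hs (i + 1)).trans (stageMass_succ_le L hs i)
  -- `stageSize` is `(32κ)^{ℓ+1-i} 2^n` times the telescoped product of the first `i` loss factors,
  -- and `c / p` is the loss factor of the current stage. So one stage multiplies it by `c / (32 κ
  -- p)`.
  have e1 : t₀ * c = 32 * κ * t₁ * p := by
    have h0 := hp 0
    have h1 := hp i
    have h2 := hp (i + 1)
    have h3 := hp (i + 2)
    rw [ht₀, ht₁, hcdef, hpdef, stageSize, stageSize, ← hθ,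
      show ℓ + 1 - i = (ℓ + 1 - (i + 1)) + 1 by omega, pow_succ]
    field_simp
  -- After cancellation two ratios of consecutive masses remain, each at least `2^{-n/2}`, which
  -- uses up the factor `2^n`. The exponent `ℓ + 1 - i` is at least `2` because `i < ℓ`.
  have e2 : (32 * κ) ^ 2 ≤ t₀ * p := by
    have h1 := stageMass_ratio_ge L b hs 0
    have h2 := stageMass_ratio_ge L b hs (i + 1)
    have h3 := mul_le_mul h1 h2 (by positivity) (div_nonneg (hp _).le (hp _).le)
    have h4 := mul_le_mul_of_nonneg_left h3 (show (0 : ℝ) ≤ 2 ^ n by positivity)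
    rw [two_pow_eq_mul] at h4
    have h5 : (32 * κ) ^ 2 ≤ (32 * κ) ^ (ℓ + 1 - i) :=
      pow_le_pow_right₀ (by linarith) (by omega)
    have h6 : t₀ * p = (32 * κ) ^ (ℓ + 1 - i) *
        (2 ^ n * (θ (0 + 1) / θ 0 * (θ (i + 1 + 1) / θ (i + 1)))) := by
      have h0 := hp 0
      have h1 := hp i
      have h2 := hp (i + 1)
      rw [ht₀, hpdef, stageSize, ← hθ]
      field_simp
    rw [h6]
    calc (32 * κ) ^ 2 ≤ (32 * κ) ^ (ℓ + 1 - i) * 1 := by rw [mul_one]; exact h5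
      _ ≤ _ := mul_le_mul_of_nonneg_left h4 (by positivity)
  have e3 : 32 * κ ≤ t₁ := by
    refine le_trans ?_ (stageSize_ge b hs hκ (i := i + 1) (by omega))
    exact le_mul_of_one_le_right (by linarith) (Real.one_le_rpow (by norm_num) (by positivity))
  set A := m / (32 * K) with hA
  have hAm : (m : ℝ) ≤ 32 * K * (A + 1) := by
    have := Nat.lt_mul_div_succ m (show 0 < 32 * K by omega)
    exact_mod_cast this.le
  have hmp : (32 * κ) ^ 2 ≤ m * p := e2.trans (mul_le_mul_of_nonneg_right hm hp0.le)
  have hm1 : (32 * κ) ^ 2 ≤ m := hmp.trans (mul_le_of_le_one_right (by positivity) hp1)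
  have hA3 : (3 : ℝ) ≤ A := by
    by_contra hlt
    push Not at hlt
    nlinarith
  -- Rounding in `A` is harmless: `A ≥ 3` gives `A + 1 ≤ 4A/3`.
  have hAm' : 3 * (m : ℝ) ≤ 128 * K * A := by nlinarith
  have hKA : (K : ℝ) ≤ A * p := by
    have h1 : 3 * ((m : ℝ) * p) ≤ 128 * K * (A * p) := by nlinarith
    have h2 : 128 * K * (K : ℝ) ≤ 3 * (32 * κ) ^ 2 := by nlinarith
    have h3 : 128 * (K : ℝ) * K ≤ 128 * K * (A * p) := by linarith
    exact le_of_mul_le_mul_left h3 (by positivity)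
  -- This explains the divisor `512`. From `κ ≥ 512 K` one gets `A c ≥ 384 t₁ p`, and `256 (t₁ + 1)
  -- ≤ 384 t₁` because `t₁ ≥ 2`.
  have hthr' : 256 * (⌈t₁⌉₊ : ℝ) * p ≤ A * c := by
    have h1 : (⌈t₁⌉₊ : ℝ) ≤ t₁ + 1 := (Nat.ceil_lt_add_one (by linarith)).le
    have h2 : 32 * κ * t₁ * p ≤ m * c := by
      rw [← e1]; exact mul_le_mul_of_nonneg_right hm hc0
    have h3 : 3 * ((m : ℝ) * c) ≤ 128 * K * (A * c) := by
      have := mul_le_mul_of_nonneg_right hAm' hc0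
      linarith
    have h4 : 512 * (K : ℝ) * (t₁ * p) ≤ κ * (t₁ * p) :=
      mul_le_mul_of_nonneg_right hKκ (mul_nonneg (by linarith) hp0.le)
    have h5 : 128 * K * (384 * (t₁ * p)) ≤ 128 * K * (A * c) := by linarith
    have h6 := le_of_mul_le_mul_left h5 (by positivity)
    have h7 : 256 * (⌈t₁⌉₊ : ℝ) * p ≤ 256 * (t₁ + 1) * p :=
      mul_le_mul_of_nonneg_right (by linarith) hp0.le
    have h8 : 2 * p ≤ t₁ * p := mul_le_mul_of_nonneg_right (by linarith) hp0.le
    linarith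
  have hthr : K ≤ ⌈t₁⌉₊ := by
    have : (K : ℝ) ≤ ⌈t₁⌉₊ := (show (K : ℝ) ≤ t₁ by linarith).trans (Nat.le_ceil _)
    exact_mod_cast this
  have hpos := stageParam_pos hs i
  have epar : stageParam s i / 2 = stageParam s (i + 2) := (stageParam_add_two s i).symm
  have epar' : stageParam s i / Real.sqrt 2 = stageParam s (i + 1) := (stageParam_succ s i).symm
  obtain ⟨ω, hω, hcl⟩ := stage_close (cs := cosetCode) (av := vecAvg)
    (q := gaussCoord b (stageParam s i) hpos)
    (q' := gaussCoord b (stageParam s (i + 1)) (stageParam_pos hs (i + 1)))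
    (m := m) (p := p) (c := c) hA.symm hK hp0 hc0
    (fun z => by
      have := classProb_gaussCoord_le b hpos z
      rwa [epar] at this)
    (z₀ := cosetCode (0 : Fin d → ℤ)) (by
      have := classProb_gaussCoord_zero b hpos
      rwa [epar] at this)
    (fun F => by
      have := wsum_gaussCoord_same_class b hpos (by rw [epar']; exact stageParam_pos hs _) F
      rw [this, gaussCoord_congr b epar' _ (stageParam_pos hs _), epar']
      rfl)
    hKA hthr hthr'
  refine ⟨ω, fun k hk => ⟨?_, (hω k hk).2.trans (Nat.div_le_self _ _)⟩, hcl⟩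
  exact (Nat.le_ceil _).trans (by exact_mod_cast (hω k hk).1)

/-- The effect of all stages on discrete Gaussian vectors. -/
theorem stages_gauss_close (b : Module.Basis (Fin d) ℤ L) {s κ : ℝ} (hs : 0 < s) (hκ : 2 ≤ κ)
    {ℓ K M : ℕ} (hK : 0 < ℓ → 0 < K ∧ 512 * (K : ℝ) ≤ κ) (r i : ℕ) (hi : i + r = ℓ) (ω : PMF ℕ)
    (hω : ∀ k ∈ ω.support, stageSize L s κ ℓ i ≤ k ∧ k ≤ M) :
    ∃ ω' : PMF ℕ, (∀ k ∈ ω'.support, stageSize L s κ ℓ ℓ ≤ k ∧ k ≤ M) ∧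
      Close ((ω.bind (iidList (gaussCoord b (stageParam s i) (stageParam_pos hs i)))).bind
          (iter (fun _ => stage cosetCode vecAvg K) r))
        (ω'.bind (iidList (gaussCoord b (stageParam s ℓ) (stageParam_pos hs ℓ))))
        (ENNReal.ofReal (r * (2 * M * Real.exp (-(K / 4))))) := by
  induction r generalizing i ω with
  | zero =>
    obtain rfl : i = ℓ := by omega
    refine ⟨ω, hω, ?_⟩
    have : iter (fun _ => stage cosetCode (vecAvg (d := d)) K) 0 = PMF.pure := by
      funext s; rfl
    rw [this, PMF.bind_pure]
    exact (Close.refl _).mono (by simp)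
  | succ r ih =>
    obtain ⟨hK0, hKκ⟩ := hK (by omega)
    -- The output size law depends on the input size `k`; outside the support of `ω` an arbitrary
    -- law is chosen.
    have hk : ∀ k, ∃ ωk : PMF ℕ, k ∈ ω.support →
        (∀ k' ∈ ωk.support, stageSize L s κ ℓ (i + 1) ≤ k' ∧ k' ≤ k) ∧
        Close ((iidList (gaussCoord b (stageParam s i) (stageParam_pos hs i)) k).bind
          (stage cosetCode vecAvg K))
        (ωk.bind (iidList (gaussCoord b (stageParam s (i + 1)) (stageParam_pos hs (i + 1)))))
        (ENNReal.ofReal (2 * k * Real.exp (-(K / 4)))) := fun k => by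
      by_cases h : k ∈ ω.support
      · obtain ⟨ωk, h1⟩ := stage_gauss_close b hs hκ (by omega) hK0 hKκ (hω k h).1
        exact ⟨ωk, fun _ => h1⟩
      · exact ⟨PMF.pure 0, fun h' => absurd h' h⟩
    choose W hW using hk
    obtain ⟨ω', hω', hcl⟩ := ih (i + 1) (by omega) (ω.bind W) fun k' hk' => by
      rw [PMF.mem_support_bind_iff] at hk'
      obtain ⟨k, hk, hk'⟩ := hk'
      have := (hW k hk).1 k' hk'
      exact ⟨this.1, this.2.trans (hω k hk).2⟩
    refine ⟨ω', hω', ?_⟩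
    have e : (ω.bind (iidList (gaussCoord b (stageParam s i) (stageParam_pos hs i)))).bind
        (iter (fun _ => stage cosetCode vecAvg K) (r + 1)) =
        (ω.bind fun k => (iidList (gaussCoord b (stageParam s i) (stageParam_pos hs i)) k).bind
          (stage cosetCode vecAvg K)).bind (iter (fun _ => stage cosetCode vecAvg K) r) := by
      rw [PMF.bind_bind, PMF.bind_bind]
      refine congrArg ω.bind (funext fun k => ?_)
      rw [PMF.bind_bind]
      rfl
    have h1 : Close (ω.bind fun k =>
        (iidList (gaussCoord b (stageParam s i) (stageParam_pos hs i)) k).bind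
          (stage cosetCode vecAvg K))
        ((ω.bind W).bind (iidList (gaussCoord b (stageParam s (i + 1)) (stageParam_pos hs (i + 1)))))
        (ENNReal.ofReal (2 * M * Real.exp (-(K / 4)))) := by
      rw [PMF.bind_bind]
      -- Sizes never increase, so the error of each stage is at most that for the initial size `M`.
      refine Close.bind_right _ fun k hk => ((hW k hk).2).mono (ENNReal.ofReal_le_ofReal ?_)
      have : (k : ℝ) ≤ M := by exact_mod_cast (hω k hk).2
      gcongr
    rw [e]
    refine ((h1.bind_left _).trans hcl).mono ?_
    rw [← ENNReal.ofReal_add (by positivity) (by positivity)]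
    refine ENNReal.ofReal_le_ofReal (le_of_eq ?_)
    push_cast
    ring

end stages

/-! ### Input memory, word length and reading the output. -/

section input

variable {n d : ℕ} {L : Submodule ℤ (EuclideanSpace ℝ (Fin n))}

/-- The coordinate vectors in array `1`, their number being in register `4`. -/
def outputCoords (d : ℕ) (σ : Memory) : List (Fin d → ℤ) :=
  (List.range (σ.reg 4).toNat).map fun (j : ℕ) (i : Fin d) => σ.arr 1 ((j : ℤ) * d + (i : ℕ))

theorem outputCoords_eq {σ : Memory} {ys : List (Fin d → ℤ)} (h : σ.reg 4 = ys.length)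
    (hv : ∀ j (h : j < ys.length), VecAt σ j ys[j]) : outputCoords d σ = ys := by
  refine List.ext_getElem (by simp [outputCoords, h]) fun j h1 h2 => ?_
  simp only [outputCoords, List.getElem_map, List.getElem_range]
  exact funext fun i => hv j h2 i

theorem pow_five_le_two_pow {M B : ℕ} (h : 64 ≤ M) : M ^ 5 ≤ 2 ^ (8 * (Nat.log 2 M + B)) := by
  have h1 : M < 2 ^ (Nat.log 2 M + 1) := Nat.lt_pow_succ_log_self (by norm_num) M
  have h2 : 6 ≤ Nat.log 2 M := by
    exact Nat.le_log_of_pow_le (by norm_num) h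
  calc M ^ 5 ≤ (2 ^ (Nat.log 2 M + 1)) ^ 5 := Nat.pow_le_pow_left h1.le 5
    _ = 2 ^ ((Nat.log 2 M + 1) * 5) := (pow_mul _ _ _).symm
    _ ≤ _ := Nat.pow_le_pow_right (by norm_num) (by omega)

/-- The largest addresses are those of dictionary slots: about `ℓ · 2^d · M` cells, a cubic
expression in `M`, times `K`. So `M^5` is ample, and `8 (log M + B)` bits suffice. -/
theorem bounds_of_le {M k ℓ B : ℕ} (h64 : 64 ≤ M) (hd : 2 ^ d ≤ M) (hk : k ≤ M) (hℓ : ℓ ≤ M) :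
    Bounds d (8 * (Nat.log 2 M + B)) B M (2 ^ d) (k / 512) (ℓ * (2 ^ d * (M + 1)) + M + 2 ^ d) := by
  have h5 := pow_five_le_two_pow (B := B) h64
  have hdM : d < M := d.lt_two_pow_self.trans_le hd
  have h2 : 6 ≤ Nat.log 2 M := by
    exact Nat.le_log_of_pow_le (by norm_num) h64
  refine ⟨rfl, ?_, ?_, ?_, ?_, by omega, Nat.le_add_left _ _⟩
  · rw [← pow_succ']
    exact Nat.pow_le_pow_right (by norm_num) (by omega)
  · refine le_trans ?_ h5
    calc (M + 2) * (d + 4) ≤ (2 * M) * (2 * M) := Nat.mul_le_mul (by omega) (by omega)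
      _ = 4 * M ^ 2 := by ring
      _ ≤ M ^ 3 * M ^ 2 := Nat.mul_le_mul_right _ (by nlinarith [Nat.pow_le_pow_left h64 3])
      _ = M ^ 5 := by ring
  · refine le_trans ?_ h5
    have h6 : ℓ * (2 ^ d * (M + 1)) ≤ M * (M * (2 * M)) :=
      Nat.mul_le_mul hℓ (Nat.mul_le_mul hd (by omega))
    have h7 : M ≤ M ^ 3 := Nat.le_self_pow (by norm_num) M
    have h8 : ℓ * (2 ^ d * (M + 1)) + M + 2 ^ d + 2 ≤ 5 * M ^ 3 := by
      have : M * (M * (2 * M)) = 2 * M ^ 3 := by ring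
      omega
    calc _ ≤ (5 * M ^ 3) * M := Nat.mul_le_mul h8 (by omega)
      _ ≤ (M * M ^ 3) * M := Nat.mul_le_mul_right _ (Nat.mul_le_mul_right _ (by omega))
      _ = M ^ 5 := by ring
  · exact (Nat.le_add_left _ _).trans (Nat.le_add_right _ _)

theorem inputMemory_arr_zero (b : Module.Basis (Fin d) ℤ L) {M : ℕ} (ℓ k : ℕ) (x : Fin M → L)
    (j : Fin M) (i : Fin d) :
    (inputMemory b ℓ k x).arr 0 (((j : ℕ) * d + (i : ℕ) : ℕ) : ℤ) = b.equivFun (x j) i := by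
  have hlt : (j : ℕ) * d + (i : ℕ) < M * d := by
    have := (finProdFinEquiv (j, i)).isLt
    rw [finProdFinEquiv_apply_val] at this
    simp only at this
    linarith [mul_comm d (j : ℕ)]
  have e : finProdFinEquiv.symm (⟨(j : ℕ) * d + (i : ℕ), hlt⟩ : Fin (M * d)) = (j, i) := by
    rw [Equiv.symm_apply_eq]
    ext
    rw [finProdFinEquiv_apply_val]
    simp only
    ring
  have h : (0 : ℕ) = 0 ∧ (0 : ℤ) ≤ (((j : ℕ) * d + (i : ℕ) : ℕ) : ℤ) ∧
      ((((j : ℕ) * d + (i : ℕ) : ℕ) : ℤ)).toNat < M * d :=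
    ⟨rfl, Int.natCast_nonneg _, by rw [Int.toNat_natCast]; exact hlt⟩
  refine (dif_pos h).trans ?_
  simp only [Int.toNat_natCast, e]
  rfl

theorem abs_inputMemory_arr_lt (b : Module.Basis (Fin d) ℤ L) {M B : ℕ} (ℓ k : ℕ) (x : Fin M → L)
    (hB : ∀ j i, |b.repr (x j) i| < 2 ^ B) (a : ℕ) (i : ℤ) :
    |(inputMemory b ℓ k x).arr a i| < 2 ^ B := by
  simp only [inputMemory]
  split_ifs with h
  · exact hB _ _
  · rw [abs_zero]; positivity

theorem exists_abs_repr_lt (b : Module.Basis (Fin d) ℤ L) {M : ℕ} (x : Fin M → L) :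
    ∃ B : ℕ, ∀ j i, |b.repr (x j) i| < 2 ^ B := by
  refine ⟨∑ j, ∑ i, (b.repr (x j) i).natAbs, fun j i => ?_⟩
  have h : (b.repr (x j) i).natAbs ≤ ∑ j, ∑ i, (b.repr (x j) i).natAbs :=
    (Finset.single_le_sum (f := fun i => (b.repr (x j) i).natAbs) (fun _ _ => Nat.zero_le _)
      (Finset.mem_univ i)).trans
    (Finset.single_le_sum (f := fun j => ∑ i, (b.repr (x j) i).natAbs)
      (fun _ _ => Nat.zero_le _) (Finset.mem_univ j))
  have h' := h.trans_lt (Nat.lt_two_pow_self (n := ∑ j, ∑ i, (b.repr (x j) i).natAbs))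
  rw [Int.abs_eq_natAbs]
  exact_mod_cast h'

/-- The sampler on the prescribed input. -/
theorem samplerProg_ev (b : Module.Basis (Fin d) ℤ L) {M k ℓ B : ℕ} (h64 : 64 ≤ M)
    (hn : 2 ^ n ≤ M) (hdn : d ≤ n) (hk : k ≤ M) (hℓ : ℓ ≤ M) (x : Fin M → L)
    (hB : ∀ j i, |b.repr (x j) i| < 2 ^ B) :
    Ev (Memory.Bdd (8 * (Nat.log 2 M + B))) (outputCoords d)
      ([samplerProg], inputMemory b ℓ k x) (max 1 ℓ * M * (2000 * (d + 1)))
      (iter (fun _ => stage cosetCode vecAvg (k / 512)) ℓ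
        (List.ofFn fun j => b.equivFun (x j))) := by
  have hd : 2 ^ d ≤ M := (Nat.pow_le_pow_right (by norm_num) hdn).trans hn
  have hdM : d < M := d.lt_two_pow_self.trans_le hd
  have hnM : n < M := n.lt_two_pow_self.trans_le hn
  have h5 := pow_five_le_two_pow (B := B) h64
  have h2 : 2 * M ^ 2 < M ^ 5 :=
    calc 2 * M ^ 2 < M ^ 3 * M ^ 2 :=
          Nat.mul_lt_mul_of_pos_right (by nlinarith [Nat.pow_le_pow_left h64 3]) (by positivity)
      _ = M ^ 5 := by ring
  have hMw : M < 2 ^ (8 * (Nat.log 2 M + B)) := by nlinarith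
  have hN : 2 ^ d * (M + 1) < 2 ^ (8 * (Nat.log 2 M + B)) := by nlinarith
  have hreg : ∀ v : ℕ, v ≤ M → |(v : ℤ)| < 2 ^ (8 * (Nat.log 2 M + B)) := fun v hv => by
    rw [abs_of_nonneg (Int.natCast_nonneg v)]
    exact_mod_cast hv.trans_lt hMw
  have hbdd : Memory.Bdd (8 * (Nat.log 2 M + B)) (inputMemory b ℓ k x) := by
    refine ⟨fun r => ?_, fun a i => (abs_inputMemory_arr_lt b ℓ k x hB a i).trans_le
      (pow_le_pow_right₀ (by norm_num) (by omega))⟩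
    simp only [inputMemory]
    split
    · exact hreg _ hnM.le
    · exact hreg _ hdM.le
    · exact hreg _ hℓ
    · exact hreg _ hk
    · exact hreg _ le_rfl
    · simp
  have hsim := samplerProg_sim (bounds_of_le (d := d) (B := B) h64 hd hk hℓ)
    ((Nat.le_add_right _ _).trans (Nat.le_add_right _ _)) hN
    (by nlinarith [Nat.pow_le_pow_left h64 2]) (σ := inputMemory b ℓ k x)
    (List.ofFn fun j => b.equivFun (x j)) (by simp) rfl rfl rfl rfl rfl
    (fun j h i => by
      have hj : j < M := by simpa using h
      have := inputMemory_arr_zero b ℓ k x ⟨j, hj⟩ i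
      rw [List.getElem_ofFn]
      exact this)
    (fun i => abs_inputMemory_arr_lt b ℓ k x hB 0 i)
    (fun a ha i => by simp [inputMemory, ha])
  have := hsim hbdd _ (outputCoords d) [] 0 PMF.pure fun ys _ σ' hr hw => by
    have := Ev.halted (outputCoords d) hw
    rwa [outputCoords_eq hr.1 hr.2] at this
  rwa [PMF.bind_pure, Nat.add_zero] at this

/-- The lattice vectors with the first `m` coordinate vectors of a list. -/
noncomputable def vectorsOf (b : Module.Basis (Fin d) ℤ L) (m : ℕ) (l : List (Fin d → ℤ)) :
    Fin m → L :=
  fun j => b.equivFun.symm (l.getD j 0)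

theorem outputVectors_eq (b : Module.Basis (Fin d) ℤ L) {m : ℕ} {σ : Memory}
    (h : m ≤ (outputCoords d σ).length) :
    outputVectors b m σ = vectorsOf b m (outputCoords d σ) := by
  funext j
  rw [vectorsOf, Module.Basis.equivFun_symm_apply, outputVectors]
  refine Finset.sum_congr rfl fun i _ => ?_
  have hj : (j : ℕ) < (outputCoords d σ).length := j.isLt.trans_le h
  have e : (outputCoords d σ)[(j : ℕ)] = fun i : Fin d => σ.arr 1 (((j : ℕ) : ℤ) * d + (i : ℕ)) := by
    simp [outputCoords]
  rw [List.getD_eq_getElem _ _ hj, e]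

theorem psum_map_eq_wsum_iidSamples {α β : Type} (p : PMF α) (e : α → β) (m : ℕ)
    (F : List β → ℝ≥0∞) :
    psum (p.map e) m F = wsum (iidSamples p m) fun y => F (List.ofFn fun j => e (y j)) := by
  induction m generalizing F with
  | zero => rw [iidSamples, wsum_pure, psum]; simp
  | succ m ih =>
    rw [psum, wsum_map, iidSamples, wsum_bind]
    refine wsum_congr fun a => ?_
    rw [ih, wsum_map]
    refine wsum_congr fun y => ?_
    simp [List.ofFn_succ]

theorem vectorsOf_append_ofFn (b : Module.Basis (Fin d) ℤ L) {m : ℕ} (y : Fin m → L)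
    (l : List (Fin d → ℤ)) :
    vectorsOf b m ((List.ofFn fun j => b.equivFun (y j)) ++ l) = y := by
  funext j
  rw [vectorsOf, List.getD_append _ _ _ _ (by simp), List.getD_eq_getElem _ _ (by simp)]
  simp

end input

/-! ### The law of the output on Gaussian input. -/

section output

variable {n d : ℕ} {L : Submodule ℤ (EuclideanSpace ℝ (Fin n))} [DiscreteTopology L]

/-- The output distribution on discrete Gaussian input, when the stages are non-trivial. -/
theorem samplerProg_close (b : Module.Basis (Fin d) ℤ L) {s κ : ℝ} (hs : 0 < s) (hκ : 2 ≤ κ)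
    {ℓ M m T : ℕ} (h64 : 64 ≤ M) (hn : 2 ^ n ≤ M) (hk : ⌊κ⌋₊ ≤ M) (hℓ : ℓ ≤ M)
    (hM : (32 * κ) ^ (ℓ + 1) * 2 ^ n ≤ M) (hm : (m : ℝ) ≤ 32 * κ * (2 : ℝ) ^ ((n : ℝ) / 2))
    (hT : T = max 1 ℓ * M * (2000 * (d + 1)))
    (hK : 0 < ℓ → 0 < ⌊κ⌋₊ / 512 ∧ 512 * ((⌊κ⌋₊ / 512 : ℕ) : ℝ) ≤ κ)
    (s' : ℝ) (hs' : 0 < s') (hss' : s' = stageParam s ℓ) :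
    Close ((iidSamples (discreteGaussian L s hs) M).bind fun x =>
        (run T ([samplerProg], inputMemory b ℓ ⌊κ⌋₊ x)).map fun cfg => outputVectors b m cfg.2)
      (iidSamples (discreteGaussian L s' hs') m)
      (ENNReal.ofReal (ℓ * (2 * M * Real.exp (-((⌊κ⌋₊ / 512 : ℕ) / 4))))) := by
  have hdn := rank_le_dim L b
  set K := ⌊κ⌋₊ / 512 with hKdef
  intro F hF
  -- On lists that are too short `G` takes its maximal value `1`, so it dominates the test function
  -- whatever the machine leaves in memory. On the ideal side every list has at least `m` entries
  -- and `G` agrees with the test function.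
  let G : List (Fin d → ℤ) → ℝ≥0∞ := fun l => if m ≤ l.length then F (vectorsOf b m l) else 1
  have hG : ∀ l, G l ≤ 1 := fun l => by
    simp only [G]; split_ifs
    · exact hF _
    · exact le_rfl
  have hGle : ∀ σ, F (outputVectors b m σ) ≤ G (outputCoords d σ) := fun σ => by
    simp only [G]; split_ifs with h
    · rw [outputVectors_eq b h]
    · exact hF _
  have hs0 : stageParam s 0 = s := by simp [stageParam]
  obtain ⟨ω, hω, hcl⟩ := stages_gauss_close b hs hκ hK ℓ 0 (by omega) (PMF.pure M) fun k hk => by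
    rw [PMF.mem_support_pure_iff] at hk
    subst hk
    refine ⟨le_trans (le_of_eq ?_) hM, le_rfl⟩
    have h0 := (stageMass_pos L hs 0).ne'
    have h1 := (stageMass_pos L hs 1).ne'
    rw [stageSize, Nat.sub_zero]
    field_simp
  rw [PMF.pure_bind, gaussCoord_congr b hs0 _ hs] at hcl
  have h1 : wsum ((iidSamples (discreteGaussian L s hs) M).bind fun x =>
        (run T ([samplerProg], inputMemory b ℓ ⌊κ⌋₊ x)).map fun cfg => outputVectors b m cfg.2) F ≤
      wsum ((iidList (gaussCoord b s hs) M).bind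
        (iter (fun _ => stage cosetCode vecAvg K) ℓ)) G := by
    rw [wsum_bind, wsum_bind, wsum_iidList, gaussCoord, psum_map_eq_wsum_iidSamples]
    refine wsum_mono fun x => ?_
    obtain ⟨B, hB⟩ := exists_abs_repr_lt b x
    have hev := (samplerProg_ev b h64 hn hdn hk hℓ x hB).1 T hT.ge
    rw [← hev.1, wsum_map, wsum_map]
    exact wsum_mono fun cfg => hGle _
  have h2 : wsum (ω.bind (iidList (gaussCoord b (stageParam s ℓ) (stageParam_pos hs ℓ)))) G =
      wsum (iidSamples (discreteGaussian L s' hs') m) F := by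
    rw [gaussCoord_congr b hss'.symm _ hs', wsum_bind, ← wsum_const ω (wsum _ F)]
    refine le_antisymm ?_ ?_ <;> refine wsum_mono_support fun k hk => ?_
    all_goals
      have hmk : m ≤ k := by
        have := (hm.trans (stageSize_ge b hs hκ le_rfl)).trans (hω k hk).1
        exact_mod_cast this
      obtain ⟨r, rfl⟩ := Nat.exists_eq_add_of_le hmk
      rw [wsum_iidList, psum_append]
      have e : psum (gaussCoord b s' hs') m
          (fun l => psum (gaussCoord b s' hs') r fun l' => G (l ++ l')) =
          wsum (iidSamples (discreteGaussian L s' hs') m) F := by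
        rw [gaussCoord, psum_map_eq_wsum_iidSamples]
        refine wsum_congr fun y => ?_
        rw [← psum_const' (PMF.map (⇑b.equivFun) (discreteGaussian L s' hs')) r (F y)]
        refine psum_congr fun l' _ => ?_
        simp only [G]
        rw [if_pos (by simp), vectorsOf_append_ofFn]
      first | exact e.le | exact e.ge
  calc _ ≤ _ := h1
    _ ≤ _ := hcl G hG
    _ = _ := by rw [h2]

end output

/-! ### The final statement and its constants. -/

theorem corollary3p6 :
    ∃ (prog : Prog) (P : MvPolynomial (Fin 2) ℝ) (c : ℕ) (C₁ C₂ : ℝ), 0 < C₁ ∧ 0 < C₂ ∧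
      ∀ (n d : ℕ) (L : Submodule ℤ (EuclideanSpace ℝ (Fin n))) [DiscreteTopology L]
        (b : Module.Basis (Fin d) ℤ L) (ℓ : ℕ) (κ : ℝ), 2 ≤ κ →
        ∀ M m : ℕ, M = ⌈(32 * κ) ^ (ℓ + 1) * 2 ^ n⌉₊ → m = ⌈(2 : ℝ) ^ ((n : ℝ) / 2)⌉₊ →
        -- running time and word length, for all input vectors
        (∃ T : ℕ,
          (T : ℝ) ≤ (max 1 ℓ : ℕ) * M * MvPolynomial.eval ![(n : ℝ), Real.log κ] P ∧
          (∀ x : Fin M → L, HaltsWithin prog (inputMemory b ℓ ⌊κ⌋₊ x) T ∧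
            ∀ B : ℕ, (∀ j i, |b.repr (x j) i| < 2 ^ B) →
              UsesWordLength prog (inputMemory b ℓ ⌊κ⌋₊ x) (c * (Nat.log 2 M + B))) ∧
          -- distribution of the output, for discrete Gaussian input vectors
          ∀ (s : ℝ) (hs : 0 < s),
            statDist
              ((iidSamples (discreteGaussian L s hs) M).bind fun x =>
                (run T ([prog], inputMemory b ℓ ⌊κ⌋₊ x)).map fun cfg => outputVectors b m cfg.2)
              (iidSamples
                (discreteGaussian L ((2 : ℝ) ^ (-(ℓ : ℝ) / 2) * s) (by positivity)) m) ≤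
              ℓ * M * Real.exp (C₁ * n - C₂ * κ)) ∧
        -- accumulated loss factor
        ∀ s : ℝ, 0 < s →
          (2 : ℝ) ^ (-(n : ℝ) / 2) ≤
            ∏ i ∈ Finset.range ℓ, lossFactor L ((2 : ℝ) ^ (-(i : ℝ) / 2) * s) := by
  -- The time bound needs no `log κ`: `K` enters only through loop lengths that are multiples of `K
  -- A`, and `32 K A` is at most the number of vectors in the stage.
  refine ⟨samplerProg, MvPolynomial.C 2000 * (MvPolynomial.X 0 + 1), 8, 1, 1 / 8192, by norm_num,
    by norm_num, ?_⟩
  intro n d L _ b ℓ κ hκ M m hM hm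
  have hdn := rank_le_dim L b
  have hMle : (32 * κ) ^ (ℓ + 1) * 2 ^ n ≤ M := by rw [hM]; exact Nat.le_ceil _
  have h1 : (1 : ℝ) ≤ 2 ^ n := one_le_pow₀ (by norm_num)
  have h2 : (32 * κ) ≤ (32 * κ) ^ (ℓ + 1) := le_self_pow₀ (by linarith) (by omega)
  have h3 : 32 * κ ≤ M := by nlinarith
  have h64 : 64 ≤ M := by
    have : (64 : ℝ) ≤ M := by linarith
    exact_mod_cast this
  have hn : 2 ^ n ≤ M := by
    have : (2 : ℝ) ^ n ≤ M := by nlinarith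
    exact_mod_cast this
  have hk : ⌊κ⌋₊ ≤ M := by
    have : (⌊κ⌋₊ : ℝ) ≤ M := (Nat.floor_le (by linarith)).trans (by linarith)
    exact_mod_cast this
  have hℓ : ℓ ≤ M := by
    have h4 : (2 : ℝ) ^ ℓ ≤ (32 * κ) ^ (ℓ + 1) :=
      (pow_le_pow_right₀ (by norm_num) ℓ.le_succ).trans
        (pow_le_pow_left₀ (by norm_num) (by linarith) _)
    have h5 : (2 : ℝ) ^ ℓ ≤ M := by nlinarith
    have h6 : 2 ^ ℓ ≤ M := by exact_mod_cast h5
    exact ℓ.lt_two_pow_self.le.trans h6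
  refine ⟨⟨max 1 ℓ * M * (2000 * (d + 1)), ?_, fun x => ⟨?_, fun B hB => ?_⟩, fun s hs => ?_⟩,
    fun s hs => ?_⟩
  · simp only [map_mul, map_add, MvPolynomial.eval_C, MvPolynomial.eval_X, map_one,
      Matrix.cons_val_zero]
    have : (d : ℝ) ≤ n := by exact_mod_cast hdn
    push_cast
    gcongr
  · obtain ⟨B, hB⟩ := exists_abs_repr_lt b x
    exact ((samplerProg_ev b h64 hn hdn hk hℓ x hB).1 _ le_rfl).2
  · exact (samplerProg_ev b h64 hn hdn hk hℓ x hB).2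
  · have hM64 : (64 : ℝ) ≤ M := by exact_mod_cast h64
    have hn0 : (0 : ℝ) ≤ n := n.cast_nonneg
    -- For `κ ≤ 8192` and `ℓ > 0` the claimed bound is at least `64 e^{-1} > 1`, hence trivial; this
    -- disposes of the case `K = 0`. For `ℓ = 0` no stage is run and `K` plays no role.
    by_cases hcase : 0 < ℓ ∧ κ ≤ 8192
    · refine (statDist_le_one _ _).trans ?_
      have hℓ1 : (1 : ℝ) ≤ ℓ := by exact_mod_cast hcase.1
      have h5 : Real.exp (-1) ≤ Real.exp (1 * n - 1 / 8192 * κ) := by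
        rw [Real.exp_le_exp]; linarith [hcase.2]
      have h6 : (1 : ℝ) / 3 ≤ Real.exp (-1) := by
        rw [Real.exp_neg, one_div]
        exact inv_anti₀ (Real.exp_pos 1) (Real.exp_one_lt_d9.le.trans (by norm_num))
      calc (1 : ℝ) ≤ 1 * 64 * (1 / 3) := by norm_num
        _ ≤ _ := by gcongr; exact h6.trans h5
    · have hκ' : 0 < ℓ → 8192 < κ := fun h => by
        by_contra h'
        exact hcase ⟨h, not_lt.1 h'⟩
      have hfl : (⌊κ⌋₊ : ℝ) ≤ κ := Nat.floor_le (by linarith)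
      have hfl' : κ < ⌊κ⌋₊ + 1 := Nat.lt_floor_add_one κ
      have hKle : 512 * ((⌊κ⌋₊ / 512 : ℕ) : ℝ) ≤ κ := by
        refine le_trans ?_ hfl
        exact_mod_cast Nat.mul_div_le ⌊κ⌋₊ 512
      have hKlt : κ < 512 * (((⌊κ⌋₊ / 512 : ℕ) : ℝ) + 1) := by
        refine hfl'.trans_le ?_
        exact_mod_cast Nat.lt_mul_div_succ ⌊κ⌋₊ (show 0 < 512 by norm_num)
      have hcl := samplerProg_close b hs hκ (m := m) h64 hn hk hℓ hMle (by
          have h4 : (1 : ℝ) ≤ (2 : ℝ) ^ ((n : ℝ) / 2) :=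
            Real.one_le_rpow (by norm_num) (by positivity)
          have h5 := (Nat.ceil_lt_add_one (show (0 : ℝ) ≤ (2 : ℝ) ^ ((n : ℝ) / 2) by positivity)).le
          rw [← hm] at h5
          nlinarith) rfl
        (fun h => ⟨by
          have h4 := hκ' h
          have h5 : (0 : ℝ) < ((⌊κ⌋₊ / 512 : ℕ) : ℝ) := by linarith
          exact_mod_cast h5, hKle⟩) ((2 : ℝ) ^ (-(ℓ : ℝ) / 2) * s) (by positivity)
        (rpow_mul_eq_stageParam s ℓ)
      refine (hcl.statDist_le (by positivity)).trans ?_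
      rcases Nat.eq_zero_or_pos ℓ with rfl | hpos
      · simp
      have h4 := hκ' hpos
      have h5 : (2 : ℝ) ≤ Real.exp 1 := by
        have := Real.add_one_le_exp (1 : ℝ)
        linarith
      -- The factor `2` is absorbed into `e`. Since `512 (K + 1) > κ`, the exponent `1 - K/4` is
      -- below `5/4 - κ/2048`, and this is at most `-κ/8192` once `κ > 8192`.
      have h6 : 2 * Real.exp (-(((⌊κ⌋₊ / 512 : ℕ) : ℝ) / 4)) ≤ Real.exp (1 * n - 1 / 8192 * κ) :=
        calc _ ≤ Real.exp 1 * Real.exp (-(((⌊κ⌋₊ / 512 : ℕ) : ℝ) / 4)) := by gcongr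
          _ = Real.exp (1 + -(((⌊κ⌋₊ / 512 : ℕ) : ℝ) / 4)) := (Real.exp_add _ _).symm
          _ ≤ _ := by rw [Real.exp_le_exp]; linarith
      calc (ℓ : ℝ) * (2 * M * Real.exp (-(((⌊κ⌋₊ / 512 : ℕ) : ℝ) / 4)))
          = ℓ * M * (2 * Real.exp (-(((⌊κ⌋₊ / 512 : ℕ) : ℝ) / 4))) := by ring
        _ ≤ _ := by gcongr
  · simp_rw [rpow_mul_eq_stageParam]
    exact prod_lossFactor_ge L b hs ℓ
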